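/- **Setting.** Let $G=(V,E)$ be a DAG with $n$ vertices, $m$ edges and real (positive or negative) edge weights. Number the vertices $v_1,\dots,v_n$ so that the numbering extends the topological order and the sources have the lowest numbers. For an ancestor $u$ of $v_i$, the *lexicographically-first* shortest path from $u$ to $v_i$ is the shortest path from $u$ to $v_i$ whose direct ancestor $v_j$ of $v_i$ has the least index $j$ among all direct ancestors of $v_i$ on shortest paths from $u$ to $v_i$, and whose part from $u$ to $v_j$ is the lexicographically-first shortest path from $u$ to $v_j$. Let $T_v$ be the union of the lexicographically-first shortest paths from all ancestors of $v$ to $v$, a tree with root (sink) $v$, and let $\mathrm{leaf}(T_v)$ be the set of vertices of $T_v$ that no edge of $T_v$ enters (so $\mathrm{leaf}(T_v)=\{v\}$ if $v$ is a source). **Algorithm 2.** (1) Compute such a numbering (in time $O(n+m)$); let $r$ be the number of sources. (2) Set $\mathrm{dist}(u,u)=0$ and $\mathrm{dist}(u,v)=\infty$ for $u\ne v$. (3) For $i=r+1,\dots,n$: take the set $A(v_i)$ of ancestors of $v_i$, sorted by index, and set $\mathrm{NEXT}_{v_i}(v_j)=0$ for all $v_j\in A(v_i)$; then for each $v_k\in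 A(v_i)$ in increasing order of $k$ with $\mathrm{NEXT}_{v_i}(v_k)=0$ do the following. Find the direct ancestor $v_j$ of $v_i$ that minimizes $\mathrm{dist}(v_k,v_j)+\mathrm{weight}(v_j,v_i)$, with the smallest $j$ in case of ties. Put $c=v_k$; while $c\neq v_j$ and $\mathrm{NEXT}_{v_i}(c)=0$, set $\mathrm{dist}(c,v_i)=\mathrm{dist}(c,v_j)+\mathrm{weight}(v_j,v_i)$, $\mathrm{NEXT}_{v_i}(c)=\mathrm{NEXT}_{v_j}(c)$, and replace $c$ by $\mathrm{NEXT}_{v_i}(c)$. Finally, if $\mathrm{NEXT}_{v_i}(v_j)=0$, set $\mathrm{dist}(v_j,v_i)=\mathrm{weight}(v_j,v_i)$ and $\mathrm{NEXT}_{v_i}(v_j)=v_i$. **Model.** Time is counted on a RAM with words of $O(\log n)$ bits and unit-cost word operations, extended by memory cells for elements of $\mathbb R\cup\{\infty\}$ that can be copied, added and compared at unit cost. The input is the list of the edges with their weights. Let $\omega$ be any real number such that two $n\times n$ zero-one matrices can be multiplied over the integers on this machine in time $O(n^{\omega})$. **Corollary.** Linear-time programs for step (1) exist. There is a program computing the sorted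 sets of ancestors of all vertices such that Algorithm 2, run with it and with any linear-time program for step (1), solves the all-pairs shortest paths problem for every DAG with $n\ge 1$ vertices: it computes all distances (the value $\infty$ if there is no path) and, for every $v$ and every ancestor $u$ of $v$, as $\mathrm{NEXT}_v(u)$ the head of the unique edge of $T_v$ with tail $u$. Moreover, let $n\ge 2$, and suppose that for the numbering computed by the algorithm $$\max_{v\in V}|\mathrm{leaf}(T_v)|\le a\,n^{\alpha}\qquad\text{and}\qquad \frac1n\sum_{v\in V}|\mathrm{leaf}(T_v)|\le b\,n^{\beta}.$$ Then the running time is at most $$C\cdot\Bigl(\min\{n^{\omega},\,nm+n^2\log n\}+\min\{m\,n^{\alpha},\,n^{2+\beta}\}\Bigr),$$ where $C$ depends only on the programs used and on $a$ and $b$. -/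

import Mathlib

/-! ## Edge-weighted DAGs, shortest paths and the trees `T_v` -/

/-- A DAG with vertex set `Fin n` and `m` edges `tail e ⟶ head e` carrying real weights. -/
structure RealDag (n m : ℕ) where
  tail : Fin m → Fin n
  head : Fin m → Fin n
  weight : Fin m → ℝ
  simple : Function.Injective fun e => (tail e, head e)
  acyclic : ∀ v, ¬ Relation.TransGen (fun x y => ∃ e, tail e = x ∧ head e = y) v v

namespace RealDag

variable {n m : ℕ} (G : RealDag n m)

/-- `u` is a direct ancestor of `v`. -/
def Adj (u v : Fin n) : Prop := ∃ e, G.tail e = u ∧ G.head e = v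

/-- `u` is an ancestor of `v`: there is a directed path with at least one edge from `u` to `v`. -/
def Ancestor (u v : Fin n) : Prop := Relation.TransGen G.Adj u v

/-- `v` has no direct ancestor. -/
def IsSource (v : Fin n) : Prop := ∀ e, G.head e ≠ v

/-- `p` is the list of the edges of a directed path from `u` to `v`, the last edge of the path
first. -/
def IsPath (u : Fin n) : List (Fin m) → Fin n → Prop
  | [], v => u = v
  | e :: p, v => G.head e = v ∧ IsPath u p (G.tail e)

/-- The length of a path: the sum of the weights of its edges. -/
def length (p : List (Fin m)) : ℝ := (p.map G.weight).sum

def IsShortest (u : Fin n) (p : List (Fin m)) (v : Fin n) : Prop :=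
  G.IsPath u p v ∧ ∀ q, G.IsPath u q v → G.length p ≤ G.length q

/-- `num` numbers the vertices by `1, …, n`, extends the topological partial order, and gives the
lowest numbers to the sources. -/
structure IsNumbering (num : Fin n → ℕ) : Prop where
  injective : Function.Injective num
  pos : ∀ v, 1 ≤ num v
  le : ∀ v, num v ≤ n
  lt_of_adj : ∀ u v, G.Adj u v → num u < num v
  sources_first : ∀ u v, G.IsSource u → ¬ G.IsSource v → num u < num v

/-- `p` is the lexicographically-first shortest path from `u` to `v`: the direct ancestor of `v`
on `p` has the lowest number among the direct ancestors of `v` on shortest paths from `u` to `v`,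
and the rest of `p` is again the lexicographically-first shortest path between its ends. -/
def IsLexFirst (num : Fin n → ℕ) (u : Fin n) : List (Fin m) → Fin n → Prop
  | [], v => u = v
  | e :: p, v => G.IsShortest u (e :: p) v ∧
      (∀ e' p', G.IsShortest u (e' :: p') v → num (G.tail e) ≤ num (G.tail e')) ∧
      IsLexFirst num u p (G.tail e)

/-- The edges of `T_v`, the union of the lexicographically-first shortest paths from all ancestors
of `v` to `v`. -/
def treeEdges (num : Fin n → ℕ) (v : Fin n) : Set (Fin m) :=
  {e | ∃ u p, G.Ancestor u v ∧ G.IsLexFirst num u p v ∧ e ∈ p}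

/-- The vertices of `T_v`: its root `v` and the ends of its edges. -/
def treeVerts (num : Fin n → ℕ) (v : Fin n) : Set (Fin n) :=
  {x | x = v ∨ ∃ e ∈ G.treeEdges num v, G.tail e = x ∨ G.head e = x}

/-- The leaves of `T_v`. All edges of `T_v` point towards the root, so a leaf is a vertex of `T_v`
that no edge of `T_v` enters. -/
def leaf (num : Fin n → ℕ) (v : Fin n) : Set (Fin n) :=
  {x | x ∈ G.treeVerts num v ∧ ∀ e ∈ G.treeEdges num v, G.head e ≠ x}

end RealDag

/-! ## The machine: a word RAM with additional memory for (extended) real numbers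

There are word registers and word arrays, whose cells hold natural numbers below a bound `W`, and
real registers and real arrays, whose cells hold elements of `ℝ ∪ {∞}`. Words can be used for
arithmetic, comparisons and addressing. Reals can only be copied, added and compared, and the only
real constants are `0` and `∞`. Every elementary operation takes one unit of time. -/

namespace RealRam

structure State where
  reg : ℕ → ℕ
  mem : ℕ → ℕ → ℕ
  rreg : ℕ → WithTop ℝ
  rmem : ℕ → ℕ → WithTop ℝ

/-- All words are smaller than `W`. -/
def State.Valid (W : ℕ) (s : State) : Prop := (∀ x, s.reg x < W) ∧ ∀ a i, s.mem a i < W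

/-- Expressions with a word as their value; `get a i` is the content of cell `i` of array `a`. -/
inductive WExp where
  | const (c : ℕ)
  | reg (x : ℕ)
  | get (a : ℕ) (i : WExp)
  | add (a b : WExp)
  | sub (a b : WExp)
  | mul (a b : WExp)
  | div (a b : WExp)
  | mod (a b : WExp)

namespace WExp

def val (s : State) : WExp → ℕ
  | const c => c
  | reg x => s.reg x
  | get a i => s.mem a (i.val s)
  | add a b => a.val s + b.val s
  | sub a b => a.val s - b.val s
  | mul a b => a.val s * b.val s
  | div a b => a.val s / b.val s
  | mod a b => a.val s % b.val s

/-- No overflow occurs in the evaluation: all values are smaller than `W`. -/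
def Fits (W : ℕ) (s : State) : WExp → Prop
  | const c => c < W
  | reg x => s.reg x < W
  | get a i => i.Fits W s ∧ s.mem a (i.val s) < W
  | add a b => a.Fits W s ∧ b.Fits W s ∧ a.val s + b.val s < W
  | sub a b => a.Fits W s ∧ b.Fits W s
  | mul a b => a.Fits W s ∧ b.Fits W s ∧ a.val s * b.val s < W
  | div a b => a.Fits W s ∧ b.Fits W s
  | mod a b => a.Fits W s ∧ b.Fits W s

/-- The time for the evaluation. -/
def cost : WExp → ℕ
  | const _ => 1
  | reg _ => 1
  | get _ i => i.cost + 1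
  | add a b => a.cost + b.cost + 1
  | sub a b => a.cost + b.cost + 1
  | mul a b => a.cost + b.cost + 1
  | div a b => a.cost + b.cost + 1
  | mod a b => a.cost + b.cost + 1

end WExp

/-- Expressions with a real number or `∞` as their value. -/
inductive RExp where
  | zero
  | top
  | reg (x : ℕ)
  | get (a : ℕ) (i : WExp)
  | add (a b : RExp)

namespace RExp

def val (s : State) : RExp → WithTop ℝ
  | zero => 0
  | top => ⊤
  | reg x => s.rreg x
  | get a i => s.rmem a (i.val s)
  | add a b => a.val s + b.val s

def Fits (W : ℕ) (s : State) : RExp → Prop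
  | zero => True
  | top => True
  | reg _ => True
  | get _ i => i.Fits W s
  | add a b => a.Fits W s ∧ b.Fits W s

def cost : RExp → ℕ
  | zero => 1
  | top => 1
  | reg _ => 1
  | get _ i => i.cost + 1
  | add a b => a.cost + b.cost + 1

end RExp

/-- Tests. -/
inductive Cond where
  | lt (a b : WExp)
  | eq (a b : WExp)
  | rlt (a b : RExp)
  | req (a b : RExp)
  | not (c : Cond)
  | and (c d : Cond)
  | or (c d : Cond)

namespace Cond

def Holds (s : State) : Cond → Prop
  | lt a b => a.val s < b.val s
  | eq a b => a.val s = b.val s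
  | rlt a b => a.val s < b.val s
  | req a b => a.val s = b.val s
  | not c => ¬ c.Holds s
  | and c d => c.Holds s ∧ d.Holds s
  | or c d => c.Holds s ∨ d.Holds s

def Fits (W : ℕ) (s : State) : Cond → Prop
  | lt a b => a.Fits W s ∧ b.Fits W s
  | eq a b => a.Fits W s ∧ b.Fits W s
  | rlt a b => a.Fits W s ∧ b.Fits W s
  | req a b => a.Fits W s ∧ b.Fits W s
  | not c => c.Fits W s
  | and c d => c.Fits W s ∧ d.Fits W s
  | or c d => c.Fits W s ∧ d.Fits W s

def cost : Cond → ℕ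
  | lt a b => a.cost + b.cost + 1
  | eq a b => a.cost + b.cost + 1
  | rlt a b => a.cost + b.cost + 1
  | req a b => a.cost + b.cost + 1
  | not c => c.cost + 1
  | and c d => c.cost + d.cost + 1
  | or c d => c.cost + d.cost + 1

end Cond

/-- Programs. -/
inductive Prog where
  | skip
  | set (x : ℕ) (e : WExp)
  | put (a : ℕ) (i e : WExp)
  | rset (x : ℕ) (e : RExp)
  | rput (a : ℕ) (i : WExp) (e : RExp)
  | seq (p q : Prog)
  | branch (c : Cond) (p q : Prog)
  | loop (c : Cond) (p : Prog)

namespace State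

def setReg (s : State) (x v : ℕ) : State := { s with reg := Function.update s.reg x v }

def setMem (s : State) (a i v : ℕ) : State :=
  { s with mem := Function.update s.mem a (Function.update (s.mem a) i v) }

def setRreg (s : State) (x : ℕ) (v : WithTop ℝ) : State :=
  { s with rreg := Function.update s.rreg x v }

def setRmem (s : State) (a i : ℕ) (v : WithTop ℝ) : State :=
  { s with rmem := Function.update s.rmem a (Function.update (s.rmem a) i v) }

end State

/-- `Exec W p s s' t`: on the machine with word bound `W`, the program `p` started in the state `s`
halts after time `t` in the state `s'`, and no overflow occurs. -/
inductive Exec (W : ℕ) : Prog → State → State → ℕ → Prop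
  | skip (s) : Exec W .skip s s 1
  | set (s x e) : e.Fits W s → Exec W (.set x e) s (s.setReg x (e.val s)) (e.cost + 1)
  | put (s a i e) : i.Fits W s → e.Fits W s →
      Exec W (.put a i e) s (s.setMem a (i.val s) (e.val s)) (i.cost + e.cost + 1)
  | rset (s x e) : e.Fits W s → Exec W (.rset x e) s (s.setRreg x (e.val s)) (e.cost + 1)
  | rput (s a i e) : i.Fits W s → e.Fits W s →
      Exec W (.rput a i e) s (s.setRmem a (i.val s) (e.val s)) (i.cost + e.cost + 1)
  | seq {p q s s₁ s₂ t₁ t₂} : Exec W p s s₁ t₁ → Exec W q s₁ s₂ t₂ →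
      Exec W (.seq p q) s s₂ (t₁ + t₂)
  | branch_true {c p q s s₁ t} : c.Fits W s → c.Holds s → Exec W p s s₁ t →
      Exec W (.branch c p q) s s₁ (c.cost + 1 + t)
  | branch_false {c p q s s₁ t} : c.Fits W s → ¬ c.Holds s → Exec W q s s₁ t →
      Exec W (.branch c p q) s s₁ (c.cost + 1 + t)
  | loop_done {c p s} : c.Fits W s → ¬ c.Holds s → Exec W (.loop c p) s s (c.cost + 1)
  | loop_step {c p s s₁ s₂ t₁ t₂} : c.Fits W s → c.Holds s → Exec W p s s₁ t₁ →
      Exec W (.loop c p) s₁ s₂ t₂ → Exec W (.loop c p) s s₂ (c.cost + 1 + t₁ + t₂)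

/-- Sequential composition of a list of programs. -/
def Prog.block : List Prog → Prog
  | [] => .skip
  | [p] => p
  | p :: q :: l => .seq p (block (q :: l))

/-- `for x = lo, …, hi - 1 do p`. -/
def Prog.forUp (x : ℕ) (lo hi : WExp) (p : Prog) : Prog :=
  .seq (.set x lo)
    (.loop (.lt (.reg x) hi) (.seq p (.set x (.add (.reg x) (.const 1)))))

/-- `n × n` matrices can be multiplied in time `O(n ^ ω)`: some program computes the product (over
the integers) of any two `n × n` matrices with entries `0` and `1` in that time, with words of
`O(log n)` bits, whatever the other memory cells contain. The matrices are stored row by row, the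
factors in arrays `0` and `1`, the product in array `2`; register `0` holds `n`. -/
def MatMulTime (ω : ℝ) : Prop :=
  ∃ (mm : Prog) (C : ℝ) (κ : ℕ), ∀ n : ℕ, 1 ≤ n → ∀ W : ℕ, (n + 2) ^ κ ≤ W →
    ∀ (A B : Matrix (Fin n) (Fin n) ℕ) (s : State), s.Valid W →
      (∀ i j, A i j ≤ 1) → (∀ i j, B i j ≤ 1) → s.reg 0 = n →
      (∀ i j : Fin n, s.mem 0 (i * n + j) = A i j) →
      (∀ i j : Fin n, s.mem 1 (i * n + j) = B i j) →
      ∃ s' t, Exec W mm s s' t ∧ (∀ i j : Fin n, s'.mem 2 (i * n + j) = (A * B) i j) ∧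
        (t : ℝ) ≤ C * (n : ℝ) ^ ω

end RealRam

/-! ## The algorithm

Word registers: `0`: `n`, `1`: `m`, `2`: the number `r` of sources, `3`: `i`, `4`: a position in
the list of the ancestors of `v_i`, `5`: `k`, `6`: `j`, `7`: an edge, `8`: the number of
`v_current`, `9`: scratch.

Word arrays: `0`: tails of the edges, `1`: heads, `2`: the numbers of the vertices, `3`: sizes of
the ancestor sets, `4`: the ancestor sets, `5`, `6`: linked lists of the edges entering each vertex
(an edge `e` is stored there as `e + 1`, and `0` ends a list), `7`: the table `NEXT`.

Real registers: `0`: the current minimum, `1`: scratch, `2`: `weight(v_j, v_i)`.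

Real arrays: `0`: edge weights, `1`: the table `dist`. -/

namespace Apsp

open RealRam

/-- The position of the entry `(x, y)` of a table with indices up to `n`, as an expression. -/
def at2 (x y : WExp) : WExp := .add (.mul x (.add (.reg 0) (.const 1))) y

/-- `NEXT_{v_y}(v_x)`. -/
def nextE (x y : WExp) : WExp := .get 7 (at2 x y)

/-- `dist(v_x, v_y)`. -/
def distE (x y : WExp) : RExp := .get 1 (at2 x y)

/-- The `p`-th ancestor of `v_x` in increasing order. -/
def ancE (x p : WExp) : WExp := .get 4 (at2 x p)

/-- `dist(u, u) = 0` and `dist(u, v) = ∞` for `u ≠ v`. -/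
def initDist : Prog :=
  .forUp 3 (.const 1) (.add (.reg 0) (.const 1)) <| .block [
    .forUp 6 (.const 1) (.add (.reg 0) (.const 1)) (.rput 1 (at2 (.reg 3) (.reg 6)) .top),
    .rput 1 (at2 (.reg 3) (.reg 3)) .zero]

/-- The lists of the edges entering each vertex. -/
def inLists : Prog := .block [
  .forUp 3 (.const 1) (.add (.reg 0) (.const 1)) (.put 5 (.reg 3) (.const 0)),
  .forUp 7 (.const 0) (.reg 1) <| .block [
    .set 9 (.get 2 (.get 1 (.reg 7))),
    .put 6 (.reg 7) (.get 5 (.reg 9)),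
    .put 5 (.reg 9) (.add (.reg 7) (.const 1))]]

/-- `NEXT_{v_i}(v_j) = 0` for all ancestors `v_j` of `v_i`. -/
def initNext : Prog :=
  .forUp 4 (.const 0) (.get 3 (.reg 3)) (.put 7 (at2 (ancE (.reg 3) (.reg 4)) (.reg 3)) (.const 0))

/-- Find the direct ancestor `v_j` of `v_i` that minimizes `dist(v_k, v_j) + weight(v_j, v_i)`, the
one with the smallest index in case of ties. -/
def findDirect : Prog := .block [
  .rset 0 .top,
  .set 6 (.const 0),
  .set 7 (.get 5 (.reg 3)),
  .loop (.not (.eq (.reg 7) (.const 0))) <| .block [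
    .set 9 (.get 2 (.get 0 (.sub (.reg 7) (.const 1)))),
    .rset 1 (.add (distE (.reg 5) (.reg 9)) (.get 0 (.sub (.reg 7) (.const 1)))),
    .branch (.or (.rlt (.reg 1) (.reg 0)) (.and (.req (.reg 1) (.reg 0)) (.lt (.reg 9) (.reg 6))))
      (.block [
        .rset 0 (.reg 1),
        .set 6 (.reg 9),
        .rset 2 (.get 0 (.sub (.reg 7) (.const 1)))])
      .skip,
    .set 7 (.get 6 (.sub (.reg 7) (.const 1)))]]

/-- Add the missing initial fragment of the path from `v_k` to `v_i` through `v_j`. -/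
def addFragment : Prog := .block [
  .set 8 (.reg 5),
  .loop (.and (.not (.eq (.reg 8) (.reg 6))) (.eq (nextE (.reg 8) (.reg 3)) (.const 0))) <| .block [
    .rput 1 (at2 (.reg 8) (.reg 3)) (.add (distE (.reg 8) (.reg 6)) (.reg 2)),
    .put 7 (at2 (.reg 8) (.reg 3)) (nextE (.reg 8) (.reg 6)),
    .set 8 (nextE (.reg 8) (.reg 3))],
  .branch (.eq (nextE (.reg 6) (.reg 3)) (.const 0))
    (.block [
      .rput 1 (at2 (.reg 6) (.reg 3)) (.reg 2),
      .put 7 (at2 (.reg 6) (.reg 3)) (.reg 3)])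
    .skip]

/-- The algorithm, with a subroutine `number` that numbers the vertices and a subroutine
`ancestors` that finds the sorted sets of ancestors. -/
def algorithm2 (number ancestors : Prog) : Prog := .block [
  number,
  ancestors,
  initDist,
  inLists,
  .forUp 3 (.add (.reg 2) (.const 1)) (.add (.reg 0) (.const 1)) <| .block [
    initNext,
    .forUp 4 (.const 0) (.get 3 (.reg 3)) <| .block [
      .set 5 (ancE (.reg 3) (.reg 4)),
      .branch (.eq (nextE (.reg 5) (.reg 3)) (.const 0))
        (.block [findDirect, addFragment])
        .skip]]]

variable {n m : ℕ}

/-- The memory holds `G` as a list of edges. -/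
structure HoldsGraph (G : RealDag n m) (s : State) : Prop where
  size : s.reg 0 = n
  edges : s.reg 1 = m
  tail : ∀ e : Fin m, s.mem 0 e = G.tail e
  head : ∀ e : Fin m, s.mem 1 e = G.head e
  weight : ∀ e : Fin m, s.rmem 0 e = (G.weight e : WithTop ℝ)

/-- The memory holds a numbering of the vertices of `G` and the number of sources. -/
structure HoldsNumbering (G : RealDag n m) (num : Fin n → ℕ) (s : State) : Prop where
  numbering : G.IsNumbering num
  number : ∀ v : Fin n, s.mem 2 v = num v
  sources : s.reg 2 = {v | G.IsSource v}.ncard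

/-- The memory holds, for each vertex, the increasing list of the numbers of its ancestors. -/
structure HoldsAncestors (G : RealDag n m) (num : Fin n → ℕ) (s : State) : Prop where
  sorted : ∀ (v : Fin n) (p q : ℕ), p < q → q < s.mem 3 (num v) →
    s.mem 4 (num v * (n + 1) + p) < s.mem 4 (num v * (n + 1) + q)
  mem_iff : ∀ (v : Fin n) (x : ℕ), (∃ p < s.mem 3 (num v), s.mem 4 (num v * (n + 1) + p) = x) ↔
    ∃ u, G.Ancestor u v ∧ num u = x

/-- The memory holds the solution of the all-pairs shortest paths problem for `G`: the distances in
the table `dist`, with `∞` for the pairs without a path, and the trees `T_v` in the tables `NEXT_v`,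
where `NEXT_v(u)` is the head of the unique edge of `T_v` with tail `u`. -/
structure HoldsSolution (G : RealDag n m) (num : Fin n → ℕ) (s : State) : Prop where
  dist : ∀ (u v : Fin n) (p : List (Fin m)), G.IsShortest u p v →
    s.rmem 1 (num u * (n + 1) + num v) = (G.length p : WithTop ℝ)
  dist_top : ∀ u v : Fin n, u ≠ v → ¬ G.Ancestor u v → s.rmem 1 (num u * (n + 1) + num v) = ⊤
  next : ∀ u v : Fin n, G.Ancestor u v → ∃ e ∈ G.treeEdges num v, G.tail e = u ∧
    (∀ e' ∈ G.treeEdges num v, G.tail e' = u → e' = e) ∧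
    s.mem 7 (num u * (n + 1) + num v) = num (G.head e)

/-- `p` numbers the vertices of any DAG in linear time. -/
def NumbersVertices (p : Prog) : Prop :=
  ∃ (C : ℝ) (κ : ℕ), ∀ (n m : ℕ) (G : RealDag n m), 1 ≤ n → ∀ W : ℕ, (n + 2) ^ κ ≤ W →
    ∀ s : State, s.Valid W → HoldsGraph G s →
      ∃ num s' t, Exec W p s s' t ∧ HoldsGraph G s' ∧ HoldsNumbering G num s' ∧
        (t : ℝ) ≤ C * ((n : ℝ) + m)

/-- `p` finds the sorted sets of ancestors in any DAG with numbered vertices. -/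
def FindsAncestors (p : Prog) : Prop :=
  ∃ κ : ℕ, ∀ (n m : ℕ) (G : RealDag n m) (num : Fin n → ℕ), 1 ≤ n → ∀ W : ℕ, (n + 2) ^ κ ≤ W →
    ∀ s : State, s.Valid W → HoldsGraph G s → HoldsNumbering G num s →
      ∃ s' t, Exec W p s s' t ∧ HoldsGraph G s' ∧ HoldsNumbering G num s' ∧
        HoldsAncestors G num s'

end Apsp

/-! Correctness of the search rests on one exchange argument: what remains of a
lexicographically-first shortest path after removing an initial part is again lexicographically
first (`IsLexFirst.suffix`). Hence an edge of `T_v` is the first edge of the path from its own tail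
(`mem_treeEdges_iff`), and `T_v` is recorded by the function `nxt`. If the path from `u` to `v`
enters `v` from `v_j`, then so do the paths from all later vertices up to `v_j`
(`IsParent.parent_nxt`, `IsParent.parent_tail`), and before `v_j` the path follows the tree of `v_j`
(`IsParent.nxt_of_ne`). One search for `v_j` therefore serves a whole fragment, whose entries are
copied from finished columns of the tables.

The running time of the search is a charging argument. The vertices with a known entry are closed
under `nxt` (`NextClosed`), and ancestors are visited in increasing order. If `u` is still unknown
at its turn, then no tree edge can enter `u`: its tail would have a smaller number, would already be
known, and closedness would make `u` known. So `u` is a leaf (`mem_leaf_of_ancestor`), and the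
search over the edges into `v` takes place at most once per leaf of `T_v`. Copying costs a constant
per new entry (`unset` is the potential in `addFragment_run`). Altogether the search costs `O(n² +
m)` plus the sum of in-degree times number of leaves (`searchPart_run`), and the two leaf bounds
follow because the in-degrees sum to `m` and none exceeds `n`.

For the ancestors, the relation between the numbers of the vertices increases the index. Its closure
is built in blocks of doubling size `b`, with two matrix products per block (`Prog.join_run`). With
product time at most `ρ * b ^ 2` the levels form a geometric series, so that no logarithm is lost
(`Prog.closure_run`). Such a `ρ` exists because the exponent is at least `2`: a multiplication
program has to write all entries of the product (`sq_le_of_multiplies`, `two_le_of_sq_le`).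
Alternatively, columns of the closure are added along the edges in time `O(n m + n²)`
(`Prog.columns_run`).

A program cannot know which method is faster, since the multiplication program and the exponent are
arbitrary. Therefore the closure is run with a fuel counter worth `n m + n² + 1` units
(`Exec.clock`), and the columns are used only if the fuel is exhausted; this attains the minimum up
to a constant (`reachability_run`). Since the multiplication program may overwrite anything it
mentions, the input is saved in locations beyond all names occurring in it (`Prog.exists_bound`),
and restored afterwards.

The linear-time numbering is the usual queue of vertices whose direct ancestors have all been
processed (`kahn`). The program logic gives total correctness with exact time accounting; a
syntactic frame rule takes care of everything a program does not write. -/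

/-! ## Program logic for the word RAM -/

namespace RealRam

/-! ### Overflow and validity -/

/-- The part of `Fits` that does not already follow from the validity of the state. -/
def WExp.Safe (W : ℕ) (s : State) : WExp → Prop
  | const c => c < W
  | reg _ => True
  | get _ i => i.Safe W s
  | add a b => a.Safe W s ∧ b.Safe W s ∧ a.val s + b.val s < W
  | sub a b => a.Safe W s ∧ b.Safe W s
  | mul a b => a.Safe W s ∧ b.Safe W s ∧ a.val s * b.val s < W
  | div a b => a.Safe W s ∧ b.Safe W s
  | mod a b => a.Safe W s ∧ b.Safe W s

def RExp.Safe (W : ℕ) (s : State) : RExp → Prop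
  | zero => True
  | top => True
  | reg _ => True
  | get _ i => i.Safe W s
  | add a b => a.Safe W s ∧ b.Safe W s

def Cond.Safe (W : ℕ) (s : State) : Cond → Prop
  | lt a b => a.Safe W s ∧ b.Safe W s
  | eq a b => a.Safe W s ∧ b.Safe W s
  | rlt a b => a.Safe W s ∧ b.Safe W s
  | req a b => a.Safe W s ∧ b.Safe W s
  | not c => c.Safe W s
  | and c d => c.Safe W s ∧ d.Safe W s
  | or c d => c.Safe W s ∧ d.Safe W s

variable {W : ℕ} {s : State}

theorem WExp.Safe.fits (hs : s.Valid W) {e : WExp} (h : e.Safe W s) : e.Fits W s := by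
  induction e with
  | const c => exact h
  | reg x => exact hs.1 x
  | get a i ih => exact ⟨ih h, hs.2 _ _⟩
  | add a b iha ihb => exact ⟨iha h.1, ihb h.2.1, h.2.2⟩
  | mul a b iha ihb => exact ⟨iha h.1, ihb h.2.1, h.2.2⟩
  | sub a b iha ihb => exact ⟨iha h.1, ihb h.2⟩
  | div a b iha ihb => exact ⟨iha h.1, ihb h.2⟩
  | mod a b iha ihb => exact ⟨iha h.1, ihb h.2⟩

theorem RExp.Safe.fits (hs : s.Valid W) {e : RExp} (h : e.Safe W s) : e.Fits W s := by
  induction e with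
  | zero => trivial
  | top => trivial
  | reg x => trivial
  | get a i => exact WExp.Safe.fits hs h
  | add a b iha ihb => exact ⟨iha h.1, ihb h.2⟩

theorem Cond.Safe.fits (hs : s.Valid W) {c : Cond} (h : c.Safe W s) : c.Fits W s := by
  induction c with
  | lt a b => exact ⟨h.1.fits hs, h.2.fits hs⟩
  | eq a b => exact ⟨h.1.fits hs, h.2.fits hs⟩
  | rlt a b => exact ⟨h.1.fits hs, h.2.fits hs⟩
  | req a b => exact ⟨h.1.fits hs, h.2.fits hs⟩
  | not c ih => exact ih h
  | and c d ihc ihd => exact ⟨ihc h.1, ihd h.2⟩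
  | or c d ihc ihd => exact ⟨ihc h.1, ihd h.2⟩

theorem WExp.Fits.val_lt {e : WExp} (h : e.Fits W s) : e.val s < W := by
  induction e with
  | const c => exact h
  | reg x => exact h
  | get a i ih => exact h.2
  | add a b iha ihb => exact h.2.2
  | mul a b iha ihb => exact h.2.2
  | sub a b iha ihb => exact (Nat.sub_le _ _).trans_lt (iha h.1)
  | div a b iha ihb => exact (Nat.div_le_self _ _).trans_lt (iha h.1)
  | mod a b iha ihb => exact (Nat.mod_le _ _).trans_lt (iha h.1)

namespace State

@[simp] theorem setReg_reg (x v y : ℕ) : (s.setReg x v).reg y = if y = x then v else s.reg y := by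
  simp [setReg, Function.update_apply]
@[simp] theorem setReg_mem (x v : ℕ) : (s.setReg x v).mem = s.mem := rfl
@[simp] theorem setReg_rreg (x v : ℕ) : (s.setReg x v).rreg = s.rreg := rfl
@[simp] theorem setReg_rmem (x v : ℕ) : (s.setReg x v).rmem = s.rmem := rfl
@[simp] theorem setMem_reg (a i v : ℕ) : (s.setMem a i v).reg = s.reg := rfl
@[simp] theorem setMem_mem (a i v b j : ℕ) :
    (s.setMem a i v).mem b j = if b = a ∧ j = i then v else s.mem b j := by
  by_cases h : b = a
  · subst h; simp [setMem, Function.update_apply]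
  · simp [setMem, h]
@[simp] theorem setMem_mem_ne (a i v b : ℕ) (h : b ≠ a) : (s.setMem a i v).mem b = s.mem b := by
  simp [setMem, h]
@[simp] theorem setMem_rreg (a i v : ℕ) : (s.setMem a i v).rreg = s.rreg := rfl
@[simp] theorem setMem_rmem (a i v : ℕ) : (s.setMem a i v).rmem = s.rmem := rfl
@[simp] theorem setRreg_reg (x : ℕ) (v : WithTop ℝ) : (s.setRreg x v).reg = s.reg := rfl
@[simp] theorem setRreg_mem (x : ℕ) (v : WithTop ℝ) : (s.setRreg x v).mem = s.mem := rfl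
@[simp] theorem setRreg_rreg (x : ℕ) (v : WithTop ℝ) (y : ℕ) :
    (s.setRreg x v).rreg y = if y = x then v else s.rreg y := by
  simp [setRreg, Function.update_apply]
@[simp] theorem setRreg_rmem (x : ℕ) (v : WithTop ℝ) : (s.setRreg x v).rmem = s.rmem := rfl
@[simp] theorem setRmem_reg (a i : ℕ) (v : WithTop ℝ) : (s.setRmem a i v).reg = s.reg := rfl
@[simp] theorem setRmem_mem (a i : ℕ) (v : WithTop ℝ) : (s.setRmem a i v).mem = s.mem := rfl
@[simp] theorem setRmem_rreg (a i : ℕ) (v : WithTop ℝ) : (s.setRmem a i v).rreg = s.rreg := rfl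
@[simp] theorem setRmem_rmem (a i : ℕ) (v : WithTop ℝ) (b j : ℕ) :
    (s.setRmem a i v).rmem b j = if b = a ∧ j = i then v else s.rmem b j := by
  by_cases h : b = a
  · subst h; simp [setRmem, Function.update_apply]
  · simp [setRmem, h]

theorem Valid.setReg (hs : s.Valid W) {x v : ℕ} (hv : v < W) : (s.setReg x v).Valid W :=
  ⟨fun y => by rw [setReg_reg]; split_ifs <;> [exact hv; exact hs.1 y], hs.2⟩

theorem Valid.setMem (hs : s.Valid W) {a i v : ℕ} (hv : v < W) : (s.setMem a i v).Valid W :=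
  ⟨hs.1, fun b j => by rw [setMem_mem]; split_ifs <;> [exact hv; exact hs.2 b j]⟩

end State

theorem Exec.valid {p : Prog} {s' : State} {t : ℕ} (h : Exec W p s s' t) (hs : s.Valid W) :
    s'.Valid W := by
  induction h with
  | skip s => exact hs
  | set s x e he => exact hs.setReg he.val_lt
  | put s a i e hi he => exact hs.setMem he.val_lt
  | rset s x e he => exact hs
  | rput s a i e hi he => exact hs
  | seq _ _ ih1 ih2 => exact ih2 (ih1 hs)
  | branch_true _ _ _ ih => exact ih hs
  | branch_false _ _ _ ih => exact ih hs
  | loop_done => exact hs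
  | loop_step _ _ _ _ ih1 ih2 => exact ih2 (ih1 hs)

/-! ### Total correctness -/

/-- Started in the state `s`, which is valid, the program `p` halts in a state `s'` after time `t`
such that `Q s' t`. -/
def Run (W : ℕ) (p : Prog) (s : State) (Q : State → ℕ → Prop) : Prop :=
  s.Valid W → ∃ s' t, Exec W p s s' t ∧ s'.Valid W ∧ Q s' t

variable {Q Q' : State → ℕ → Prop}

theorem Run.mono {p : Prog} (h : Run W p s Q) (hQ : ∀ s' t, s'.Valid W → Q s' t → Q' s' t) :
    Run W p s Q' := fun hs => by
  obtain ⟨s', t, h1, h2, h3⟩ := h hs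
  exact ⟨s', t, h1, h2, hQ _ _ h2 h3⟩

theorem Run.seq {p q : Prog} (h : Run W p s fun s₁ t₁ => Run W q s₁ fun s₂ t₂ => Q s₂ (t₁ + t₂)) :
    Run W (.seq p q) s Q := fun hs => by
  obtain ⟨s₁, t₁, e₁, v₁, h₁⟩ := h hs
  obtain ⟨s₂, t₂, e₂, v₂, h₂⟩ := h₁ v₁
  exact ⟨s₂, _, e₁.seq e₂, v₂, h₂⟩

/-- A sufficient condition for `Run W p s Q`, in which loops are left alone. -/
def wp (W : ℕ) : Prog → State → (State → ℕ → Prop) → Prop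
  | .skip, s, Q => Q s 1
  | .set x e, s, Q => e.Safe W s ∧ Q (s.setReg x (e.val s)) (e.cost + 1)
  | .put a i e, s, Q => i.Safe W s ∧ e.Safe W s ∧
      Q (s.setMem a (i.val s) (e.val s)) (i.cost + e.cost + 1)
  | .rset x e, s, Q => e.Safe W s ∧ Q (s.setRreg x (e.val s)) (e.cost + 1)
  | .rput a i e, s, Q => i.Safe W s ∧ e.Safe W s ∧
      Q (s.setRmem a (i.val s) (e.val s)) (i.cost + e.cost + 1)
  | .seq p q, s, Q => wp W p s fun s₁ t₁ => wp W q s₁ fun s₂ t₂ => Q s₂ (t₁ + t₂)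
  | .branch c p q, s, Q => c.Safe W s ∧ (c.Holds s → wp W p s fun s' t => Q s' (c.cost + 1 + t)) ∧
      (¬ c.Holds s → wp W q s fun s' t => Q s' (c.cost + 1 + t))
  | .loop c p, s, Q => Run W (.loop c p) s Q

theorem Run.of_wp {p : Prog} (h : wp W p s Q) : Run W p s Q := by
  induction p generalizing s Q with
  | skip => exact fun hs => ⟨s, _, .skip s, hs, h⟩
  | set x e =>
    exact fun hs => ⟨_, _, .set s x e (h.1.fits hs), hs.setReg (h.1.fits hs).val_lt, h.2⟩
  | put a i e =>
    exact fun hs => ⟨_, _, .put s a i e (h.1.fits hs) (h.2.1.fits hs),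
      hs.setMem (h.2.1.fits hs).val_lt, h.2.2⟩
  | rset x e => exact fun hs => ⟨_, _, .rset s x e (h.1.fits hs), hs, h.2⟩
  | rput a i e =>
    exact fun hs => ⟨_, _, .rput s a i e (h.1.fits hs) (h.2.1.fits hs), hs, h.2.2⟩
  | seq p q ihp ihq => exact .seq ((ihp h).mono fun s₁ t₁ _ h₁ => ihq h₁)
  | branch c p q ihp ihq =>
    intro hs
    by_cases hc : c.Holds s
    · obtain ⟨s', t, h1, h2, h3⟩ := ihp (h.2.1 hc) hs
      exact ⟨s', _, .branch_true (h.1.fits hs) hc h1, h2, h3⟩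
    · obtain ⟨s', t, h1, h2, h3⟩ := ihq (h.2.2 hc) hs
      exact ⟨s', _, .branch_false (h.1.fits hs) hc h1, h2, h3⟩
  | loop c p => exact h

/-- The index `k` of the invariant is a variant that decreases in every round, which yields
termination. The last argument of the invariant is the time elapsed since the loop was entered, so
time bounds are proved as part of the invariant. -/
theorem Run.loop {c : Cond} {p : Prog} (I : ℕ → State → ℕ → Prop) (k : ℕ) (h0 : I k s 0)
    (hstep : ∀ k s t, s.Valid W → I k s t → c.Safe W s ∧ (¬ c.Holds s → Q s (t + (c.cost + 1))) ∧
      (c.Holds s → Run W p s fun s' t' => ∃ k' < k, I k' s' (t + (c.cost + 1 + t')))) :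
    Run W (.loop c p) s Q := by
  suffices H : ∀ k s t₀, I k s t₀ → s.Valid W →
      ∃ s' t, Exec W (.loop c p) s s' t ∧ s'.Valid W ∧ Q s' (t₀ + t) by
    intro hs
    simpa using H _ s 0 h0 hs
  intro k
  induction k using Nat.strong_induction_on with
  | _ k ih =>
    intro s t₀ hI hs
    obtain ⟨h1, h2, h3⟩ := hstep k s t₀ hs hI
    by_cases hc : c.Holds s
    · obtain ⟨s₁, t₁, e₁, v₁, k', hk, hI₁⟩ := h3 hc hs
      obtain ⟨s₂, t₂, e₂, v₂, hQ⟩ := ih k' hk s₁ _ hI₁ v₁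
      refine ⟨s₂, _, .loop_step (h1.fits hs) hc e₁ e₂, v₂, ?_⟩
      convert hQ using 1
      omega
    · exact ⟨s, _, .loop_done (h1.fits hs) hc, hs, h2 hc⟩

/-- The loop of a counting loop, after the counter has been set. -/
theorem Run.forUp {x : ℕ} {hi : WExp} {p : Prog} {lo : ℕ} (H : ℕ) (I : ℕ → State → ℕ → Prop)
    (hle : lo ≤ H) (hreg : s.reg x = lo) (h0 : I lo s 0)
    (hhi : ∀ k s t, lo ≤ k → k ≤ H → s.reg x = k → I k s t → hi.Safe W s ∧ hi.val s = H)
    (hbody : ∀ k s t, s.Valid W → lo ≤ k → k < H → k + 1 < W → s.reg x = k → I k s t →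
      wp W p s fun s' t' =>
        s'.reg x = k ∧ I (k + 1) (s'.setReg x (k + 1)) (t + (t' + (hi.cost + 7))))
    (hQ : ∀ s t, s.Valid W → s.reg x = H → I H s t → Q s (t + (hi.cost + 3))) :
    Run W (.loop (.lt (.reg x) hi) (.seq p (.set x (.add (.reg x) (.const 1))))) s Q := by
  -- The variant is the number of rounds left. A round costs `hi.cost + 7` beyond the body: `hi.cost
  -- + 3` for the test and `4` for the increment; the failing test at the end costs `hi.cost + 3`.
  refine Run.loop (fun k s t => k = H - s.reg x ∧ lo ≤ s.reg x ∧ s.reg x ≤ H ∧ I (s.reg x) s t)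
    _ ⟨rfl, hreg.ge, hreg ▸ hle, hreg ▸ h0⟩ ?_
  rintro k s t hs ⟨rfl, h1, h2, h3⟩
  obtain ⟨hsafe, hval⟩ := hhi _ s t h1 h2 rfl h3
  -- The upper limit is the value of an expression that fits into a word, so the counter, being
  -- below it, can be incremented without overflow.
  have hHW : H < W := hval ▸ (hsafe.fits hs).val_lt
  refine ⟨⟨trivial, hsafe⟩, ?_, ?_⟩
  · intro hc
    simp only [Cond.Holds, WExp.val, hval, not_lt] at hc
    have : s.reg x = H := le_antisymm h2 hc
    have := hQ s t hs this (this ▸ h3)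
    convert this using 1
    simp [Cond.cost, WExp.cost]; omega
  · intro hc
    simp only [Cond.Holds, WExp.val, hval] at hc
    refine .seq ((Run.of_wp (hbody _ s t hs h1 hc (by omega) rfl h3)).mono ?_)
    rintro s' t' hs' ⟨hr, hI⟩
    refine Run.of_wp ?_
    simp only [wp, WExp.Safe, WExp.val, hr, State.setReg_reg, Cond.cost, WExp.cost]
    refine ⟨⟨trivial, by omega, by omega⟩, _, by simp; omega, rfl, by simp; omega,
      by simp; omega, ?_⟩
    simp only [if_true]
    convert hI using 1
    omega

/-- A loop that fills cells of a word array. -/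
theorem Run.fill {x a : ℕ} {hi i e : WExp} (H : ℕ) (f g : ℕ → ℕ) (hreg : s.reg x = 0)
    (hinj : ∀ k < H, ∀ l < H, f k = f l → k = l)
    (hhi : ∀ s' : State, (∀ y ≠ x, s'.reg y = s.reg y) → (∀ b ≠ a, s'.mem b = s.mem b) →
      hi.Safe W s' ∧ hi.val s' = H)
    (hfg : ∀ k < H, k + 1 < W → ∀ s' : State, s'.Valid W →
      s'.reg x = k → (∀ y ≠ x, s'.reg y = s.reg y) →
      (∀ b ≠ a, s'.mem b = s.mem b) →
      (i.Safe W s' ∧ i.val s' = f k) ∧ e.Safe W s' ∧ e.val s' = g k)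
    (hQ : ∀ s' t, s'.Valid W → s'.reg x = H → (∀ y ≠ x, s'.reg y = s.reg y) →
      (∀ b ≠ a, s'.mem b = s.mem b) → s'.rreg = s.rreg → s'.rmem = s.rmem →
      (∀ k < H, s'.mem a (f k) = g k) →
      (∀ c, (∀ k < H, f k ≠ c) → s'.mem a c = s.mem a c) →
      t ≤ H * (i.cost + e.cost + hi.cost + 8) + hi.cost + 3 → Q s' t) :
    Run W (.loop (.lt (.reg x) hi) (.seq (.put a i e) (.set x (.add (.reg x) (.const 1))))) s Q := by
  refine Run.forUp H (fun k s' t => (∀ y ≠ x, s'.reg y = s.reg y) ∧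
      (∀ b ≠ a, s'.mem b = s.mem b) ∧ s'.rreg = s.rreg ∧ s'.rmem = s.rmem ∧
      (∀ l < k, s'.mem a (f l) = g l) ∧ (∀ c, (∀ l < k, f l ≠ c) → s'.mem a c = s.mem a c) ∧
      t ≤ k * (i.cost + e.cost + hi.cost + 8))
    (Nat.zero_le _) hreg ?_ ?_ ?_ ?_
  · simp
  · rintro k s' t - - - ⟨h1, h2, -⟩
    exact hhi s' h1 h2
  · rintro k s' t hs' - hk hkW hx ⟨h1, h2, h3, h4, h5, h6, h7⟩
    obtain ⟨⟨si, vi⟩, se, ve⟩ := hfg k hk hkW s' hs' hx h1 h2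
    refine ⟨si, se, by simpa using hx, ?_⟩
    simp only [vi, ve]
    refine ⟨fun y hy => by simp [hy, h1 y hy], fun b hb => ?_, h3, h4, ?_, ?_, ?_⟩
    · funext j
      simp [hb, h2 b hb]
    · intro l hl
      rcases Nat.lt_succ_iff_lt_or_eq.1 hl with hl | rfl
      · have : f l ≠ f k := fun h => by have := hinj l (by omega) k hk h; omega
        simp [this, h5 l hl]
      · simp
    · intro c hc
      have := hc k (by omega)
      simp [Ne.symm this, h6 c fun l hl => hc l (by omega)]
    · have : (k + 1) * (i.cost + e.cost + hi.cost + 8) =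
        k * (i.cost + e.cost + hi.cost + 8) + (i.cost + e.cost + hi.cost + 8) := by ring
      omega
  · rintro s' t hs' hx ⟨h1, h2, h3, h4, h5, h6, h7⟩
    exact hQ s' _ hs' hx h1 h2 h3 h4 h5 h6 (by omega)

/-! ### Frames -/

/-- Names of registers and arrays. -/
inductive Loc where
  | reg (x : ℕ)
  | mem (a : ℕ)
  | rreg (x : ℕ)
  | rmem (a : ℕ)

/-- All four kinds of memory share one index, so that a single number can bound everything a program
touches. -/
def Loc.idx : Loc → ℕ
  | reg x => x
  | mem x => x
  | rreg x => x
  | rmem x => x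

/-- The two states agree at the register or array `l`. -/
def Loc.Agree (s s' : State) : Loc → Prop
  | reg x => s'.reg x = s.reg x
  | mem a => s'.mem a = s.mem a
  | rreg x => s'.rreg x = s.rreg x
  | rmem a => s'.rmem a = s.rmem a

theorem Loc.Agree.trans {s₁ s₂ s₃ : State} {l : Loc} (h : l.Agree s₁ s₂) (h' : l.Agree s₂ s₃) :
    l.Agree s₁ s₃ := by
  cases l <;> exact Eq.trans h' h

theorem Loc.Agree.refl (s : State) (l : Loc) : l.Agree s s := by
  cases l <;> rfl

def WExp.Uses (l : Loc) : WExp → Prop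
  | const _ => False
  | reg x => l = .reg x
  | get a i => l = .mem a ∨ i.Uses l
  | add a b => a.Uses l ∨ b.Uses l
  | sub a b => a.Uses l ∨ b.Uses l
  | mul a b => a.Uses l ∨ b.Uses l
  | div a b => a.Uses l ∨ b.Uses l
  | mod a b => a.Uses l ∨ b.Uses l

def RExp.Uses (l : Loc) : RExp → Prop
  | zero => False
  | top => False
  | reg x => l = .rreg x
  | get a i => l = .rmem a ∨ i.Uses l
  | add a b => a.Uses l ∨ b.Uses l

def Cond.Uses (l : Loc) : Cond → Prop
  | lt a b => a.Uses l ∨ b.Uses l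
  | eq a b => a.Uses l ∨ b.Uses l
  | rlt a b => a.Uses l ∨ b.Uses l
  | req a b => a.Uses l ∨ b.Uses l
  | not c => c.Uses l
  | and c d => c.Uses l ∨ d.Uses l
  | or c d => c.Uses l ∨ d.Uses l

/-- The program reads or writes the register or array `l`. -/
def Prog.Uses (l : Loc) : Prog → Prop
  | skip => False
  | set x e => l = .reg x ∨ e.Uses l
  | put a i e => l = .mem a ∨ i.Uses l ∨ e.Uses l
  | rset x e => l = .rreg x ∨ e.Uses l
  | rput a i e => l = .rmem a ∨ i.Uses l ∨ e.Uses l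
  | seq p q => p.Uses l ∨ q.Uses l
  | branch c p q => c.Uses l ∨ p.Uses l ∨ q.Uses l
  | loop c p => c.Uses l ∨ p.Uses l

/-- The program writes the register or array `l`. -/
def Prog.Writes (l : Loc) : Prog → Prop
  | skip => False
  | set x _ => l = .reg x
  | put a _ _ => l = .mem a
  | rset x _ => l = .rreg x
  | rput a _ _ => l = .rmem a
  | seq p q => p.Writes l ∨ q.Writes l
  | branch _ p q => p.Writes l ∨ q.Writes l
  | loop _ p => p.Writes l

theorem Prog.Writes.uses {l : Loc} {p : Prog} (h : p.Writes l) : p.Uses l := by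
  induction p with
  | skip => exact h
  | set x e => exact .inl h
  | put a i e => exact .inl h
  | rset x e => exact .inl h
  | rput a i e => exact .inl h
  | seq p q ihp ihq => exact h.imp ihp ihq
  | branch c p q ihp ihq => exact .inr (h.imp ihp ihq)
  | loop c p ih => exact .inr (ih h)

theorem Exec.agree {p : Prog} {s' : State} {t : ℕ} (h : Exec W p s s' t) {l : Loc}
    (hl : ¬ p.Writes l) : l.Agree s s' := by
  induction h with
  | skip s => exact .refl _ _
  | set s x e he =>
    cases l with
    | reg y =>
      have : y ≠ x := fun h => hl (by simp [Prog.Writes, h])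
      simp [Loc.Agree, this]
    | _ => rfl
  | put s a i e hi he =>
    cases l with
    | mem y =>
      have : y ≠ a := fun h => hl (by simp [Prog.Writes, h])
      simp only [Loc.Agree]; funext j; simp [this]
    | _ => rfl
  | rset s x e he =>
    cases l with
    | rreg y =>
      have : y ≠ x := fun h => hl (by simp [Prog.Writes, h])
      simp [Loc.Agree, this]
    | _ => rfl
  | rput s a i e hi he =>
    cases l with
    | rmem y =>
      have : y ≠ a := fun h => hl (by simp [Prog.Writes, h])
      simp only [Loc.Agree]; funext j; simp [this]
    | _ => rfl
  | seq _ _ ih1 ih2 =>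
    exact (ih1 fun h => hl (.inl h)).trans (ih2 fun h => hl (.inr h))
  | branch_true _ _ _ ih => exact ih fun h => hl (.inl h)
  | branch_false _ _ _ ih => exact ih fun h => hl (.inr h)
  | loop_done => exact .refl _ _
  | loop_step _ _ _ _ ih1 ih2 => exact (ih1 hl).trans (ih2 hl)

/-- The states agree at all registers and arrays that `p` does not write. -/
def Frame (p : Prog) (s s' : State) : Prop := ∀ l : Loc, ¬ p.Writes l → l.Agree s s'

theorem Run.frame {p : Prog} (h : Run W p s Q) :
    Run W p s fun s' t => Q s' t ∧ Frame p s s' := fun hs => by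
  obtain ⟨s', t, h1, h2, h3⟩ := h hs
  exact ⟨s', t, h1, h2, h3, fun l hl => h1.agree hl⟩

theorem WExp.exists_bound (e : WExp) : ∃ N, ∀ l : Loc, e.Uses l → l.idx < N := by
  induction e with
  | const c => exact ⟨0, fun l h => h.elim⟩
  | reg x => exact ⟨x + 1, by rintro l rfl; simp [Loc.idx]⟩
  | get a i ih =>
    obtain ⟨N, hN⟩ := ih
    refine ⟨max N (a + 1), ?_⟩
    rintro l (rfl | h)
    · simp [Loc.idx]
    · exact (hN l h).trans_le (le_max_left _ _)
  | add a b iha ihb | sub a b iha ihb | mul a b iha ihb | div a b iha ihb | mod a b iha ihb =>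
    obtain ⟨N, hN⟩ := iha
    obtain ⟨M, hM⟩ := ihb
    refine ⟨max N M, ?_⟩
    rintro l (h | h)
    · exact (hN l h).trans_le (le_max_left _ _)
    · exact (hM l h).trans_le (le_max_right _ _)

theorem RExp.exists_bound (e : RExp) : ∃ N, ∀ l : Loc, e.Uses l → l.idx < N := by
  induction e with
  | zero => exact ⟨0, fun l h => h.elim⟩
  | top => exact ⟨0, fun l h => h.elim⟩
  | reg x => exact ⟨x + 1, by rintro l rfl; simp [Loc.idx]⟩
  | get a i =>
    obtain ⟨N, hN⟩ := i.exists_bound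
    refine ⟨max N (a + 1), ?_⟩
    rintro l (rfl | h)
    · simp [Loc.idx]
    · exact (hN l h).trans_le (le_max_left _ _)
  | add a b iha ihb =>
    obtain ⟨N, hN⟩ := iha
    obtain ⟨M, hM⟩ := ihb
    refine ⟨max N M, ?_⟩
    rintro l (h | h)
    · exact (hN l h).trans_le (le_max_left _ _)
    · exact (hM l h).trans_le (le_max_right _ _)

theorem Cond.exists_bound (c : Cond) : ∃ N, ∀ l : Loc, c.Uses l → l.idx < N := by
  have key : ∀ {P P' : Loc → Prop}, (∃ N, ∀ l : Loc, P l → l.idx < N) →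
      (∃ N, ∀ l : Loc, P' l → l.idx < N) → ∃ N, ∀ l : Loc, P l ∨ P' l → l.idx < N := by
    rintro P P' ⟨N, hN⟩ ⟨M, hM⟩
    exact ⟨max N M, fun l h => h.elim (fun h => (hN l h).trans_le (le_max_left _ _))
      fun h => (hM l h).trans_le (le_max_right _ _)⟩
  induction c with
  | lt a b => exact key a.exists_bound b.exists_bound
  | eq a b => exact key a.exists_bound b.exists_bound
  | rlt a b => exact key a.exists_bound b.exists_bound
  | req a b => exact key a.exists_bound b.exists_bound
  | not c ih => exact ih
  | and c d ihc ihd => exact key ihc ihd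
  | or c d ihc ihd => exact key ihc ihd

/-- A program is a finite text, and arrays are named by constants; only cells within an array are
addressed dynamically. Beyond the bound there are thus fresh registers and arrays for the tables and
counters placed around an unknown program. -/
theorem Prog.exists_bound (p : Prog) : ∃ N, ∀ l : Loc, p.Uses l → l.idx < N := by
  have key : ∀ {P P' : Loc → Prop}, (∃ N, ∀ l : Loc, P l → l.idx < N) →
      (∃ N, ∀ l : Loc, P' l → l.idx < N) → ∃ N, ∀ l : Loc, P l ∨ P' l → l.idx < N := by
    rintro P P' ⟨N, hN⟩ ⟨M, hM⟩
    exact ⟨max N M, fun l h => h.elim (fun h => (hN l h).trans_le (le_max_left _ _))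
      fun h => (hM l h).trans_le (le_max_right _ _)⟩
  have one : ∀ l₀ : Loc, ∃ N, ∀ l : Loc, l = l₀ → l.idx < N :=
    fun l₀ => ⟨l₀.idx + 1, by rintro l rfl; omega⟩
  induction p with
  | skip => exact ⟨0, fun l h => h.elim⟩
  | set x e => exact key (one _) e.exists_bound
  | put a i e => exact key (one _) (key i.exists_bound e.exists_bound)
  | rset x e => exact key (one _) e.exists_bound
  | rput a i e => exact key (one _) (key i.exists_bound e.exists_bound)
  | seq p q ihp ihq => exact key ihp ihq
  | branch c p q ihp ihq => exact key c.exists_bound (key ihp ihq)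
  | loop c p ih => exact key c.exists_bound ih

/-! ### The number of cells written -/

/-- Every elementary operation takes at least one unit of time and writes at most one cell. This is
the source of the lower bound on the exponent of matrix multiplication. -/
theorem Exec.exists_changed {p : Prog} {s' : State} {t : ℕ} (h : Exec W p s s' t) :
    ∃ F : Finset (ℕ × ℕ), F.card ≤ t ∧ ∀ a i, (a, i) ∉ F → s'.mem a i = s.mem a i := by
  induction h with
  | skip s => exact ⟨∅, by simp⟩
  | set s x e he => exact ⟨∅, by simp⟩
  | put s a i e hi he =>
    refine ⟨{(a, i.val s)}, by simp, fun b j h => ?_⟩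
    simp only [Finset.mem_singleton, Prod.mk.injEq] at h
    simp [h]
  | rset s x e he => exact ⟨∅, by simp⟩
  | rput s a i e hi he => exact ⟨∅, by simp⟩
  | seq _ _ ih1 ih2 =>
    obtain ⟨F, hF, h⟩ := ih1
    obtain ⟨F', hF', h'⟩ := ih2
    refine ⟨F ∪ F', (Finset.card_union_le _ _).trans (by omega), fun a i hi => ?_⟩
    simp only [Finset.mem_union, not_or] at hi
    rw [h' a i hi.2, h a i hi.1]
  | branch_true _ _ _ ih | branch_false _ _ _ ih =>
    obtain ⟨F, hF, h⟩ := ih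
    exact ⟨F, by omega, h⟩
  | loop_done => exact ⟨∅, by simp⟩
  | loop_step _ _ _ _ ih1 ih2 =>
    obtain ⟨F, hF, h⟩ := ih1
    obtain ⟨F', hF', h'⟩ := ih2
    refine ⟨F ∪ F', (Finset.card_union_le _ _).trans (by omega), fun a i hi => ?_⟩
    simp only [Finset.mem_union, not_or] at hi
    rw [h' a i hi.2, h a i hi.1]

end RealRam

namespace RealRam

variable {W : ℕ} {s s' : State} {Q : State → ℕ → Prop}

/-! ### Clocked programs -/

theorem WExp.val_congr {e : WExp} (h : ∀ l : Loc, e.Uses l → l.Agree s s') :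
    e.val s' = e.val s := by
  induction e with
  | const c => rfl
  | reg x => exact h _ rfl
  | get a i ih =>
    have h1 := ih fun l hl => h l (.inr hl)
    have h2 : s'.mem a = s.mem a := h (.mem a) (.inl rfl)
    simp [WExp.val, h1, h2]
  | add a b iha ihb | sub a b iha ihb | mul a b iha ihb | div a b iha ihb | mod a b iha ihb =>
    simp [WExp.val, iha fun l hl => h l (.inl hl), ihb fun l hl => h l (.inr hl)]

theorem WExp.Fits.congr {e : WExp} (h : ∀ l : Loc, e.Uses l → l.Agree s s') (hf : e.Fits W s) :
    e.Fits W s' := by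
  induction e with
  | const c => exact hf
  | reg x => have := h _ rfl; simp only [Loc.Agree] at this; simpa [WExp.Fits, this] using hf
  | get a i ih =>
    have h1 := ih (fun l hl => h l (.inr hl)) hf.1
    have h2 := WExp.val_congr fun l hl => h l (.inr hl)
    have h3 : s'.mem a = s.mem a := h (.mem a) (.inl rfl)
    exact ⟨h1, by rw [h2, h3]; exact hf.2⟩
  | add a b iha ihb | mul a b iha ihb =>
    refine ⟨iha (fun l hl => h l (.inl hl)) hf.1, ihb (fun l hl => h l (.inr hl)) hf.2.1, ?_⟩
    rw [WExp.val_congr fun l hl => h l (.inl hl), WExp.val_congr fun l hl => h l (.inr hl)]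
    exact hf.2.2
  | sub a b iha ihb | div a b iha ihb | mod a b iha ihb =>
    exact ⟨iha (fun l hl => h l (.inl hl)) hf.1, ihb (fun l hl => h l (.inr hl)) hf.2⟩

theorem RExp.val_congr {e : RExp} (h : ∀ l : Loc, e.Uses l → l.Agree s s') :
    e.val s' = e.val s := by
  induction e with
  | zero => rfl
  | top => rfl
  | reg x => exact h _ rfl
  | get a i =>
    have h1 := WExp.val_congr fun l hl => h l (.inr hl)
    have h2 : s'.rmem a = s.rmem a := h (.rmem a) (.inl rfl)
    simp [RExp.val, h1, h2]
  | add a b iha ihb =>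
    simp [RExp.val, iha fun l hl => h l (.inl hl), ihb fun l hl => h l (.inr hl)]

theorem RExp.Fits.congr {e : RExp} (h : ∀ l : Loc, e.Uses l → l.Agree s s') (hf : e.Fits W s) :
    e.Fits W s' := by
  induction e with
  | zero => trivial
  | top => trivial
  | reg x => trivial
  | get a i => exact WExp.Fits.congr (fun l hl => h l (.inr hl)) hf
  | add a b iha ihb =>
    exact ⟨iha (fun l hl => h l (.inl hl)) hf.1, ihb (fun l hl => h l (.inr hl)) hf.2⟩

theorem Cond.holds_congr {c : Cond} (h : ∀ l : Loc, c.Uses l → l.Agree s s') :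
    c.Holds s' ↔ c.Holds s := by
  induction c with
  | lt a b | eq a b =>
    simp only [Cond.Holds, WExp.val_congr fun l hl => h l (.inl hl),
      WExp.val_congr fun l hl => h l (.inr hl)]
  | rlt a b | req a b =>
    simp only [Cond.Holds, RExp.val_congr fun l hl => h l (.inl hl),
      RExp.val_congr fun l hl => h l (.inr hl)]
  | not c ih => simp only [Cond.Holds, ih h]
  | and c d ihc ihd | or c d ihc ihd =>
    simp only [Cond.Holds, ihc fun l hl => h l (.inl hl), ihd fun l hl => h l (.inr hl)]

theorem Cond.Fits.congr {c : Cond} (h : ∀ l : Loc, c.Uses l → l.Agree s s') (hf : c.Fits W s) :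
    c.Fits W s' := by
  induction c with
  | lt a b | eq a b =>
    exact ⟨hf.1.congr fun l hl => h l (.inl hl), hf.2.congr fun l hl => h l (.inr hl)⟩
  | rlt a b | req a b =>
    exact ⟨hf.1.congr fun l hl => h l (.inl hl), hf.2.congr fun l hl => h l (.inr hl)⟩
  | not c ih => exact ih h hf
  | and c d ihc ihd | or c d ihc ihd =>
    exact ⟨ihc (fun l hl => h l (.inl hl)) hf.1, ihd (fun l hl => h l (.inr hl)) hf.2⟩

/-- The test whether there is fuel left in register `N`. -/
def Cond.fuel (N : ℕ) : Cond := .lt (.const 0) (.reg N)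

/-- Use one unit of the fuel in register `N`. -/
def Prog.tick (N : ℕ) : Prog := .set N (.sub (.reg N) (.const 1))

/-- Set the flag in register `N + 1` if there is fuel left and `c` holds, and clear it otherwise. -/
def Prog.flag (N : ℕ) (c : Cond) : Prog :=
  .branch (.fuel N) (.branch c (.set (N + 1) (.const 1)) (.set (N + 1) (.const 0)))
    (.set (N + 1) (.const 0))

/-- The program that simulates `p` as long as there is fuel in register `N`. -/
def Prog.clock (N : ℕ) : Prog → Prog
  | skip => skip
  | set x e => .branch (.fuel N) (.seq (.set x e) (tick N)) .skip
  | put a i e => .branch (.fuel N) (.seq (.put a i e) (tick N)) .skip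
  | rset x e => .branch (.fuel N) (.seq (.rset x e) (tick N)) .skip
  | rput a i e => .branch (.fuel N) (.seq (.rput a i e) (tick N)) .skip
  | seq p q => .seq (clock N p) (clock N q)
  | branch c p q => .branch (.fuel N) (.branch c (clock N p) (clock N q)) .skip
  | loop c p => .seq (flag N c)
      (.loop (.eq (.reg (N + 1)) (.const 1)) (.seq (tick N) (.seq (clock N p) (flag N c))))

/-- A bound for the time that the clocked program needs for each unit of fuel. -/
def Prog.clockCost : Prog → ℕ
  | skip => 1
  | set _ e => e.cost + 10
  | put _ i e => i.cost + e.cost + 10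
  | rset _ e => e.cost + 10
  | rput _ i e => i.cost + e.cost + 10
  | seq p q => p.clockCost + q.clockCost
  | branch c p q => c.cost + p.clockCost + q.clockCost + 10
  | loop c p => 2 * c.cost + p.clockCost + 50

/-- No assumption on `c` is needed, because `c` is not evaluated. This is why clocked loops use a
flag: without fuel the state no longer follows the simulated program, `c` might overflow, and a
conjunction with the fuel test would still require `c` to fit. -/
theorem run_flag_idle {N : ℕ} {c : Cond} (hW : 2 ≤ W) (h : s.reg N = 0) (hs : s.Valid W) :
    Exec W (.flag N c) s (s.setReg (N + 1) 0) 6 :=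
  .branch_false (c := .fuel N) (t := 2) ⟨show 0 < W by omega, hs.1 N⟩
    (by simp [Cond.fuel, Cond.Holds, WExp.val, h])
    (.set s (N + 1) (.const 0) (show 0 < W by omega))

theorem run_flag {N : ℕ} {c : Cond} (hW : 2 ≤ W) (hf : c.Fits W s) (hs : s.Valid W) :
    ∃ v t, Exec W (.flag N c) s (s.setReg (N + 1) v) t ∧ t ≤ c.cost + 10 ∧
      (v = 1 ↔ 0 < s.reg N ∧ c.Holds s) := by
  rcases Nat.eq_zero_or_pos (s.reg N) with h | h
  · exact ⟨0, 6, run_flag_idle hW h hs, by omega, by simp [h]⟩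
  · by_cases hc : c.Holds s
    · refine ⟨1, _, .branch_true ⟨show 0 < W by omega, hs.1 N⟩ h (.branch_true hf hc
        (.set s (N + 1) (.const 1) (show 1 < W by omega))), ?_, by simp [h, hc]⟩
      simp [Cond.fuel, Cond.cost, WExp.cost]; omega
    · refine ⟨0, _, .branch_true ⟨show 0 < W by omega, hs.1 N⟩ h (.branch_false hf hc
        (.set s (N + 1) (.const 0) (show 0 < W by omega))), ?_, by simp [hc]⟩
      simp [Cond.fuel, Cond.cost, WExp.cost]; omega

theorem exec_tick {N : ℕ} (hW : 2 ≤ W) (hs : s.Valid W) :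
    Exec W (.tick N) s (s.setReg N (s.reg N - 1)) 4 :=
  .set s N (.sub (.reg N) (.const 1)) ⟨hs.1 N, show 1 < W by omega⟩

/-- Without fuel, a clocked program halts in constant time. -/
theorem Prog.clock_idle {N : ℕ} (p : Prog) (hW : 2 ≤ W) (h : s.reg N = 0) (hs : s.Valid W) :
    ∃ s' t, Exec W (p.clock N) s s' t ∧ s'.reg N = 0 ∧ t ≤ p.clockCost := by
  have hf : (Cond.fuel N).Fits W s := ⟨show 0 < W by omega, hs.1 N⟩
  have hh : ¬ (Cond.fuel N).Holds s := by simp [Cond.fuel, Cond.Holds, WExp.val, h]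
  have hc : (Cond.fuel N).cost = 3 := rfl
  have skip : ∀ p : Prog, Exec W (.branch (.fuel N) p .skip) s s ((Cond.fuel N).cost + 1 + 1) :=
    fun p => .branch_false hf hh (.skip s)
  induction p generalizing s with
  | skip => exact ⟨s, 1, .skip s, h, le_rfl⟩
  | set x e | put a i e | rset x e | rput a i e =>
    exact ⟨s, _, skip _, h, by simp [clockCost, hc]⟩
  | branch c p q => exact ⟨s, _, skip _, h, by simp [clockCost, hc]⟩
  | seq p q ihp ihq =>
    obtain ⟨s₁, t₁, e₁, h₁, b₁⟩ := ihp h hs hf hh skip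
    have hs₁ := e₁.valid hs
    have hf₁ : (Cond.fuel N).Fits W s₁ := ⟨show 0 < W by omega, hs₁.1 N⟩
    have hh₁ : ¬ (Cond.fuel N).Holds s₁ := by simp [Cond.fuel, Cond.Holds, WExp.val, h₁]
    obtain ⟨s₂, t₂, e₂, h₂, b₂⟩ := ihq h₁ hs₁ hf₁ hh₁ fun p => .branch_false hf₁ hh₁ (.skip _)
    exact ⟨s₂, _, e₁.seq e₂, h₂, by simp [clockCost]; omega⟩
  | loop c p =>
    have e₁ := run_flag_idle (c := c) hW h hs
    have hs₁ := e₁.valid hs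
    refine ⟨_, _, e₁.seq (.loop_done ⟨hs₁.1 _, show 1 < W by omega⟩ ?_), ?_, ?_⟩
    · simp [Cond.Holds, WExp.val]
    · simp [h]
    · simp [clockCost, Cond.cost, WExp.cost]

/-- The states agree except for the registers `N` and `N + 1`. -/
def Sim (N : ℕ) (s s' : State) : Prop :=
  (∀ y, y ≠ N → y ≠ N + 1 → s'.reg y = s.reg y) ∧ s'.mem = s.mem ∧ s'.rreg = s.rreg ∧
    s'.rmem = s.rmem

theorem Sim.agree {N : ℕ} (h : Sim N s s') {l : Loc} (h0 : l ≠ .reg N) (h1 : l ≠ .reg (N + 1)) :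
    l.Agree s s' := by
  cases l with
  | reg y => exact h.1 y (fun h => h0 (h ▸ rfl)) fun h => h1 (h ▸ rfl)
  | mem a => exact congrFun h.2.1 a
  | rreg y => exact congrFun h.2.2.1 y
  | rmem a => exact congrFun h.2.2.2 a

theorem Sim.tick {N : ℕ} (h : Sim N s s') (v : ℕ) : Sim N s (s'.setReg N v) :=
  ⟨fun y h0 h1 => by simp [h0, h.1 y h0 h1], h.2⟩

theorem Sim.flag {N : ℕ} (h : Sim N s s') (v : ℕ) : Sim N s (s'.setReg (N + 1) v) :=
  ⟨fun y h0 h1 => by simp [h1, h.1 y h0 h1], h.2⟩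

/-- A unit of fuel is spent on each elementary statement and each round of a loop, and each of these
takes at least one unit of the original time, so at most `t` units are used. In the time bound the
summand `1` pays for passing through program text without using fuel. Fuel left at the end certifies
that the simulation was never interrupted; without it nothing is said about the result. -/
theorem Exec.clock {N : ℕ} {p : Prog} {s' : State} {t : ℕ} (h : Exec W p s s' t) (hW : 2 ≤ W)
    (hN : ¬ p.Uses (.reg N)) (hN' : ¬ p.Uses (.reg (N + 1))) :
    ∀ z : State, Sim N s z → z.Valid W → ∃ z' u, Exec W (p.clock N) z z' u ∧
      z'.reg N ≤ z.reg N ∧ z.reg N ≤ z'.reg N + t ∧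
      u ≤ p.clockCost * (1 + (z.reg N - z'.reg N)) ∧ (0 < z'.reg N → Sim N s' z') := by
  have fits : ∀ z : State, z.Valid W → (Cond.fuel N).Fits W z :=
    fun z hz => ⟨show 0 < W by omega, hz.1 N⟩
  -- The common pattern of the four elementary statements: test the fuel, execute, use one unit.
  have op : ∀ (p : Prog) (s s' z z' : State) (t : ℕ),
      Sim N s z → z.Valid W → (0 < z.reg N → Exec W p z z' t ∧ z'.reg N = z.reg N ∧ Sim N s' z') →
      ∃ y u, Exec W (.branch (.fuel N) (.seq p (.tick N)) .skip) z y u ∧ y.reg N ≤ z.reg N ∧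
        z.reg N ≤ y.reg N + 1 ∧ u ≤ (t + 9) * (1 + (z.reg N - y.reg N)) ∧
        (0 < y.reg N → Sim N s' y) := by
    intro p s s' z z' t hsim hz he
    rcases Nat.eq_zero_or_pos (z.reg N) with h | h
    · refine ⟨z, _, .branch_false (fits z hz) ?_ (.skip z), le_rfl, by omega, ?_, by omega⟩
      · simp [Cond.fuel, Cond.Holds, WExp.val, h]
      · simp [Cond.fuel, Cond.cost, WExp.cost]
    · obtain ⟨e, h2, h3⟩ := he h
      refine ⟨_, _, .branch_true (fits z hz) h (e.seq (exec_tick hW (e.valid hz))), ?_, ?_, ?_, ?_⟩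
      · simp [h2]
      · simp [h2]; omega
      · have : (1 + (z.reg N - (z'.setReg N (z'.reg N - 1)).reg N)) = 2 := by simp [h2]; omega
        rw [this]
        simp [Cond.fuel, Cond.cost, WExp.cost]; omega
      · exact fun _ => h3.tick _
  induction h with
  | skip s =>
    intro z hz hv
    exact ⟨z, 1, .skip z, le_rfl, by omega, by simp [Prog.clockCost], fun _ => hz⟩
  | set s x e he =>
    intro z hz hv
    have hag : ∀ l : Loc, e.Uses l → l.Agree s z := fun l hl => hz.agree
      (by rintro rfl; exact hN (.inr hl)) (by rintro rfl; exact hN' (.inr hl))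
    have hx : N ≠ x := by rintro rfl; exact hN (.inl rfl)
    obtain ⟨y, u, h1, h2, h3, h4, h5⟩ := op (.set x e) s (s.setReg x (e.val s)) z _ _ hz hv
      (fun _ => ⟨.set z x e (he.congr hag), by simp [hx], fun y h0 h1 => by
        simp [hz.1 y h0 h1, WExp.val_congr hag], hz.2⟩)
    exact ⟨y, u, h1, h2, by omega, h4, h5⟩
  | put s a i e hi he =>
    intro z hz hv
    have hag : ∀ l : Loc, e.Uses l → l.Agree s z := fun l hl => hz.agree
      (by rintro rfl; exact hN (.inr (.inr hl))) (by rintro rfl; exact hN' (.inr (.inr hl)))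
    have hag' : ∀ l : Loc, i.Uses l → l.Agree s z := fun l hl => hz.agree
      (by rintro rfl; exact hN (.inr (.inl hl))) (by rintro rfl; exact hN' (.inr (.inl hl)))
    obtain ⟨y, u, h1, h2, h3, h4, h5⟩ := op (.put a i e) s (s.setMem a (i.val s) (e.val s)) z _ _
      hz hv (fun _ => ⟨.put z a i e (hi.congr hag') (he.congr hag), by simp, hz.1, by
        simp [State.setMem, hz.2.1, WExp.val_congr hag, WExp.val_congr hag'], hz.2.2⟩)
    exact ⟨y, u, h1, h2, by omega, h4, h5⟩
  | rset s x e he =>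
    intro z hz hv
    have hag : ∀ l : Loc, e.Uses l → l.Agree s z := fun l hl => hz.agree
      (by rintro rfl; exact hN (.inr hl)) (by rintro rfl; exact hN' (.inr hl))
    obtain ⟨y, u, h1, h2, h3, h4, h5⟩ := op (.rset x e) s (s.setRreg x (e.val s)) z _ _ hz hv
      (fun _ => ⟨.rset z x e (he.congr hag), by simp, hz.1, hz.2.1, by
        simp [State.setRreg, hz.2.2.1, RExp.val_congr hag], hz.2.2.2⟩)
    exact ⟨y, u, h1, h2, by omega, h4, h5⟩
  | rput s a i e hi he =>
    intro z hz hv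
    have hag : ∀ l : Loc, e.Uses l → l.Agree s z := fun l hl => hz.agree
      (by rintro rfl; exact hN (.inr (.inr hl))) (by rintro rfl; exact hN' (.inr (.inr hl)))
    have hag' : ∀ l : Loc, i.Uses l → l.Agree s z := fun l hl => hz.agree
      (by rintro rfl; exact hN (.inr (.inl hl))) (by rintro rfl; exact hN' (.inr (.inl hl)))
    obtain ⟨y, u, h1, h2, h3, h4, h5⟩ := op (.rput a i e) s (s.setRmem a (i.val s) (e.val s)) z _ _
      hz hv (fun _ => ⟨.rput z a i e (hi.congr hag') (he.congr hag), by simp, hz.1, hz.2.1,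
        hz.2.2.1, by
        simp [State.setRmem, hz.2.2.2, RExp.val_congr hag, WExp.val_congr hag']⟩)
    exact ⟨y, u, h1, h2, by omega, h4, h5⟩
  | @seq p q s s₁ s₂ t₁ t₂ e₁ e₂ ih1 ih2 =>
    intro z hz hv
    obtain ⟨z₁, u₁, x₁, a₁, b₁, c₁, d₁⟩ := ih1 (fun h => hN (.inl h)) (fun h => hN' (.inl h)) z hz hv
    -- If the first half has used up the fuel, the state in which the second half starts is unknown,
    -- and only the bound for idle programs applies.
    rcases Nat.eq_zero_or_pos (z₁.reg N) with h | h
    · obtain ⟨z₂, u₂, x₂, a₂, b₂⟩ := Prog.clock_idle q hW h (x₁.valid hv)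
      refine ⟨z₂, _, x₁.seq x₂, by omega, by omega, ?_, by omega⟩
      simp only [Prog.clockCost, a₂]
      rw [h] at c₁
      nlinarith [Nat.zero_le (q.clockCost * (z.reg N - 0))]
    · obtain ⟨z₂, u₂, x₂, a₂, b₂, c₂, d₂⟩ := ih2 (fun h => hN (.inr h)) (fun h => hN' (.inr h)) z₁
        (d₁ h) (x₁.valid hv)
      refine ⟨z₂, _, x₁.seq x₂, by omega, by omega, ?_, d₂⟩
      simp only [Prog.clockCost]
      have h1 : p.clockCost * (1 + (z.reg N - z₁.reg N)) ≤
          p.clockCost * (1 + (z.reg N - z₂.reg N)) := Nat.mul_le_mul_left _ (by omega)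
      have h2 : q.clockCost * (1 + (z₁.reg N - z₂.reg N)) ≤
          q.clockCost * (1 + (z.reg N - z₂.reg N)) := Nat.mul_le_mul_left _ (by omega)
      rw [add_mul]
      omega
  | @branch_true c p q s s₁ t hf hc e ih =>
    intro z hz hv
    have hag : ∀ l : Loc, c.Uses l → l.Agree s z := fun l hl => hz.agree
      (by rintro rfl; exact hN (.inl hl)) (by rintro rfl; exact hN' (.inl hl))
    rcases Nat.eq_zero_or_pos (z.reg N) with h | h
    · refine ⟨z, _, .branch_false (fits z hv) ?_ (.skip z), le_rfl, by omega, ?_, by omega⟩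
      · simp [Cond.fuel, Cond.Holds, WExp.val, h]
      · simp [Cond.fuel, Cond.cost, WExp.cost, Prog.clockCost]
    · obtain ⟨z₁, u₁, x₁, a₁, b₁, c₁, d₁⟩ := ih (fun h => hN (.inr (.inl h)))
        (fun h => hN' (.inr (.inl h))) z hz hv
      refine ⟨z₁, _, .branch_true (fits z hv) h (.branch_true (hf.congr hag)
        ((Cond.holds_congr hag).2 hc) x₁), a₁, by omega, ?_, d₁⟩
      simp only [Cond.fuel, Cond.cost, WExp.cost, Prog.clockCost]
      nlinarith [Nat.zero_le (q.clockCost * (1 + (z.reg N - z₁.reg N))),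
        Nat.zero_le (c.cost * (z.reg N - z₁.reg N))]
  | @branch_false c p q s s₁ t hf hc e ih =>
    intro z hz hv
    have hag : ∀ l : Loc, c.Uses l → l.Agree s z := fun l hl => hz.agree
      (by rintro rfl; exact hN (.inl hl)) (by rintro rfl; exact hN' (.inl hl))
    rcases Nat.eq_zero_or_pos (z.reg N) with h | h
    · refine ⟨z, _, .branch_false (fits z hv) ?_ (.skip z), le_rfl, by omega, ?_, by omega⟩
      · simp [Cond.fuel, Cond.Holds, WExp.val, h]
      · simp [Cond.fuel, Cond.cost, WExp.cost, Prog.clockCost]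
    · obtain ⟨z₁, u₁, x₁, a₁, b₁, c₁, d₁⟩ := ih (fun h => hN (.inr (.inr h)))
        (fun h => hN' (.inr (.inr h))) z hz hv
      refine ⟨z₁, _, .branch_true (fits z hv) h (.branch_false (hf.congr hag)
        (fun h => hc ((Cond.holds_congr hag).1 h)) x₁), a₁, by omega, ?_, d₁⟩
      simp only [Cond.fuel, Cond.cost, WExp.cost, Prog.clockCost]
      nlinarith [Nat.zero_le (p.clockCost * (1 + (z.reg N - z₁.reg N))),
        Nat.zero_le (c.cost * (z.reg N - z₁.reg N))]
  | @loop_done c p s hf hc =>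
    intro z hz hv
    have hag : ∀ l : Loc, c.Uses l → l.Agree s z := fun l hl => hz.agree
      (by rintro rfl; exact hN (.inl hl)) (by rintro rfl; exact hN' (.inl hl))
    obtain ⟨v, u, x, b, hiff⟩ := run_flag (N := N) hW (hf.congr hag) hv
    have : v ≠ 1 := fun h => hc ((Cond.holds_congr hag).1 (hiff.1 h).2)
    refine ⟨_, _, x.seq (.loop_done ⟨(x.valid hv).1 _, show 1 < W by omega⟩ ?_), ?_, ?_, ?_, ?_⟩
    · simp [Cond.Holds, WExp.val, this]
    · simp
    · simp
    · simp [Prog.clockCost, Cond.cost, WExp.cost]; omega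
    · exact fun _ => hz.flag v
  | @loop_step c p s s₁ s₂ t₁ t₂ hf hc e₁ e₂ ih1 ih2 =>
    intro z hz hv
    have hag : ∀ l : Loc, c.Uses l → l.Agree s z := fun l hl => hz.agree
      (by rintro rfl; exact hN (.inl hl)) (by rintro rfl; exact hN' (.inl hl))
    obtain ⟨v, u, x, b, hiff⟩ := run_flag (N := N) hW (hf.congr hag) hv
    have vx := x.valid hv
    rcases Nat.eq_zero_or_pos (z.reg N) with h | h
    · have : v ≠ 1 := fun h' => by have := (hiff.1 h').1; omega
      refine ⟨_, _, x.seq (.loop_done ⟨vx.1 _, show 1 < W by omega⟩ ?_), ?_, ?_, ?_, ?_⟩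
      · simp [Cond.Holds, WExp.val, this]
      · simp
      · simp
      · simp [Prog.clockCost, Cond.cost, WExp.cost]; omega
      · simp [h]
    · have hv1 : v = 1 := hiff.2 ⟨h, (Cond.holds_congr hag).2 hc⟩
      have xt := exec_tick (N := N) hW vx
      obtain ⟨z₁, u₁, x₁, a₁, b₁, c₁, d₁⟩ := ih1 (fun h => hN (.inr h)) (fun h => hN' (.inr h))
        _ ((hz.flag v).tick _) (xt.valid vx)
      simp only [State.setReg_reg, if_true, show N ≠ N + 1 by omega, if_false] at a₁ b₁ c₁
      have v₁ := x₁.valid (xt.valid vx)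
      have htest : (Cond.eq (.reg (N + 1)) (.const 1)).Fits W (z.setReg (N + 1) v) :=
        ⟨vx.1 _, show 1 < W by omega⟩
      have hholds : (Cond.eq (.reg (N + 1)) (.const 1)).Holds (z.setReg (N + 1) v) := by
        simp [Cond.Holds, WExp.val, hv1]
      rcases Nat.eq_zero_or_pos (z₁.reg N) with h' | h'
      · have xf := run_flag_idle (c := c) hW h' v₁
        refine ⟨_, _, x.seq (.loop_step htest hholds (xt.seq (x₁.seq xf)) (.loop_done
          ⟨(xf.valid v₁).1 _, show 1 < W by omega⟩ ?_)), ?_, ?_, ?_, ?_⟩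
        · simp [Cond.Holds, WExp.val]
        · simp [h']
        · simp [h']; omega
        · simp only [State.setReg_reg, show N ≠ N + 1 by omega, if_false, h', Prog.clockCost,
            Cond.cost, WExp.cost] at c₁ ⊢
          have h1 : 1 + (z.reg N - 1 - 0) = z.reg N := by omega
          rw [h1] at c₁
          rw [Nat.sub_zero]
          nlinarith [Nat.zero_le (c.cost * z.reg N)]
        · simp [h']
      · obtain ⟨z₂, u₂, x₂, a₂, b₂, c₂, d₂⟩ := ih2 hN hN' z₁ (d₁ h') v₁
        -- The execution obtained for the remaining rounds begins by computing the flag. Split off,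
        -- this computation becomes the end of the body of the present round.
        cases x₂ with
        | @seq _ _ _ y _ w₁ w₂ y₁ y₂ =>
          refine ⟨z₂, _, x.seq (.loop_step htest hholds (xt.seq (x₁.seq y₁)) y₂), by omega,
            by omega, ?_, d₂⟩
          simp only [Prog.clockCost, Cond.cost, WExp.cost] at c₂ ⊢
          have h1 : 1 + (z.reg N - 1 - z₁.reg N) = z.reg N - z₁.reg N := by omega
          rw [h1] at c₁
          have h2 : z.reg N - z₂.reg N = (z.reg N - z₁.reg N) + (z₁.reg N - z₂.reg N) := by omega
          rw [h2]
          -- The round itself has used at least one unit of fuel, which pays for its test and for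
          -- the additional flag computation.
          have h3 : 1 ≤ z.reg N - z₁.reg N := by omega
          nlinarith [Nat.mul_le_mul_left c.cost h3]

end RealRam

/-! ## Lexicographically-first shortest paths -/

namespace RealDag

variable {n m : ℕ} {G : RealDag n m} {num : Fin n → ℕ} {u v c : Fin n} {e e' : Fin m}
  {p q : List (Fin m)}

variable (G) in
/-- There is a path, possibly without edges, from `u` to `v`. -/
def Reach (u v : Fin n) : Prop := Relation.ReflTransGen G.Adj u v

theorem adj_edge (e : Fin m) : G.Adj (G.tail e) (G.head e) := ⟨e, rfl, rfl⟩

theorem edge_ext (ht : G.tail e = G.tail e') (hh : G.head e = G.head e') : e = e' :=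
  G.simple (Prod.ext ht hh)

theorem Ancestor.reach (h : G.Ancestor u v) : G.Reach u v := h.to_reflTransGen

theorem reach_iff : G.Reach u v ↔ v = u ∨ G.Ancestor u v := Relation.reflTransGen_iff_eq_or_transGen

theorem reach_refl (u : Fin n) : G.Reach u u := Relation.ReflTransGen.refl

theorem Reach.ancestor (h : G.Reach u (G.tail e)) (he : G.head e = v) : G.Ancestor u v :=
  Relation.TransGen.tail' h (he ▸ adj_edge e)

theorem Ancestor.exists_edge (h : G.Ancestor u v) :
    ∃ e, G.head e = v ∧ G.Reach u (G.tail e) := by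
  obtain ⟨w, h1, e, rfl, rfl⟩ := Relation.TransGen.tail'_iff.1 h
  exact ⟨e, rfl, h1⟩

theorem IsPath.reach (h : G.IsPath u p v) : G.Reach u v := by
  induction p generalizing v with
  | nil => exact h ▸ reach_refl u
  | cons e p ih => exact Relation.ReflTransGen.tail (ih h.2) (h.1 ▸ adj_edge e)

theorem IsPath.append {w : Fin n} (hq : G.IsPath u q w) (hp : G.IsPath w p v) :
    G.IsPath u (p ++ q) v := by
  induction p generalizing v with
  | nil => exact (show w = v from hp) ▸ hq
  | cons e p ih => exact ⟨hp.1, ih hp.2⟩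

theorem IsPath.exists_of_append (h : G.IsPath u (p ++ q) v) :
    ∃ w, G.IsPath u q w ∧ G.IsPath w p v := by
  induction p generalizing v with
  | nil => exact ⟨v, h, rfl⟩
  | cons e p ih =>
    obtain ⟨w, h1, h2⟩ := ih h.2
    exact ⟨w, h1, h.1, h2⟩

theorem length_cons : G.length (e :: p) = G.weight e + G.length p := by simp [length]

theorem length_append : G.length (p ++ q) = G.length p + G.length q := by simp [length]

theorem IsShortest.tail (h : G.IsShortest u (e :: p) v) : G.IsShortest u p (G.tail e) := by
  refine ⟨h.1.2, fun q hq => ?_⟩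
  have := h.2 (e :: q) ⟨h.1.1, hq⟩
  rw [length_cons, length_cons] at this
  linarith

theorem IsLexFirst.isPath (h : G.IsLexFirst num u p v) : G.IsPath u p v := by
  cases p with
  | nil => exact h
  | cons e p => exact h.1.1

theorem IsPath.nil_iff (h : G.IsPath u p v) : p = [] ↔ u = v := by
  constructor
  · rintro rfl; exact h
  · rintro rfl
    cases p with
    | nil => rfl
    | cons e p => exact (G.acyclic u (h.2.reach.ancestor h.1)).elim

/-- The minimality conditions bound the numbers of the last tails in both directions, so the tails
coincide, and there are no parallel edges. The rest follows by induction. -/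
theorem IsLexFirst.unique (hnum : G.IsNumbering num) (hp : G.IsLexFirst num u p v)
    (hq : G.IsLexFirst num u q v) : p = q := by
  induction p generalizing q v with
  | nil => exact (hq.isPath.nil_iff.2 hp).symm
  | cons e p ih =>
    cases q with
    | nil => exact hp.isPath.nil_iff.2 hq
    | cons e' q =>
      have ht : G.tail e = G.tail e' :=
        hnum.injective (le_antisymm (hp.2.1 e' q hq.1) (hq.2.1 e p hp.1))
      obtain rfl : e = e' := edge_ext ht (hp.1.1.1.trans hq.1.1.1.symm)
      rw [ih hp.2.2 hq.2.2]

theorem IsLexFirst.isShortest (h : G.IsLexFirst num u p v) : G.IsShortest u p v := by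
  cases p with
  | nil =>
    refine ⟨h, fun q hq => ?_⟩
    rw [hq.nil_iff.2 h]
  | cons e p => exact h.1

/-- Exchange argument: a competitor from `c`, preceded by `q`, is a competitor from `u`, and it
would beat the given path in length, or tie with it and have a lower last tail. The structure of
`T_v` rests on this. -/
theorem IsLexFirst.suffix (h : G.IsLexFirst num u (p ++ q) v) (hq : G.IsPath u q c)
    (hp : G.IsPath c p v) : G.IsLexFirst num c p v := by
  induction p generalizing v with
  | nil => exact hp
  | cons e p ih =>
    refine ⟨⟨hp, fun r hr => ?_⟩, fun e' r hr => ?_, ih h.2.2 hp.2⟩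
    · have : G.length (e :: p ++ q) ≤ G.length (r ++ q) := h.1.2 (r ++ q) (hq.append hr)
      rw [length_append, length_append] at this
      linarith
    · refine h.2.1 e' (r ++ q) ⟨hq.append hr.1, fun t ht => ?_⟩
      have h1 : G.length (e :: p ++ q) ≤ G.length t := h.1.2 t ht
      have h2 := hr.2 (e :: p) hp
      rw [length_append] at h1
      rw [← List.cons_append, length_append]
      linarith

/-- Induction along the numbering: extend the paths to the direct ancestors of `v` and choose the
best extension. Acyclicity thus guarantees shortest paths even with negative weights. -/
theorem exists_isLexFirst (hnum : G.IsNumbering num) (h : G.Reach u v) :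
    ∃ p, G.IsLexFirst num u p v := by
  classical
  generalize hk : num v = k
  induction k using Nat.strong_induction_on generalizing v with
  | _ k ih =>
    rcases reach_iff.1 h with rfl | h
    · exact ⟨[], rfl⟩
    have hex : ∀ e, G.head e = v ∧ G.Reach u (G.tail e) → ∃ p, G.IsLexFirst num u p (G.tail e) :=
      fun e he => ih _ (hk ▸ hnum.lt_of_adj _ _ (he.1 ▸ adj_edge e)) he.2 rfl
    choose! P hP using hex
    obtain ⟨e₀, he₀⟩ := h.exists_edge
    let S : Finset (Fin m) := Finset.univ.filter fun e => G.head e = v ∧ G.Reach u (G.tail e)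
    -- One minimum over lexicographically ordered pairs makes the path shortest and its last tail
    -- lowest among the ties.
    obtain ⟨e, heS, hmin⟩ := S.exists_min_image
      (fun e => toLex (G.weight e + G.length (P e), num (G.tail e))) ⟨e₀, by simpa [S] using he₀⟩
    have he : G.head e = v ∧ G.Reach u (G.tail e) := by simpa [S] using heS
    have hmin' : ∀ e', G.head e' = v ∧ G.Reach u (G.tail e') →
        G.weight e + G.length (P e) < G.weight e' + G.length (P e') ∨
        G.weight e + G.length (P e) = G.weight e' + G.length (P e') ∧
          num (G.tail e) ≤ num (G.tail e') := fun e' he' => by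
      have := hmin e' (by simpa [S] using he')
      simpa [Prod.Lex.toLex_le_toLex] using this
    have hsh : G.IsShortest u (e :: P e) v := by
      refine ⟨⟨he.1, (hP e he).isPath⟩, fun q hq => ?_⟩
      cases q with
      | nil => exact (G.acyclic v ((show u = v from hq) ▸ h)).elim
      | cons e' q =>
        have he' : G.head e' = v ∧ G.Reach u (G.tail e') := ⟨hq.1, hq.2.reach⟩
        have h1 := (hP e' he').isShortest.2 q hq.2
        rw [length_cons, length_cons]
        rcases hmin' e' he' with h | ⟨h, -⟩ <;> linarith
    refine ⟨e :: P e, hsh, fun e' p' hp' => ?_, hP e he⟩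
    have he' : G.head e' = v ∧ G.Reach u (G.tail e') := ⟨hp'.1.1, hp'.1.2.reach⟩
    have h1 := hp'.2 _ hsh.1
    have h2 := hp'.tail.2 _ (hP e' he').isPath
    have h3 := (hP e' he').isShortest.2 _ hp'.1.2
    rw [length_cons, length_cons] at h1
    rcases hmin' e' he' with h | ⟨-, h⟩
    · linarith
    · exact h

open Classical in
/-- The lexicographically-first shortest path. -/
noncomputable def lexPath (G : RealDag n m) (num : Fin n → ℕ) (u v : Fin n) : List (Fin m) :=
  if h : ∃ p, G.IsLexFirst num u p v then h.choose else []

open Classical in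
/-- The length of a shortest path, and `∞` if there is no path. -/
noncomputable def dist (G : RealDag n m) (num : Fin n → ℕ) (u v : Fin n) : WithTop ℝ :=
  if G.Reach u v then (G.length (G.lexPath num u v) : WithTop ℝ) else ⊤

/-- The vertex after `u` on the lexicographically-first shortest path from `u` to `v`. -/
noncomputable def nxt (G : RealDag n m) (num : Fin n → ℕ) (u v : Fin n) : Fin n :=
  -- Paths are listed with the last edge first, so the first edge of the path is at the end of the
  -- list. The default covers the empty list.
  ((G.lexPath num u v).getLast?.map G.head).getD v

theorem lexPath_spec (hnum : G.IsNumbering num) (h : G.Reach u v) :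
    G.IsLexFirst num u (G.lexPath num u v) v := by
  have := exists_isLexFirst hnum h
  rw [lexPath, dif_pos this]
  exact this.choose_spec

theorem IsLexFirst.lexPath_eq (hnum : G.IsNumbering num) (h : G.IsLexFirst num u p v) :
    G.lexPath num u v = p :=
  (lexPath_spec hnum h.isPath.reach).unique hnum h

theorem IsShortest.dist_eq (hnum : G.IsNumbering num) (h : G.IsShortest u p v) :
    G.dist num u v = (G.length p : WithTop ℝ) := by
  have hs := lexPath_spec hnum h.1.reach
  rw [dist, if_pos h.1.reach, le_antisymm (hs.isShortest.2 _ h.1) (h.2 _ hs.isPath)]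

theorem dist_self (hnum : G.IsNumbering num) (u : Fin n) : G.dist num u u = 0 := by
  have : G.IsLexFirst num u [] u := rfl
  rw [this.isShortest.dist_eq hnum]
  simp [length]

theorem dist_eq_top (h : ¬ G.Reach u v) : G.dist num u v = ⊤ := if_neg h

theorem dist_ne_top (h : G.Reach u v) : G.dist num u v ≠ ⊤ := by
  rw [dist, if_pos h]; exact WithTop.coe_ne_top

theorem dist_ne_top_iff : G.dist num u v ≠ ⊤ ↔ G.Reach u v :=
  ⟨fun h => by_contra fun h' => h (dist_eq_top h'), dist_ne_top⟩

variable (G num) in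
/-- `e` is the last edge of the lexicographically-first shortest path from `u` to `v`. -/
structure IsParent (u v : Fin n) (e : Fin m) : Prop where
  head : G.head e = v
  reach : G.Reach u (G.tail e)
  min : ∀ e', G.head e' = v →
    G.dist num u (G.tail e) + G.weight e < G.dist num u (G.tail e') + G.weight e' ∨
    G.dist num u (G.tail e) + G.weight e = G.dist num u (G.tail e') + G.weight e' ∧
      num (G.tail e) ≤ num (G.tail e')

theorem IsParent.unique (hnum : G.IsNumbering num) (h : G.IsParent num u v e)
    (h' : G.IsParent num u v e') : e = e' := by
  refine edge_ext (hnum.injective ?_) (h.head.trans h'.head.symm)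
  rcases h.min e' h'.head with h1 | ⟨h3, h1⟩ <;> rcases h'.min e h.head with h2 | ⟨h4, h2⟩
  · exact absurd h2 h1.asymm
  · exact absurd h4.symm h1.ne
  · exact absurd h3.symm h2.ne
  · exact le_antisymm h1 h2

/-- Turns the condition on paths into a comparison of distances, with `∞` for unreachable tails.
This is the comparison that `findDirect` makes on the table. -/
theorem IsLexFirst.isParent (hnum : G.IsNumbering num) (h : G.IsLexFirst num u (e :: p) v) :
    G.IsParent num u v e := by
  refine ⟨h.1.1.1, h.1.1.2.reach, fun e' he' => ?_⟩
  by_cases hr : G.Reach u (G.tail e')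
  · have hs := lexPath_spec hnum hr
    have hp : G.IsPath u (e' :: G.lexPath num u (G.tail e')) v := ⟨he', hs.isPath⟩
    rw [h.1.tail.dist_eq hnum, hs.isShortest.dist_eq hnum]
    have h1 := h.1.2 _ hp
    rw [length_cons, length_cons] at h1
    norm_cast
    rcases h1.lt_or_eq with h2 | h2
    · left; linarith
    · refine .inr ⟨by linarith, h.2.1 e' _ ⟨hp, fun q hq => ?_⟩⟩
      have := h.1.2 q hq
      rw [length_cons] at this ⊢
      linarith
  · left
    rw [dist_eq_top hr, h.1.tail.dist_eq hnum]
    rw [top_add]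
    exact_mod_cast WithTop.coe_lt_top _

theorem IsParent.lexPath_eq (hnum : G.IsNumbering num) (h : G.IsParent num u v e) :
    G.lexPath num u v = e :: G.lexPath num u (G.tail e) := by
  have hs := lexPath_spec hnum (h.reach.ancestor h.head).reach
  cases hl : G.lexPath num u v with
  | nil =>
    rw [hl] at hs
    exact (G.acyclic u ((show u = v from hs) ▸ h.reach.ancestor h.head)).elim
  | cons e' p =>
    rw [hl] at hs
    obtain rfl := h.unique hnum (hs.isParent hnum)
    rw [hs.2.2.lexPath_eq hnum]

theorem IsParent.ancestor (h : G.IsParent num u v e) : G.Ancestor u v := h.reach.ancestor h.head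

theorem IsParent.dist_eq (hnum : G.IsNumbering num) (h : G.IsParent num u v e) :
    G.dist num u v = G.dist num u (G.tail e) + G.weight e := by
  rw [dist, if_pos h.ancestor.reach, dist, if_pos h.reach, h.lexPath_eq hnum, length_cons]
  norm_cast
  ring

theorem lexPath_self (hnum : G.IsNumbering num) (u : Fin n) : G.lexPath num u u = [] :=
  IsLexFirst.lexPath_eq hnum (show G.IsLexFirst num u [] u from rfl)

theorem IsParent.nxt_of_eq (hnum : G.IsNumbering num) (h : G.IsParent num u v e)
    (hu : u = G.tail e) : G.nxt num u v = v := by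
  rw [nxt, h.lexPath_eq hnum, ← hu, lexPath_self hnum]
  simp [h.head]

/-- Removing the last edge does not change the first edge if any edge remains. This justifies
copying entries of `NEXT` from the column of the direct ancestor. -/
theorem IsParent.nxt_of_ne (hnum : G.IsNumbering num) (h : G.IsParent num u v e)
    (hu : u ≠ G.tail e) : G.nxt num u v = G.nxt num u (G.tail e) := by
  have : G.lexPath num u (G.tail e) ≠ [] := fun h0 => hu <| by
    have := lexPath_spec hnum h.reach
    rw [h0] at this
    exact this
  rw [nxt, nxt, h.lexPath_eq hnum, List.getLast?_cons, List.getLast?_eq_some_getLast this]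
  simp

/-- The first edge of the lexicographically-first shortest path. -/
theorem Ancestor.lexPath_eq_append (hnum : G.IsNumbering num) (h : G.Ancestor u v) :
    ∃ p e, G.lexPath num u v = p ++ [e] ∧ G.tail e = u ∧ G.head e = G.nxt num u v ∧
      G.IsLexFirst num (G.nxt num u v) p v := by
  have hs := lexPath_spec hnum h.reach
  rcases List.eq_nil_or_concat (G.lexPath num u v) with hl | ⟨p, e, hl⟩
  · rw [hl] at hs
    exact (G.acyclic u ((show u = v from hs) ▸ h)).elim
  · rw [List.concat_eq_append] at hl
    rw [hl] at hs
    obtain ⟨w, h1, h2⟩ := hs.isPath.exists_of_append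
    have hn : G.head e = G.nxt num u v := by simp [nxt, hl]
    refine ⟨p, e, hl, h1.2.symm, hn, hs.suffix ⟨hn, h1.2⟩ ?_⟩
    rwa [← hn, h1.1]

/-- The next vertex of the path has the same parent edge. -/
theorem IsParent.parent_nxt (hnum : G.IsNumbering num) (h : G.IsParent num u v e)
    (hu : u ≠ G.tail e) : G.IsParent num (G.nxt num u v) v e := by
  obtain ⟨p, e₀, h1, h2, h3, h4⟩ := h.ancestor.lexPath_eq_append hnum
  rw [h.lexPath_eq hnum] at h1
  cases p with
  | nil =>
    simp only [List.nil_append, List.cons.injEq] at h1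
    exact (hu (by rw [h1.1, h2])).elim
  | cons e' p =>
    simp only [List.cons_append, List.cons.injEq] at h1
    rw [← h1.1] at h4
    exact h4.isParent hnum

/-- The last edge alone is a final part of the path, hence lexicographically first. This is the
entry that `addFragment` makes after its loop. -/
theorem IsParent.parent_tail (hnum : G.IsNumbering num) (h : G.IsParent num u v e) :
    G.IsParent num (G.tail e) v e := by
  have hs := lexPath_spec hnum h.ancestor.reach
  rw [h.lexPath_eq hnum] at hs
  exact (IsLexFirst.suffix (p := [e]) hs hs.isPath.2 ⟨h.head, rfl⟩).isParent hnum

/-- An edge of some lexicographically-first path to `v` starts the remaining part of that path,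
which is the lexicographically-first path from its tail. So each ancestor is the tail of exactly one
edge, and the union of the paths is determined by `nxt`. -/
theorem mem_treeEdges_iff (hnum : G.IsNumbering num) :
    e ∈ G.treeEdges num v ↔ G.Ancestor (G.tail e) v ∧ G.head e = G.nxt num (G.tail e) v := by
  constructor
  · rintro ⟨u, p, h, hp, he⟩
    -- Since lists run backwards, `b` is the part of the path before `e`, and `a` the part after it.
    obtain ⟨a, b, rfl⟩ := List.append_of_mem he
    have h0 := hp.isPath
    rw [List.append_cons] at h0
    obtain ⟨w, h1, h2⟩ := h0.exists_of_append
    obtain ⟨w', h3, h4⟩ := h2.exists_of_append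
    obtain rfl : G.head e = w' := h3.1
    have hw : w = G.tail e := h3.2
    subst hw
    rw [List.append_cons] at hp
    have hl := hp.suffix h1 h2
    refine ⟨Relation.TransGen.head' (adj_edge e) h4.reach, ?_⟩
    simp [nxt, hl.lexPath_eq hnum]
  · rintro ⟨h, he⟩
    obtain ⟨p, e', h1, h2, h3, h4⟩ := h.lexPath_eq_append hnum
    obtain rfl := edge_ext h2 (h3.trans he.symm)
    exact ⟨_, _, h, lexPath_spec hnum h.reach, by simp [h1]⟩

theorem Ancestor.exists_treeEdge (hnum : G.IsNumbering num) (h : G.Ancestor u v) :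
    ∃ e ∈ G.treeEdges num v, G.tail e = u ∧ G.head e = G.nxt num u v ∧
      ∀ e' ∈ G.treeEdges num v, G.tail e' = u → e' = e := by
  obtain ⟨p, e, -, h2, h3, -⟩ := h.lexPath_eq_append hnum
  refine ⟨e, (mem_treeEdges_iff hnum).2 (by rw [h2]; exact ⟨h, h3⟩), h2, h3, fun e' he' ht => ?_⟩
  have := ((mem_treeEdges_iff hnum).1 he').2
  exact edge_ext (ht.trans h2.symm) (by rw [this, ht, h3])

/-- An edge into `u` comes from a vertex with a smaller number, so only vertices visited before `u`
have to be excluded as tails. -/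
theorem mem_leaf_of_ancestor (hnum : G.IsNumbering num) (h : G.Ancestor u v)
    (hu : ∀ x, G.Ancestor x v → num x < num u → G.nxt num x v ≠ u) : u ∈ G.leaf num v := by
  obtain ⟨e, he, h1, h2, -⟩ := h.exists_treeEdge hnum
  refine ⟨.inr ⟨e, he, .inl h1⟩, fun e' he' hh => ?_⟩
  obtain ⟨h3, h4⟩ := (mem_treeEdges_iff hnum).1 he'
  exact hu _ h3 (hnum.lt_of_adj _ _ (hh ▸ adj_edge e')) (h4 ▸ hh)

theorem edges_le (G : RealDag n m) : m ≤ n * n := by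
  simpa using Fintype.card_le_of_injective _ G.simple

theorem IsNumbering.lt_of_ancestor (hnum : G.IsNumbering num) (h : G.Ancestor u v) :
    num u < num v := by
  induction h with
  | single h => exact hnum.lt_of_adj _ _ h
  | tail _ h ih => exact ih.trans (hnum.lt_of_adj _ _ h)

theorem IsNumbering.exists_eq (hnum : G.IsNumbering num) {k : ℕ} (h1 : 1 ≤ k) (h2 : k ≤ n) :
    ∃ v, num v = k := by
  have hinj : Function.Injective fun v => (⟨num v - 1, by
      have := hnum.pos v; have := hnum.le v; omega⟩ : Fin n) := fun u v h => by
    have := hnum.pos u; have := hnum.pos v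
    simp only [Fin.mk.injEq] at h
    exact hnum.injective (by omega)
  obtain ⟨v, hv⟩ := (Finite.injective_iff_surjective.1 hinj) ⟨k - 1, by omega⟩
  have := hnum.pos v
  simp only [Fin.mk.injEq] at hv
  exact ⟨v, by omega⟩

/-- The sources form an initial segment of the numbering, and counting determines where it ends.
This is why the main loop may start right after the number of sources. -/
theorem IsNumbering.isSource_iff (hnum : G.IsNumbering num) :
    G.IsSource v ↔ num v ≤ {v | G.IsSource v}.ncard := by
  classical
  have hinj : ∀ S : Set (Fin n), (num '' S).ncard = S.ncard := fun S =>
    Set.ncard_image_of_injective S hnum.injective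
  constructor
  · intro h
    have hsub : ↑(Finset.Icc 1 (num v)) ⊆ num '' {v | G.IsSource v} := by
      intro k hk
      simp only [Finset.coe_Icc, Set.mem_Icc] at hk
      obtain ⟨w, rfl⟩ := hnum.exists_eq hk.1 (hk.2.trans (hnum.le v))
      refine ⟨w, by_contra fun hw => ?_, rfl⟩
      have := hnum.sources_first v w h hw
      omega
    have := Set.ncard_le_ncard hsub (Set.toFinite _)
    rwa [Set.ncard_coe_finset, hinj, Nat.card_Icc, Nat.add_sub_cancel] at this
  · intro h
    by_contra hv
    have hsub : num '' {v | G.IsSource v} ⊆ ↑(Finset.Icc 1 (num v - 1)) := by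
      rintro _ ⟨w, hw, rfl⟩
      have := hnum.sources_first w v hw hv
      have := hnum.pos w
      simp only [Finset.coe_Icc, Set.mem_Icc]
      omega
    have := Set.ncard_le_ncard hsub (Set.toFinite _)
    rw [Set.ncard_coe_finset, hinj, Nat.card_Icc] at this
    have := hnum.pos v
    omega

end RealDag

namespace RealRam

variable {W : ℕ} {s : State} {Q : State → ℕ → Prop}

attribute [simp] wp WExp.Safe RExp.Safe Cond.Safe WExp.val RExp.val Cond.Holds WExp.cost RExp.cost
  Cond.cost Prog.block Prog.forUp Prog.Writes

/-! ### Loop rules with frames -/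

theorem Frame.reg {p : Prog} {s s' : State} (h : Frame p s s') (x : ℕ) (hx : ¬ p.Writes (.reg x)) :
    s'.reg x = s.reg x := h _ hx

theorem Frame.mem {p : Prog} {s s' : State} (h : Frame p s s') (a : ℕ) (ha : ¬ p.Writes (.mem a)) :
    s'.mem a = s.mem a := h _ ha

theorem Frame.rreg {p : Prog} {s s' : State} (h : Frame p s s') (x : ℕ)
    (hx : ¬ p.Writes (.rreg x)) : s'.rreg x = s.rreg x := h _ hx

theorem Frame.rmem {p : Prog} {s s' : State} (h : Frame p s s') (a : ℕ)
    (ha : ¬ p.Writes (.rmem a)) : s'.rmem a = s.rmem a := h _ ha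

/-- Whatever the body does not write is the same as on entry, in every round. Invariants then need
to mention only what changes. -/
theorem Run.loopFrame {c : Cond} {p : Prog} (I : ℕ → State → ℕ → Prop) (k : ℕ) (h0 : I k s 0)
    (hstep : ∀ k z t, z.Valid W → Frame p s z → I k z t → c.Safe W z ∧
      (¬ c.Holds z → Q z (t + (c.cost + 1))) ∧
      (c.Holds z → Run W p z fun s' t' => ∃ k' < k, I k' s' (t + (c.cost + 1 + t')))) :
    Run W (.loop c p) s Q := by
  refine Run.loop (fun k z t => I k z t ∧ Frame p s z) k ⟨h0, fun l _ => .refl _ _⟩ ?_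
  rintro k z t hz ⟨hI, hF⟩
  obtain ⟨h1, h2, h3⟩ := hstep k z t hz hF hI
  refine ⟨h1, h2, fun hc => (h3 hc).frame.mono ?_⟩
  rintro s' t' - ⟨⟨k', h4, h5⟩, h6⟩
  exact ⟨k', h4, h5, fun l hl => (hF l hl).trans (h6 l hl)⟩

/-- In the frame, `.seq p (.set x hi)` merely names a set of locations: those written by the body,
and the counter. It is never executed. -/
theorem Run.forUp_loopFrame {x : ℕ} {hi : WExp} {p : Prog} {lo : ℕ} (H : ℕ)
    (I : ℕ → State → ℕ → Prop) (hle : lo ≤ H) (hreg : s.reg x = lo) (h0 : I lo s 0) (hx : ¬ p.Writes (.reg x))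
    (hhi : ∀ k z t, lo ≤ k → k ≤ H → Frame (.seq p (.set x hi)) s z → z.reg x = k → I k z t →
      hi.Safe W z ∧ hi.val z = H)
    (hbody : ∀ k z t, z.Valid W → lo ≤ k → k < H → k + 1 < W →
      Frame (.seq p (.set x hi)) s z → z.reg x = k → I k z t →
      Run W p z fun s' t' => I (k + 1) (s'.setReg x (k + 1)) (t + (t' + (hi.cost + 7))))
    (hQ : ∀ z t, z.Valid W → Frame (.seq p (.set x hi)) s z → z.reg x = H → I H z t →
      Q z (t + (hi.cost + 3))) :
    Run W (.loop (.lt (.reg x) hi) (.seq p (.set x (.add (.reg x) (.const 1))))) s Q := by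
  refine Run.loop (fun k z t => k = H - z.reg x ∧ lo ≤ z.reg x ∧ z.reg x ≤ H ∧ I (z.reg x) z t ∧
      Frame (.seq p (.set x hi)) s z) _ ⟨rfl, hreg.ge, hreg ▸ hle, hreg ▸ h0, fun l _ => .refl _ _⟩ ?_
  rintro k z t hz ⟨rfl, h1, h2, h3, h4⟩
  obtain ⟨hsafe, hval⟩ := hhi _ z t h1 h2 h4 rfl h3
  have hHW : H < W := hval ▸ (hsafe.fits hz).val_lt
  refine ⟨⟨trivial, hsafe⟩, ?_, ?_⟩
  · intro hc
    simp only [Cond.Holds, WExp.val, hval, not_lt] at hc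
    have : z.reg x = H := le_antisymm h2 hc
    have := hQ z t hz h4 this (this ▸ h3)
    convert this using 1
    simp; omega
  · intro hc
    simp only [Cond.Holds, WExp.val, hval] at hc
    refine .seq ((hbody _ z t hz h1 hc (by omega) h4 rfl h3).frame.mono ?_)
    rintro s' t' hs' ⟨hI, hF⟩
    have hr : s'.reg x = z.reg x := hF _ hx
    refine Run.of_wp ?_
    simp only [wp, WExp.Safe, WExp.val, hr, State.setReg_reg, Cond.cost, WExp.cost]
    refine ⟨⟨trivial, by omega, by omega⟩, _, by simp; omega, rfl, by simp; omega,
      by simp; omega, ?_, ?_⟩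
    · simp only [if_true]
      convert hI using 1
      omega
    · intro l hl
      simp only [Prog.Writes, not_or] at hl
      refine (h4 l (by simpa using hl)).trans ((hF l hl.1).trans ?_)
      cases l with
      | reg y =>
        have : y ≠ x := fun h => hl.2 (by rw [h])
        simp [Loc.Agree, this]
      | _ => rfl

theorem Frame.mono {p q : Prog} {s s' : State} (h : Frame p s s')
    (hpq : ∀ l, p.Writes l → q.Writes l) : Frame q s s' := fun l hl => h l fun h' => hl (hpq l h')

theorem Frame.of_setReg {x v : ℕ} {p : Prog} {z : State} (hx : p.Writes (.reg x))
    (h : Frame p (s.setReg x v) z) : Frame p s z := by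
  intro l hl
  refine Loc.Agree.trans ?_ (h l hl)
  cases l with
  | reg y =>
    have : y ≠ x := fun h => hl (h ▸ hx)
    simp [Loc.Agree, this]
  | _ => rfl

theorem Run.forUpFrame {x : ℕ} {lo hi : WExp} {p : Prog} (L H : ℕ) (I : ℕ → State → ℕ → Prop)
    (hlo : lo.Safe W s ∧ lo.val s = L) (hle : L ≤ H) (h0 : I L (s.setReg x L) 0)
    (hx : ¬ p.Writes (.reg x))
    (hhi : ∀ k z t, L ≤ k → k ≤ H → Frame (.seq p (.set x hi)) s z → z.reg x = k → I k z t →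
      hi.Safe W z ∧ hi.val z = H)
    (hbody : ∀ k z t, z.Valid W → L ≤ k → k < H → k + 1 < W →
      Frame (.seq p (.set x hi)) s z → z.reg x = k → I k z t →
      Run W p z fun s' t' => I (k + 1) (s'.setReg x (k + 1)) (t + (t' + (hi.cost + 7))))
    (hQ : ∀ z t, z.Valid W → Frame (.seq p (.set x hi)) s z → z.reg x = H → I H z t →
      Q z (t + (lo.cost + hi.cost + 4))) :
    Run W (.forUp x lo hi p) s Q := by
  have hF : ∀ z, Frame (.seq p (.set x hi)) (s.setReg x (lo.val s)) z →
      Frame (.seq p (.set x hi)) s z := fun z => .of_setReg (by simp)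
  refine .seq (.of_wp ⟨hlo.1, ?_⟩)
  refine Run.forUp_loopFrame (lo := L) H I hle (by simp [hlo.2]) (by rwa [hlo.2]) hx
    (fun k z t h1 h2 h3 => hhi k z t h1 h2 (hF z h3))
    (fun k z t h0 h1 h2 h3 h4 => hbody k z t h0 h1 h2 h3 (hF z h4)) fun z t h1 h2 h3 h4 => ?_
  have := hQ z t h1 (hF z h2) h3 h4
  convert this using 1
  omega

/-- A loop that fills cells of a word array. -/
theorem Run.fillUp {x a : ℕ} {hi i e : WExp} (H : ℕ) (f g : ℕ → ℕ)
    (hinj : ∀ k < H, ∀ l < H, f k = f l → k = l)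
    (hhi : ∀ s' : State, (∀ y ≠ x, s'.reg y = s.reg y) → (∀ b ≠ a, s'.mem b = s.mem b) →
      hi.Safe W s' ∧ hi.val s' = H)
    (hfg : ∀ k < H, k + 1 < W → ∀ s' : State, s'.Valid W →
      s'.reg x = k → (∀ y ≠ x, s'.reg y = s.reg y) →
      (∀ b ≠ a, s'.mem b = s.mem b) →
      (i.Safe W s' ∧ i.val s' = f k) ∧ e.Safe W s' ∧ e.val s' = g k)
    (hQ : ∀ s' t, s'.Valid W → (∀ y ≠ x, s'.reg y = s.reg y) →
      (∀ b ≠ a, s'.mem b = s.mem b) → s'.rreg = s.rreg → s'.rmem = s.rmem →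
      (∀ k < H, s'.mem a (f k) = g k) →
      (∀ c, (∀ k < H, f k ≠ c) → s'.mem a c = s.mem a c) →
      t ≤ H * (i.cost + e.cost + hi.cost + 8) + hi.cost + 5 → Q s' t) :
    Run W (.forUp x (.const 0) hi (.put a i e)) s Q := by
  intro hs
  -- Validity is a hypothesis inside `Run`; it is introduced only to see that the constant `0` is a
  -- word, and then handed back.
  have hW : 0 < W := (Nat.zero_le _).trans_lt (hs.1 0)
  revert hs
  refine Run.seq (.of_wp ⟨hW, ?_⟩)
  have hr : ∀ {s' : State}, (∀ y ≠ x, s'.reg y = (s.setReg x (WExp.val s (.const 0))).reg y) →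
      ∀ y ≠ x, s'.reg y = s.reg y := fun h y hy => by simp [h y hy, hy]
  refine Run.fill H f g (by simp) hinj (fun s' h1 h2 => hhi s' (hr h1) h2)
    (fun k hk hkW s' hs' h0 h1 h2 => hfg k hk hkW s' hs' h0 (hr h1) h2)
    fun s' t hs' h0 h1 h2 h3 h4 h5 h6 h7 => hQ s' _ hs' (hr h1) h2 h3 h4 h5 h6 ?_
  simp
  omega

/-! ### Linked lists of edges -/

/-- The pointer `p` leads to the list `l`, if `f` contains the pointers to the next elements. The
number `i` is represented by the pointer `i + 1`. -/
def Linked {m : ℕ} (f : ℕ → ℕ) : ℕ → List (Fin m) → Prop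
  | p, [] => p = 0
  | p, e :: l => p = e + 1 ∧ Linked f (f e) l

theorem Linked.congr {m : ℕ} {f g : ℕ → ℕ} {p : ℕ} {l : List (Fin m)} (h : Linked f p l)
    (hfg : ∀ e ∈ l, g e = f e) : Linked g p l := by
  induction l generalizing p with
  | nil => exact h
  | cons e l ih =>
    refine ⟨h.1, ?_⟩
    rw [hfg e (by simp)]
    exact ih h.2 fun e' he' => hfg e' (by simp [he'])

/-- The loop that puts all edges into linked lists according to the value `key`. -/
theorem Run.link {m : ℕ} {key : Fin m → ℕ} {keyE : WExp} (hm : s.reg 1 = m)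
    (hkey : ∀ (e : Fin m) (z : State), z.Valid W → z.reg 7 = e →
      (∀ a, a ≠ 5 → a ≠ 6 → z.mem a = s.mem a) → keyE.Safe W z ∧ keyE.val z = key e)
    (hQ : ∀ z t, z.Valid W → Frame (.block [.set 9 (.const 0), .put 6 (.const 0) (.const 0),
        .put 5 (.const 0) (.const 0), .set 7 (.const 0)]) s z →
      (∀ k, s.mem 5 k = 0 → ∃ l : List (Fin m), Linked (z.mem 6) (z.mem 5 k) l ∧ l.Nodup ∧
        ∀ e, e ∈ l ↔ key e = k) → t ≤ m * (keyE.cost + 30) + 6 → Q z t) :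
    Run W (.forUp 7 (.const 0) (.reg 1) (.block [
      .set 9 keyE,
      .put 6 (.reg 7) (.get 5 (.reg 9)),
      .put 5 (.reg 9) (.add (.reg 7) (.const 1))])) s Q := by
  intro hs
  have hW : 0 < W := (Nat.zero_le _).trans_lt (hs.1 0)
  revert hs
  refine Run.forUpFrame 0 m (fun k z t => (∀ i, s.mem 5 i = 0 → ∃ l : List (Fin m),
    Linked (z.mem 6) (z.mem 5 i) l ∧ l.Nodup ∧ ∀ e, e ∈ l ↔ key e = i ∧ e < k) ∧
    t ≤ k * (keyE.cost + 30)) ⟨hW, rfl⟩ (Nat.zero_le _) ?_ (by simp) ?_ ?_ ?_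
  · exact ⟨fun i hi => ⟨[], by simpa [Linked] using hi, by simp⟩, by simp⟩
  · intro k z t _ _ hF _ _
    refine ⟨trivial, ?_⟩
    have := hF.reg 1 (by simp)
    simp [this, hm]
  · rintro k z t hz - hk hkW hF hx ⟨h1, h2⟩
    obtain ⟨h3, h4⟩ := hkey ⟨k, hk⟩ z hz hx fun a h5 h6 => hF.mem a (by simp [h5, h6])
    refine Run.of_wp ?_
    simp only [Prog.block, wp, WExp.Safe, WExp.val, h3, h4, State.setReg_reg, State.setReg_mem,
      WExp.cost, State.setMem_reg, State.setMem_mem]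
    simp only [true_and, if_true, hx]
    refine ⟨by simp; omega, ?_, ?_⟩
    · intro i hi
      obtain ⟨l, l1, l2, l3⟩ := h1 i hi
      -- The lists built so far contain only edges below `k`, so writing the pointer of edge `k`
      -- cannot damage them.
      have hkl : (⟨k, hk⟩ : Fin m) ∉ l := fun h => by
        have := ((l3 _).1 h).2; simp at this
      have hcongr : ∀ e ∈ l, (if (e : ℕ) = k then z.mem 5 (key ⟨k, hk⟩) else z.mem 6 e) =
          z.mem 6 e := fun e he => by
        have : (e : ℕ) ≠ k := fun h => hkl (by subst h; exact he)
        simp [this]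
      by_cases hik : i = key ⟨k, hk⟩
      · refine ⟨⟨k, hk⟩ :: l, ⟨?_, ?_⟩, ?_, ?_⟩
        · simp [hik]
        · convert l1.congr (g := _) fun e he => ?_ using 1
          · simp [hik]
          · simpa using hcongr e he
        · simp [l2, hkl]
        · intro e
          simp only [List.mem_cons, l3, hik, Fin.ext_iff]
          constructor
          · rintro (h | ⟨h, h'⟩)
            · have : e = ⟨k, hk⟩ := Fin.ext h
              exact ⟨by rw [this], by omega⟩
            · exact ⟨h, by omega⟩
          · rintro ⟨h, h'⟩
            by_cases he : (e : ℕ) = k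
            · exact .inl he
            · exact .inr ⟨h, by omega⟩
      · refine ⟨l, ?_, l2, ?_⟩
        · convert l1.congr (g := _) fun e he => ?_ using 1
          · simp [hik]
          · simpa using hcongr e he
        · intro e
          rw [l3]
          constructor
          · rintro ⟨h, h'⟩
            exact ⟨h, by omega⟩
          · rintro ⟨h, h'⟩
            refine ⟨h, ?_⟩
            have : (e : ℕ) ≠ k := fun he => hik (by rw [← h, show e = ⟨k, hk⟩ from Fin.ext he])
            omega
    · rw [add_mul]; omega
  · rintro z t hz hF hx ⟨h1, h2⟩
    refine hQ _ _ hz ?_ ?_ ?_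
    · intro l hl
      refine hF l fun h => hl ?_
      simp at h ⊢
      tauto
    · intro k hk
      obtain ⟨l, l1, l2, l3⟩ := h1 k hk
      exact ⟨l, l1, l2, fun e => by rw [l3]; simp⟩
    · simp; omega

end RealRam

/-! ## Numbering the vertices in linear time -/

namespace Apsp

open RealRam

variable {n m : ℕ} {G : RealDag n m} {W : ℕ}

/-- Number the vertices in the order in which a queue of vertices is processed, where a vertex
enters the queue once all its direct ancestors have been processed. -/
def kahn : Prog := .block [
  .forUp 3 (.const 0) (.reg 0) (.put 5 (.reg 3) (.const 0)),
  .forUp 7 (.const 0) (.reg 1) (.block [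
    .set 9 (.get 0 (.reg 7)),
    .put 6 (.reg 7) (.get 5 (.reg 9)),
    .put 5 (.reg 9) (.add (.reg 7) (.const 1))]),
  .forUp 3 (.const 0) (.reg 0) (.put 8 (.reg 3) (.const 0)),
  .forUp 7 (.const 0) (.reg 1)
    (.put 8 (.get 1 (.reg 7)) (.add (.get 8 (.get 1 (.reg 7))) (.const 1))),
  .set 4 (.const 0),
  .forUp 3 (.const 0) (.reg 0) (.branch (.eq (.get 8 (.reg 3)) (.const 0))
    (.block [.put 9 (.reg 4) (.reg 3), .set 4 (.add (.reg 4) (.const 1))]) .skip),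
  .set 2 (.reg 4),
  .set 3 (.const 0),
  .loop (.lt (.reg 3) (.reg 4)) (.block [
    .set 5 (.get 9 (.reg 3)),
    .put 2 (.reg 5) (.add (.reg 3) (.const 1)),
    .set 7 (.get 5 (.reg 5)),
    .loop (.not (.eq (.reg 7) (.const 0))) (.block [
      .set 6 (.get 1 (.sub (.reg 7) (.const 1))),
      .put 8 (.reg 6) (.sub (.get 8 (.reg 6)) (.const 1)),
      .branch (.eq (.get 8 (.reg 6)) (.const 0))
        (.block [.put 9 (.reg 4) (.reg 6), .set 4 (.add (.reg 4) (.const 1))]) .skip,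
      .set 7 (.get 6 (.sub (.reg 7) (.const 1)))]),
    .set 3 (.add (.reg 3) (.const 1))])]

/-- The queue contains `q`, and for the remaining vertices the number of incoming edges outside `X`
is stored. -/
structure Queue (G : RealDag n m) (q : List (Fin n)) (X : Finset (Fin m)) (r : ℕ) (z : State) :
    Prop where
  nodup : q.Nodup
  size : z.reg 4 = q.length
  queue : ∀ i (h : i < q.length), z.mem 9 i = q[i]
  deg : ∀ v : Fin n, z.mem 8 v = (Finset.univ.filter fun e => e ∉ X ∧ G.head e = v).card
  mem_iff : ∀ v : Fin n, v ∈ q ↔ z.mem 8 v = 0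
  tail_mem : ∀ e ∈ X, G.tail e ∈ q
  order : ∀ i (h : i < q.length) e, G.head e = q[i] → G.tail e ∈ q.take i
  le : r ≤ q.length
  source : ∀ i (h : i < q.length), G.IsSource q[i] ↔ i < r

theorem Queue.congr {q : List (Fin n)} {X : Finset (Fin m)} {r : ℕ} {z z' : State}
    (h : Queue G q X r z) (h4 : z'.reg 4 = z.reg 4) (h8 : z'.mem 8 = z.mem 8)
    (h9 : z'.mem 9 = z.mem 9) : Queue G q X r z' :=
  ⟨h.nodup, h4 ▸ h.size, h9 ▸ h.queue, h8 ▸ h.deg, h8 ▸ h.mem_iff, h.tail_mem, h.order, h.le,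
    h.source⟩

theorem card_filter_insert {X : Finset (Fin m)} {e : Fin m} (he : e ∉ X) (v : Fin n) :
    (Finset.univ.filter fun f => f ∉ X ∧ G.head f = v).card =
      (Finset.univ.filter fun f => f ∉ insert e X ∧ G.head f = v).card +
        if G.head e = v then 1 else 0 := by
  classical
  split_ifs with h
  · rw [← Finset.card_insert_of_notMem
      (a := e) (s := Finset.univ.filter fun f => f ∉ insert e X ∧ G.head f = v) (by simp)]
    congr 1
    ext f
    by_cases hf : f = e
    · subst hf; simp [he, h]
    · simp [hf]
  · rw [add_zero]
    congr 1
    ext f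
    by_cases hf : f = e
    · subst hf; simp [h]
    · simp [hf]

/-- One edge out of a processed vertex is removed, and its head is not free yet. -/
theorem Queue.step_pos {q : List (Fin n)} {X : Finset (Fin m)} {r : ℕ} {z z' : State}
    (h : Queue G q X r z) {e : Fin m} (he : e ∉ X) (hq : G.tail e ∈ q)
    (h4 : z'.reg 4 = z.reg 4) (h9 : z'.mem 9 = z.mem 9)
    (h8 : ∀ v : Fin n, z'.mem 8 v = if v = G.head e then z.mem 8 v - 1 else z.mem 8 v)
    (hpos : z.mem 8 (G.head e) - 1 ≠ 0) : Queue G q (insert e X) r z' := by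
  refine ⟨h.nodup, h4 ▸ h.size, h9 ▸ h.queue, fun v => ?_, fun v => ?_, ?_, h.order, h.le,
    h.source⟩
  · rw [h8 v, h.deg v, card_filter_insert he v]
    split_ifs with h1 h2 h2
    · omega
    · exact (h2 h1.symm).elim
    · exact (h1 h2.symm).elim
    · omega
  · rw [h.mem_iff, h8 v]
    split_ifs with h1
    · subst h1; omega
    · rfl
  · intro f hf
    rcases Finset.mem_insert.1 hf with rfl | hf
    · exact hq
    · exact h.tail_mem f hf

/-- One edge out of a processed vertex is removed, and its head enters the queue. -/
theorem Queue.step_zero {q : List (Fin n)} {X : Finset (Fin m)} {r : ℕ} {z z' : State}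
    (h : Queue G q X r z) {e : Fin m} (he : e ∉ X) (hq : G.tail e ∈ q)
    (h4 : z'.reg 4 = z.reg 4 + 1)
    (h9 : ∀ i, z'.mem 9 i = if i = z.reg 4 then (G.head e : ℕ) else z.mem 9 i)
    (h8 : ∀ v : Fin n, z'.mem 8 v = if v = G.head e then z.mem 8 v - 1 else z.mem 8 v)
    (hzero : z.mem 8 (G.head e) - 1 = 0) : Queue G (q ++ [G.head e]) (insert e X) r z' := by
  have hdeg : ∀ v : Fin n, z'.mem 8 v =
      (Finset.univ.filter fun f => f ∉ insert e X ∧ G.head f = v).card := fun v => by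
    rw [h8 v, h.deg v, card_filter_insert he v]
    split_ifs with h1 h2 h2
    · omega
    · exact (h2 h1.symm).elim
    · exact (h1 h2.symm).elim
    · omega
  have hmem : G.head e ∉ q := by
    rw [h.mem_iff, h.deg, card_filter_insert he]
    simp
  -- The counter of the head has reached zero, so all its incoming edges are removed and their tails
  -- are in the queue. This gives the topological order for the new member.
  have hin : ∀ f, G.head f = G.head e → G.tail f ∈ q := fun f hf => by
    have h0 := hdeg (G.head e)
    rw [h8, if_pos rfl, hzero, eq_comm, Finset.card_eq_zero, Finset.filter_eq_empty_iff] at h0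
    have := @h0 f (Finset.mem_univ _)
    simp only [hf, and_true, not_not] at this
    rcases Finset.mem_insert.1 this with rfl | h1
    · exact hq
    · exact h.tail_mem f h1
  have hlt : ∀ i, i < (q ++ [G.head e]).length → i < q.length ∨ i = q.length := fun i hi => by
    simp at hi; omega
  refine ⟨?_, by simp [h4, h.size], fun i hi => ?_, hdeg, fun v => ?_, fun f hf => ?_,
    fun i hi f hf => ?_, by simp; have := h.le; omega, fun i hi => ?_⟩
  · rw [List.nodup_append]
    refine ⟨h.nodup, by simp, ?_⟩
    rintro a ha b hb rfl
    simp only [List.mem_singleton] at hb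
    exact hmem (hb ▸ ha)
  · rw [h9, h.size]
    rcases hlt i hi with h1 | rfl
    · rw [if_neg h1.ne, h.queue i h1, List.getElem_append_left h1]
    · simp
  · rw [h8 v, List.mem_append, h.mem_iff, List.mem_singleton]
    split_ifs with h1
    · subst h1; simp [hzero]
    · simp [h1]
  · rw [List.mem_append]
    rcases Finset.mem_insert.1 hf with rfl | hf
    · exact .inl hq
    · exact .inl (h.tail_mem f hf)
  · rcases hlt i hi with h1 | rfl
    · rw [List.getElem_append_left h1] at hf
      rw [List.take_append_of_le_length h1.le]
      exact h.order i h1 f hf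
    · simp only [List.getElem_concat_length] at hf
      simpa using hin f hf
  · rcases hlt i hi with h1 | rfl
    · rw [List.getElem_append_left h1]
      exact h.source i h1
    · simp only [List.getElem_concat_length]
      constructor
      · intro hs; exact (hs e rfl).elim
      · intro hs; have := h.le; omega

/-- If all vertices in the queue have been processed, then these are all vertices. -/
theorem Queue.mem {q : List (Fin n)} {X : Finset (Fin m)} {r : ℕ} {z : State}
    (h : Queue G q X r z) (hX : ∀ e, G.tail e ∈ q → e ∈ X) (v : Fin n) : v ∈ q := by
  have : Std.Irrefl G.Ancestor := ⟨G.acyclic⟩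
  have : IsTrans (Fin n) G.Ancestor := ⟨fun _ _ _ h h' => Relation.TransGen.trans h h'⟩
  -- Induction along the ancestors: if all direct ancestors of `v` are in the queue, all edges into
  -- `v` have been removed, so its counter is zero and `v` is in the queue.
  induction v using (Finite.wellFounded_of_trans_of_irrefl G.Ancestor).induction with
  | _ v ih =>
    rw [h.mem_iff, h.deg, Finset.card_eq_zero, Finset.filter_eq_empty_iff]
    rintro e - ⟨h1, h2⟩
    exact h1 (hX e (ih _ (.single ⟨e, rfl, h2⟩)))

/-- A vertex is numbered by its position plus one. The condition `order` makes this topological, and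
by `source` the sources occupy exactly the first `r` positions. -/
theorem Queue.isNumbering {q : List (Fin n)} {X : Finset (Fin m)} {r : ℕ} {z : State}
    (h : Queue G q X r z) (hq : ∀ v, v ∈ q) : G.IsNumbering (fun v => q.idxOf v + 1) ∧
      r = {v | G.IsSource v}.ncard := by
  classical
  have hlen : q.length ≤ n := by simpa using h.nodup.length_le_card
  have hidx : ∀ v, q.idxOf v < q.length := fun v => List.idxOf_lt_length_of_mem (hq v)
  have hget : ∀ v, q[q.idxOf v]'(hidx v) = v := fun v => List.getElem_idxOf (hidx v)
  have hsrc : ∀ v, G.IsSource v ↔ q.idxOf v < r := fun v => by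
    rw [← h.source _ (hidx v), hget]
  refine ⟨⟨fun u v huv => ?_, fun v => by omega, fun v => ?_, ?_, fun u v hu hv => ?_⟩, ?_⟩
  · exact (List.idxOf_inj (hq u)).1 (by simpa using huv)
  · have := hidx v; omega
  · rintro _ _ ⟨e, rfl, rfl⟩
    have h1 := h.order _ (hidx (G.head e)) e (hget _).symm
    obtain ⟨i, hi, hi'⟩ := List.getElem_of_mem h1
    simp only [List.length_take] at hi
    simp only [List.getElem_take] at hi'
    have : q.idxOf (G.tail e) = i := by
      rw [← hi']; exact h.nodup.idxOf_getElem i (by omega)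
    omega
  · rw [hsrc] at hu hv
    omega
  · have : {v | G.IsSource v} = ((q.take r).toFinset : Set (Fin n)) := by
      ext v
      simp only [Set.mem_ofPred_eq, hsrc, List.coe_toFinset]
      constructor
      · intro hv
        rw [List.mem_iff_getElem]
        exact ⟨q.idxOf v, by simp [hv, hidx v], by simp⟩
      · intro hv
        obtain ⟨i, hi, hi'⟩ := List.getElem_of_mem hv
        simp only [List.length_take] at hi
        simp only [List.getElem_take] at hi'
        have : q.idxOf v = i := by
          rw [← hi']; exact h.nodup.idxOf_getElem i (by omega)
        omega
    rw [this, Set.ncard_coe_finset, List.toFinset_card_of_nodup (h.nodup.sublist (List.take_sublist _ _)),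
      List.length_take]
    have := h.le
    omega

end Apsp

set_option linter.unusedSimpArgs false

/-! ### The execution of the queue algorithm -/

namespace Apsp

open RealRam

variable {n m : ℕ} {G : RealDag n m} {W : ℕ} {s : State}

/-- The edges out of a processed vertex are removed. -/
theorem kahn_inner {u : Fin n} {q : List (Fin n)} {X : Finset (Fin m)} {r : ℕ}
    {l : List (Fin m)} (hhead : ∀ e : Fin m, s.mem 1 e = G.head e) (hW : n + m + 2 < W)
    (hq : Queue G q X r s) (hu : u ∈ q) (hl : Linked (s.mem 6) (s.reg 7) l) (hnd : l.Nodup)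
    (hle : ∀ e ∈ l, G.tail e = u ∧ e ∉ X) :
    Run W (.loop (.not (.eq (.reg 7) (.const 0))) (.block [
      .set 6 (.get 1 (.sub (.reg 7) (.const 1))),
      .put 8 (.reg 6) (.sub (.get 8 (.reg 6)) (.const 1)),
      .branch (.eq (.get 8 (.reg 6)) (.const 0))
        (.block [.put 9 (.reg 4) (.reg 6), .set 4 (.add (.reg 4) (.const 1))]) .skip,
      .set 7 (.get 6 (.sub (.reg 7) (.const 1)))])) s fun z t =>
      ∃ q', Queue G q' (X ∪ l.toFinset) r z ∧ q <+: q' ∧ t ≤ 60 * l.length + 5 := by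
  classical
  refine Run.loopFrame (fun k z t => ∃ q' l₁ l₂, l = l₁ ++ l₂ ∧ k = l₂.length ∧
    Linked (s.mem 6) (z.reg 7) l₂ ∧ Queue G q' (X ∪ l₁.toFinset) r z ∧ q <+: q' ∧
    t ≤ 60 * l₁.length) l.length ⟨q, [], l, rfl, rfl, hl, by simpa using hq, List.prefix_rfl, by simp⟩ ?_
  rintro k z t hz hF ⟨q', l₁, l₂, rfl, rfl, h1, h2, h3, h4⟩
  refine ⟨by simp; omega, ?_, ?_⟩
  · intro hc
    cases l₂ with
    | nil =>
      refine ⟨q', by simpa using h2, h3, ?_⟩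
      simp; omega
    | cons e l₂ => simp [h1.1] at hc
  · intro hc
    cases l₂ with
    | nil => simp [show z.reg 7 = 0 from h1] at hc
    | cons e l₂ =>
      obtain ⟨h5, h6⟩ := h1
      have hem : e ∉ X ∪ l₁.toFinset := by
        simp only [Finset.mem_union, List.mem_toFinset, not_or]
        refine ⟨(hle e (by simp)).2, fun he => ?_⟩
        exact (List.nodup_append.1 hnd).2.2 e he e (by simp) rfl
      have hX : X ∪ (l₁ ++ [e]).toFinset = insert e (X ∪ l₁.toFinset) := by
        ext f; simp
      have hte : G.tail e ∈ q' := (hle e (by simp)).1 ▸ h3.subset hu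
      have hm1 : z.mem 1 e = G.head e := by rw [hF.mem 1 (by simp)]; exact hhead e
      have hm6 : z.mem 6 = s.mem 6 := hF.mem 6 (by simp)
      have hlen : q'.length ≤ n := by simpa using h2.nodup.length_le_card
      refine Run.of_wp ?_
      simp only [Prog.block, wp, WExp.Safe, WExp.val, State.setReg_reg, State.setReg_mem,
        WExp.cost, State.setMem_reg, State.setMem_mem, Cond.Safe, Cond.Holds, Cond.cost]
      simp only [h5, Nat.add_sub_cancel, hm1, hm6, h2.size]
      simp only [Nat.reduceEqDiff, if_true, if_false, true_and, and_true,
        false_and, and_false]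
      refine ⟨by omega, by omega, by omega, fun h0 => ?_, fun h0 => ?_⟩
      · refine ⟨by omega, by omega, _, by simp, q' ++ [G.head e], l₁ ++ [e], l₂, by simp, rfl, by simpa using h6,
          ?_, h3.trans (List.prefix_append _ _), by simp; omega⟩
        rw [hX]
        refine h2.step_zero hem hte ?_ ?_ ?_ h0
        · simp [h2.size]
        · simp [h2.size]
        · intro v; simp [Fin.ext_iff]; split_ifs with h <;> simp [h]
      · refine ⟨by omega, _, by simp, _, l₁ ++ [e], l₂, by simp, rfl, by simpa using h6,
          ?_, h3, by simp; omega⟩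
        rw [hX]
        refine h2.step_pos hem hte ?_ ?_ ?_ h0
        · simp
        · simp
        · intro v; simp [Fin.ext_iff]; split_ifs with h <;> simp [h]

/-- The removed edges are always those out of the processed part of the queue. Time is charged to
processed vertices and removed edges, each of which occurs only once, so the total is linear. -/
theorem kahn_main {q₀ : List (Fin n)} {r : ℕ} (hhead : ∀ e : Fin m, s.mem 1 e = G.head e)
    (hW : n + m + 2 < W) (hq : Queue G q₀ ∅ r s) (h3 : s.reg 3 = 0)
    (hlist : ∀ v : Fin n, ∃ l : List (Fin m), Linked (s.mem 6) (s.mem 5 v) l ∧ l.Nodup ∧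
      ∀ e, e ∈ l ↔ G.tail e = v) :
    Run W (.loop (.lt (.reg 3) (.reg 4)) (.block [
      .set 5 (.get 9 (.reg 3)),
      .put 2 (.reg 5) (.add (.reg 3) (.const 1)),
      .set 7 (.get 5 (.reg 5)),
      .loop (.not (.eq (.reg 7) (.const 0))) (.block [
        .set 6 (.get 1 (.sub (.reg 7) (.const 1))),
        .put 8 (.reg 6) (.sub (.get 8 (.reg 6)) (.const 1)),
        .branch (.eq (.get 8 (.reg 6)) (.const 0))
          (.block [.put 9 (.reg 4) (.reg 6), .set 4 (.add (.reg 4) (.const 1))]) .skip,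
        .set 7 (.get 6 (.sub (.reg 7) (.const 1)))]),
      .set 3 (.add (.reg 3) (.const 1))])) s fun z t =>
      ∃ q X, Queue G q X r z ∧ (∀ v, v ∈ q) ∧ (∀ i (h : i < q.length), z.mem 2 q[i] = i + 1) ∧
        t ≤ 40 * n + 60 * m + 10 := by
  classical
  refine Run.loopFrame (fun k z t => ∃ q X, Queue G q X r z ∧ z.reg 3 ≤ q.length ∧
    k = n - z.reg 3 ∧ (∀ e, e ∈ X ↔ G.tail e ∈ q.take (z.reg 3)) ∧
    (∀ i (h : i < q.length), i < z.reg 3 → z.mem 2 q[i] = i + 1) ∧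
    t ≤ 40 * z.reg 3 + 60 * X.card) n
    ⟨q₀, ∅, hq, by simp [h3], by simp [h3], by simp [h3], by simp [h3], by simp⟩ ?_
  rintro k z t hz hF ⟨q, X, h1, h2, rfl, h4, h5, h6⟩
  have hlen : q.length ≤ n := by simpa using h1.nodup.length_le_card
  have hcard : X.card ≤ m := by simpa using X.card_le_univ
  refine ⟨by simp, ?_, ?_⟩
  · intro hc
    simp only [Cond.Holds, WExp.val, h1.size, not_lt] at hc
    refine ⟨q, X, h1, h1.mem fun e he => ?_, fun i h => h5 i h (by omega), ?_⟩
    · rw [h4, List.take_of_length_le hc]; exact he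
    · simp; omega
  · intro hc
    simp only [Cond.Holds, WExp.val, h1.size] at hc
    set u := q[z.reg 3] with hu
    obtain ⟨l, l1, l2, l3⟩ := hlist u
    have hm6 : z.mem 6 = s.mem 6 := hF.mem 6 (by simp)
    have hm5 : z.mem 5 = s.mem 5 := hF.mem 5 (by simp)
    have hm1 : z.mem 1 = s.mem 1 := hF.mem 1 (by simp)
    -- The queue has no repetitions, so the current vertex has not been processed before, and its
    -- outgoing edges are still present.
    have hutake : u ∉ q.take (z.reg 3) := fun h => by
      obtain ⟨i, hi, hi'⟩ := List.getElem_of_mem h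
      simp only [List.length_take] at hi
      simp only [List.getElem_take, hu] at hi'
      have := (List.Nodup.getElem_inj_iff h1.nodup).1 hi'
      omega
    have hlX : ∀ e ∈ l, G.tail e = u ∧ e ∉ X := fun e he =>
      ⟨(l3 e).1 he, fun h => hutake ((l3 e).1 he ▸ (h4 e).1 h)⟩
    refine Run.of_wp ?_
    rw [Prog.block, Prog.block, Prog.block, Prog.block, Prog.block]
    simp only [wp, WExp.Safe, WExp.val, State.setReg_reg, State.setReg_mem,
        WExp.cost, State.setMem_reg, State.setMem_mem, Cond.Safe, Cond.Holds, Cond.cost]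
    have hz9 : z.mem 9 (z.reg 3) = u := h1.queue _ hc
    simp only [hz9]
    simp only [Nat.reduceEqDiff, if_true, if_false, true_and, and_true,
        false_and, and_false]
    refine ⟨⟨by omega, by omega⟩, ?_⟩
    refine (kahn_inner (G := G) (u := u) (q := q) (X := X) (r := r) (l := l) ?_ hW ?_
      (List.getElem_mem _) ?_ l2 hlX).frame.mono ?_
    · intro e; simp [hm1, hhead e]
    · exact h1.congr (by simp) (by funext i; simp) (by funext i; simp)
    · simpa [hm5, hm6] using l1
    · rintro y t' hy ⟨⟨q', k1, k2, k3⟩, k4⟩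
      have y3 := k4.reg 3 (by simp)
      have y2 := k4.mem 2 (by simp)
      simp only [State.setReg_reg, State.setMem_reg, Nat.reduceEqDiff, if_false] at y3
      have hlen' := k2.length_le
      refine ⟨by omega, n - (z.reg 3 + 1), by omega, q', X ∪ l.toFinset, ?_, ?_, ?_, ?_, ?_, ?_⟩
      · exact k1.congr (by simp) rfl rfl
      · simp [y3]; omega
      · simp [y3]
      · intro e
        obtain ⟨d, rfl⟩ := k2
        simp only [Finset.mem_union, h4, List.mem_toFinset, l3, State.setReg_reg, if_true, y3]
        simp only [hu, State.setReg_reg, if_true, List.take_add_one,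
          List.take_append_of_le_length h2, List.getElem?_append_left hc,
          List.getElem?_eq_getElem hc, List.mem_append, Option.toList_some, List.mem_singleton]
      · intro i hi hi'
        simp only [State.setReg_reg, if_true, y3] at hi'
        have hiq : i < q.length := by omega
        have hqq : q'[i] = q[i] := by
          obtain ⟨d, rfl⟩ := k2
          exact List.getElem_append_left hiq
        simp only [State.setReg_mem, y2, State.setMem_mem, hqq]
        by_cases hieq : i = z.reg 3
        · subst hieq; simp [hu]
        · have : q[i] ≠ u := fun h => hieq ((List.Nodup.getElem_inj_iff h1.nodup).1 h)
          simp [Fin.val_ne_of_ne this, h5 i hiq (by omega)]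
      · have : (X ∪ l.toFinset).card = X.card + l.length := by
          rw [Finset.card_union_of_disjoint, List.toFinset_card_of_nodup l2]
          rw [Finset.disjoint_left]
          intro e he he'
          exact (hlX e (by simpa using he')).2 he
        rw [this]
        simp [y3]
        omega

/-- The incoming edges are counted. -/
theorem kahn_degree (hG : HoldsGraph G s) (hW : n + m + 2 < W) (h0 : ∀ v : Fin n, s.mem 8 v = 0) :
    Run W (.forUp 7 (.const 0) (.reg 1)
      (.put 8 (.get 1 (.reg 7)) (.add (.get 8 (.get 1 (.reg 7))) (.const 1)))) s fun z t =>
      (∀ v : Fin n, z.mem 8 v = (Finset.univ.filter fun e => G.head e = v).card) ∧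
        t ≤ 20 * m + 10 := by
  have hle : ∀ (v : Fin n) (k : ℕ),
      (Finset.univ.filter fun e : Fin m => (e : ℕ) < k ∧ G.head e = v).card ≤ m := fun v k => by
    simpa using (Finset.univ.filter fun e : Fin m => (e : ℕ) < k ∧ G.head e = v).card_le_univ
  refine Run.forUpFrame 0 m (fun k z t => (∀ v : Fin n, z.mem 8 v =
    (Finset.univ.filter fun e : Fin m => (e : ℕ) < k ∧ G.head e = v).card) ∧ t ≤ 20 * k)
    ⟨by simp; omega, rfl⟩ (Nat.zero_le _) ⟨fun v => by simp [h0], by simp⟩ (by simp) ?_ ?_ ?_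
  · intro k z t _ _ hF _ _
    simp [hF.reg 1 (by simp), hG.edges]
  · rintro k z t hz - hk hkW hF hx ⟨h1, h2⟩
    have hhead : z.mem 1 k = G.head ⟨k, hk⟩ := by
      rw [hF.mem 1 (by simp)]; exact hG.head ⟨k, hk⟩
    refine Run.of_wp ?_
    simp only [wp, WExp.Safe, WExp.val, WExp.cost, hx, hhead, h1]
    have := hle (G.head ⟨k, hk⟩) k
    refine ⟨trivial, ⟨trivial, by omega, by omega⟩, fun v => ?_, by omega⟩
    have hkv : (Finset.univ.filter fun e : Fin m => (e : ℕ) < k + 1 ∧ G.head e = v).card =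
        (Finset.univ.filter fun e : Fin m => (e : ℕ) < k ∧ G.head e = v).card +
          if v = G.head ⟨k, hk⟩ then 1 else 0 := by
      split_ifs with h
      · rw [← Finset.card_insert_of_notMem (a := ⟨k, hk⟩) (by simp)]
        congr 1
        ext e
        simp only [Finset.mem_filter, Finset.mem_insert, Finset.mem_univ, true_and]
        constructor
        · rintro ⟨h1, h2⟩
          by_cases hek : (e : ℕ) = k
          · exact .inl (Fin.ext hek)
          · exact .inr ⟨by omega, h2⟩
        · rintro (rfl | ⟨h1, h2⟩)
          · exact ⟨by simp, h.symm⟩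
          · exact ⟨by omega, h2⟩
      · rw [add_zero]
        congr 1
        ext e
        simp only [Finset.mem_filter, Finset.mem_univ, true_and]
        refine ⟨fun ⟨h1, h2⟩ => ⟨?_, h2⟩, fun ⟨h1, h2⟩ => ⟨by omega, h2⟩⟩
        have : (e : ℕ) ≠ k := fun hek => h (by rw [← h2, show e = ⟨k, hk⟩ from Fin.ext hek])
        omega
    rw [hkv]
    simp only [State.setReg_mem, State.setMem_mem, ← Fin.ext_iff, true_and]
    split_ifs with h
    · rw [h]
    · exact h1 v
  · rintro z t hz hF hx ⟨h1, h2⟩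
    refine ⟨fun v => ?_, by simp; omega⟩
    simp [h1]

/-- The sources enter the queue. -/
theorem kahn_sources (hn : s.reg 0 = n) (h4 : s.reg 4 = 0) (hW : n + m + 2 < W)
    (h8 : ∀ v : Fin n, s.mem 8 v = (Finset.univ.filter fun e => G.head e = v).card) :
    Run W (.forUp 3 (.const 0) (.reg 0) (.branch (.eq (.get 8 (.reg 3)) (.const 0))
      (.block [.put 9 (.reg 4) (.reg 3), .set 4 (.add (.reg 4) (.const 1))]) .skip)) s fun z t =>
      ∃ q, Queue G q ∅ q.length z ∧ t ≤ 30 * n + 10 := by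
  have hsrc : ∀ v : Fin n, s.mem 8 v = 0 ↔ G.IsSource v := fun v => by
    rw [h8, Finset.card_eq_zero, Finset.filter_eq_empty_iff]
    simp [RealDag.IsSource]
  refine Run.forUpFrame 0 n (fun k z t => (∃ q : List (Fin n), q.Nodup ∧ z.reg 4 = q.length ∧
    (∀ i (h : i < q.length), z.mem 9 i = q[i]) ∧ ∀ v : Fin n, v ∈ q ↔ v < k ∧ G.IsSource v) ∧
    t ≤ 30 * k) ⟨by simp; omega, rfl⟩ (Nat.zero_le _) ⟨⟨[], by simp [h4]⟩, by simp⟩ (by simp) ?_ ?_ ?_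
  · intro k z t _ _ hF _ _
    simp [hF.reg 0 (by simp), hn]
  · rintro k z t hz - hk hkW hF hx ⟨⟨q, h1, h2, h3, h5⟩, h6⟩
    have hlen : q.length ≤ n := by simpa using h1.length_le_card
    have h8k : z.mem 8 k = 0 ↔ G.IsSource ⟨k, hk⟩ := by
      rw [hF.mem 8 (by simp)]; exact hsrc ⟨k, hk⟩
    refine Run.of_wp ?_
    simp only [Prog.block, wp, WExp.Safe, WExp.val, State.setReg_reg, State.setReg_mem,
      WExp.cost, State.setMem_reg, Cond.Safe, Cond.Holds, Cond.cost, hx, h2, h8k]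
    refine ⟨by simp; omega, fun hs => ?_, fun hs => ?_⟩
    · have hkq : (⟨k, hk⟩ : Fin n) ∉ q := fun h => by
        have := ((h5 _).1 h).1; simp at this
      refine ⟨trivial, trivial, by simp; omega, ⟨q ++ [⟨k, hk⟩], ?_, by simp, ?_, fun v => ?_⟩,
        by omega⟩
      · rw [List.nodup_append]
        refine ⟨h1, by simp, ?_⟩
        rintro a ha b hb rfl
        simp only [List.mem_singleton] at hb
        exact hkq (hb ▸ ha)
      · intro i hi
        have : i < q.length ∨ i = q.length := by simp at hi; omega
        rcases this with h | rfl
        · rw [List.getElem_append_left h]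
          simp [h.ne, h3 i h]
        · simp
      · rw [List.mem_append, h5, List.mem_singleton]
        constructor
        · rintro (⟨h, h'⟩ | rfl)
          · exact ⟨by omega, h'⟩
          · exact ⟨by simp, hs⟩
        · rintro ⟨h, h'⟩
          by_cases hvk : (v : ℕ) = k
          · exact .inr (Fin.ext hvk)
          · exact .inl ⟨by omega, h'⟩
    · refine ⟨⟨q, h1, by simp [h2], by simpa using h3, fun v => ?_⟩, by omega⟩
      rw [h5]
      refine ⟨fun ⟨h, h'⟩ => ⟨by omega, h'⟩, fun ⟨h, h'⟩ => ⟨?_, h'⟩⟩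
      have : (v : ℕ) ≠ k := fun hvk => hs (by rw [← show v = ⟨k, hk⟩ from Fin.ext hvk]; exact h')
      omega
  · rintro z t hz hF hx ⟨⟨q, h1, h2, h3, h5⟩, h6⟩
    have m8 : z.mem 8 = s.mem 8 := hF.mem 8 (by simp)
    have hq : ∀ v, v ∈ q ↔ G.IsSource v := fun v => by simp [h5]
    refine ⟨q, ⟨h1, h2, h3, fun v => by rw [m8, h8]; simp, fun v => by rw [m8, hsrc, hq], by simp,
      fun i h e he => ?_, le_rfl, fun i h => ?_⟩, by simp; omega⟩
    · exact (((hq _).1 (List.getElem_mem h)) e he).elim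
    · exact iff_of_true ((hq _).1 (List.getElem_mem h)) h

theorem kahn_run (hG : HoldsGraph G s) (hW : n + m + 2 < W) :
    Run W kahn s fun z t => ∃ num, HoldsGraph G z ∧ HoldsNumbering G num z ∧
      t ≤ 200 * (n + m) + 200 := by
  have h0W : 0 < W := by omega
  suffices H : Run W kahn s fun z t => ∃ q X r, Queue G q X r z ∧ (∀ v, v ∈ q) ∧ z.reg 2 = r ∧
      (∀ i (h : i < q.length), z.mem 2 q[i] = i + 1) ∧ t ≤ 200 * (n + m) + 200 by
    refine H.frame.mono ?_
    rintro z t - ⟨⟨q, X, r, h1, h2, h3, h4, h5⟩, hF⟩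
    obtain ⟨h6, h7⟩ := h1.isNumbering h2
    refine ⟨fun v => q.idxOf v + 1, ⟨?_, ?_, ?_, ?_, ?_⟩, ⟨h6, fun v => ?_, h3.trans h7⟩, h5⟩
    · rw [hF.reg 0 (by simp [kahn])]; exact hG.size
    · rw [hF.reg 1 (by simp [kahn])]; exact hG.edges
    · rw [hF.mem 0 (by simp [kahn])]; exact hG.tail
    · rw [hF.mem 1 (by simp [kahn])]; exact hG.head
    · rw [hF.rmem 0 (by simp [kahn])]; exact hG.weight
    · have := h4 _ (List.idxOf_lt_length_of_mem (h2 v))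
      rwa [List.getElem_idxOf] at this
  have graph : ∀ {z z' : State}, z'.reg 0 = z.reg 0 → z'.reg 1 = z.reg 1 → z'.mem 0 = z.mem 0 →
      z'.mem 1 = z.mem 1 → z'.rmem 0 = z.rmem 0 → HoldsGraph G z → HoldsGraph G z' := by
    intro z z' h1 h2 h3 h4 h5 h
    exact ⟨h1 ▸ h.size, h2 ▸ h.edges, h3 ▸ h.tail, h4 ▸ h.head, h5 ▸ h.weight⟩
  refine Run.seq (Run.fillUp n (fun k => k) (fun _ => 0) (fun _ _ _ _ h => h) ?_ ?_ ?_)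
  · intro s' h1 _; simp [h1 0 (by simp), hG.size]
  · intro k _ _ s' _ h1 _ _; simp [h1, h0W]
  intro z₁ t₁ v₁ r₁ m₁ _ w₁ f₁ _ b₁
  have hG₁ : HoldsGraph G z₁ := graph (r₁ 0 (by simp)) (r₁ 1 (by simp)) (m₁ 0 (by simp))
    (m₁ 1 (by simp)) (by rw [w₁]) hG
  refine Run.seq (Run.link (key := fun e => G.tail e) hG₁.edges ?_ ?_)
  · intro e z _ h7 h; simp [h7, h 0 (by simp) (by simp), hG₁.tail]
  intro z₂ t₂ v₂ hF₂ l₂ b₂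
  have hG₂ : HoldsGraph G z₂ := graph (hF₂.reg 0 (by simp)) (hF₂.reg 1 (by simp))
    (hF₂.mem 0 (by simp)) (hF₂.mem 1 (by simp)) (hF₂.rmem 0 (by simp)) hG₁
  have hlist : ∀ v : Fin n, ∃ l : List (Fin m), Linked (z₂.mem 6) (z₂.mem 5 v) l ∧ l.Nodup ∧
      ∀ e, e ∈ l ↔ G.tail e = v := fun v => by
    obtain ⟨l, h1, h2, h3⟩ := l₂ v (f₁ v v.2)
    exact ⟨l, h1, h2, fun e => by rw [h3, Fin.ext_iff]⟩
  refine Run.seq (Run.fillUp n (fun k => k) (fun _ => 0) (fun _ _ _ _ h => h) ?_ ?_ ?_)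
  · intro s' h1 _; simp [h1 0 (by simp), hG₂.size]
  · intro k _ _ s' _ h1 _ _; simp [h1, h0W]
  intro z₃ t₃ v₃ r₃ m₃ _ w₃ f₃ _ b₃
  have hG₃ : HoldsGraph G z₃ := graph (r₃ 0 (by simp)) (r₃ 1 (by simp)) (m₃ 0 (by simp))
    (m₃ 1 (by simp)) (by rw [w₃]) hG₂
  refine Run.seq ((kahn_degree hG₃ hW fun v => f₃ v v.2).frame.mono ?_)
  rintro z₄ t₄ v₄ ⟨⟨d₄, b₄⟩, hF₄⟩
  refine Run.seq (Run.of_wp ⟨h0W, ?_⟩)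
  refine Run.seq ((kahn_sources (G := G) ?_ (by simp) hW (by simpa using d₄)).frame.mono ?_)
  · simp only [State.setReg_reg]
    rw [if_neg (by simp), hF₄.reg 0 (by simp), hG₃.size]
  rintro z₅ t₅ v₅ ⟨⟨q, hq, b₅⟩, hF₅⟩
  refine Run.seq (Run.of_wp ⟨trivial, ?_⟩)
  refine Run.seq (Run.of_wp ⟨h0W, ?_⟩)
  refine (kahn_main (G := G) (q₀ := q) (r := q.length) ?_ hW ?_ (by simp) ?_).frame.mono ?_
  · intro e
    simp only [State.setReg_mem]
    rw [hF₅.mem 1 (by simp), State.setReg_mem, hF₄.mem 1 (by simp)]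
    exact hG₃.head e
  · exact hq.congr (by simp) (by simp) (by simp)
  · intro v
    simp only [State.setReg_mem]
    rw [hF₅.mem 5 (by simp), State.setReg_mem, hF₄.mem 5 (by simp), hF₅.mem 6 (by simp),
      State.setReg_mem, hF₄.mem 6 (by simp), m₃ 5 (by simp), m₃ 6 (by simp)]
    exact hlist v
  · rintro z₆ t₆ - ⟨⟨q', X, h1, h2, h3, b₆⟩, hF₆⟩
    refine ⟨q', X, q.length, h1, h2, ?_, h3, ?_⟩
    · rw [hF₆.reg 2 (by simp)]
      simp [hq.size]
    · simp at b₁ b₂ b₃ b₆ ⊢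
      omega

theorem numbersVertices_kahn : NumbersVertices kahn := by
  -- The additive constant `200` of `kahn_run` is absorbed because `n ≥ 1`. The fourth power
  -- suffices for words because there are at most `n * n` edges.
  refine ⟨400, 4, fun n m G hn W hW s hs hG => ?_⟩
  have hm : m ≤ n * n := G.edges_le
  have : n + m + 2 < (n + 2) ^ 4 := by nlinarith [sq_nonneg n, Nat.zero_le (n ^ 3)]
  obtain ⟨z, t, h1, h2, num, h3, h4, h5⟩ := kahn_run hG (by omega : n + m + 2 < W) hs
  refine ⟨num, z, t, h1, h3, h4, ?_⟩
  have : t ≤ 400 * (n + m) := by omega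
  exact_mod_cast this

end Apsp

/-! ## Correctness and running time of the algorithm -/

namespace Apsp

open RealRam

variable {n m : ℕ} {G : RealDag n m} {num : Fin n → ℕ} {W : ℕ} {s : State}

attribute [simp] at2 nextE distE ancE

theorem index_inj {x y x' y' : ℕ} (hy : y ≤ n) (hy' : y' ≤ n) :
    x * (n + 1) + y = x' * (n + 1) + y' ↔ x = x' ∧ y = y' := by
  constructor
  · intro h
    have h1 : (x * (n + 1) + y) / (n + 1) = x := by
      rw [mul_comm, Nat.mul_add_div (by omega), Nat.div_eq_of_lt (by omega), add_zero]
    have h2 : (x' * (n + 1) + y') / (n + 1) = x' := by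
      rw [mul_comm, Nat.mul_add_div (by omega), Nat.div_eq_of_lt (by omega), add_zero]
    have h3 : x = x' := by rw [← h1, h, h2]
    subst h3
    exact ⟨rfl, by omega⟩
  · rintro ⟨rfl, rfl⟩; rfl

theorem index_lt {x y : ℕ} (hx : x ≤ n) (hy : y ≤ n) : x * (n + 1) + y < (n + 1) * (n + 1) := by
  have := Nat.mul_le_mul_right (n + 1) hx
  have : (n + 1) * (n + 1) = n * (n + 1) + (n + 1) := by ring
  omega

theorem num_index_inj (hnum : G.IsNumbering num) {u v u' v' : Fin n} :
    num u * (n + 1) + num v = num u' * (n + 1) + num v' ↔ u = u' ∧ v = v' := by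
  rw [index_inj (hnum.le v) (hnum.le v'), hnum.injective.eq_iff, hnum.injective.eq_iff]

/-- The direct ancestor on the lexicographically-first shortest path is found. -/
theorem findDirect_run {u v : Fin n} {l : List (Fin m)} (hG : HoldsGraph G s)
    (hN : HoldsNumbering G num s) (hW : (n + 1) * (n + 1) + m + 2 < W) (h3 : s.reg 3 = num v)
    (h5 : s.reg 5 = num u) (huv : G.Ancestor u v) (hl : Linked (s.mem 6) (s.mem 5 (num v)) l)
    (hmem : ∀ e, e ∈ l ↔ G.head e = v)
    (hdist : ∀ e, G.head e = v →
      s.rmem 1 (num u * (n + 1) + num (G.tail e)) = G.dist num u (G.tail e)) :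
    Run W findDirect s fun z t => (∃ e, G.IsParent num u v e ∧ z.reg 6 = num (G.tail e) ∧
      z.rreg 2 = (G.weight e : WithTop ℝ)) ∧ t ≤ 60 * l.length + 30 := by
  have hnum := hN.numbering
  have hn1 : n < (n + 1) * (n + 1) := by nlinarith
  let val : Fin m → WithTop ℝ := fun e => G.dist num u (G.tail e) + G.weight e
  refine Run.seq (Run.of_wp ⟨trivial, ?_⟩)
  refine Run.seq (Run.of_wp ⟨by simp; omega, ?_⟩)
  refine Run.seq (Run.of_wp ⟨trivial, ?_⟩)
  -- Among the edges `l₁` scanned so far, either all values are `∞` and the registers hold their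
  -- initial contents, or a best edge is stored.
  refine Run.loopFrame (fun k z t => ∃ l₁ l₂, l = l₁ ++ l₂ ∧ k = l₂.length ∧
    Linked (s.mem 6) (z.reg 7) l₂ ∧
    (z.rreg 0 = ⊤ ∧ z.reg 6 = 0 ∧ (∀ e ∈ l₁, val e = ⊤) ∨
      ∃ e ∈ l₁, z.rreg 0 = val e ∧ z.reg 6 = num (G.tail e) ∧
        z.rreg 2 = (G.weight e : WithTop ℝ) ∧ ∀ e' ∈ l₁, val e < val e' ∨
          val e = val e' ∧ num (G.tail e) ≤ num (G.tail e')) ∧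
    t ≤ 60 * l₁.length) l.length ⟨[], l, rfl, rfl, by simpa [h3] using hl, by simp, by simp⟩ ?_
  rintro k z t hz hF ⟨l₁, l₂, rfl, rfl, h7, hbest, ht⟩
  refine ⟨by simp; omega, ?_, ?_⟩
  · intro hc
    cases l₂ with
    | cons e l₂ => simp [h7.1] at hc
    | nil =>
      simp only [List.append_nil] at hmem ⊢
      refine ⟨?_, by simp; omega⟩
      rcases hbest with ⟨-, -, h⟩ | ⟨e, he, -, h6, h2, hmin⟩
      · obtain ⟨e, he, hr⟩ := huv.exists_edge
        have := h e ((hmem e).2 he)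
        simp only [val, WithTop.add_eq_top, WithTop.coe_ne_top, or_false] at this
        exact (RealDag.dist_ne_top hr this).elim
      · refine ⟨e, ⟨(hmem e).1 he, ?_, fun e' he' => hmin e' ((hmem e').2 he')⟩, h6, h2⟩
        -- Some edge into `v` has a finite value because `u` is an ancestor. So the minimum is
        -- finite, which means that the chosen tail is reachable.
        obtain ⟨e', he', hr⟩ := huv.exists_edge
        have hne : val e' ≠ ⊤ := by
          simp only [val, ne_eq, WithTop.add_eq_top, WithTop.coe_ne_top, or_false]
          exact RealDag.dist_ne_top hr
        have hne' : val e ≠ ⊤ := fun h => by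
          rcases hmin e' ((hmem e').2 he') with h' | ⟨h', -⟩
          · rw [h] at h'; exact not_top_lt h'
          · exact hne (h' ▸ h)
        simp only [val, ne_eq, WithTop.add_eq_top, WithTop.coe_ne_top, or_false] at hne'
        exact RealDag.dist_ne_top_iff.1 hne'
  · intro hc
    cases l₂ with
    | nil => simp [show z.reg 7 = 0 from h7] at hc
    | cons e l₂ =>
      obtain ⟨h7, h8⟩ := h7
      have he : G.head e = v := (hmem e).1 (by simp)
      have m0 : z.mem 0 e = G.tail e := by rw [hF.mem 0 (by simp)]; exact hG.tail e
      have m2 : z.mem 2 (G.tail e) = num (G.tail e) := by rw [hF.mem 2 (by simp)]; exact hN.number _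
      have m6 : z.mem 6 = s.mem 6 := by rw [hF.mem 6 (by simp)]; rfl
      have r0 : z.reg 0 = n := by rw [hF.reg 0 (by simp)]; simpa using hG.size
      have r5 : z.reg 5 = num u := by rw [hF.reg 5 (by simp)]; simpa using h5
      have w0 : z.rmem 0 e = G.weight e := by rw [hF.rmem 0 (by simp)]; exact hG.weight e
      have w1 : z.rmem 1 (num u * (n + 1) + num (G.tail e)) = G.dist num u (G.tail e) := by
        rw [hF.rmem 1 (by simp)]; exact hdist e he
      have hlt := index_lt (hnum.le u) (hnum.le (G.tail e))
      refine Run.of_wp ?_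
      simp only [Prog.block, wp, WExp.Safe, RExp.Safe, WExp.val, RExp.val, State.setReg_reg,
        State.setReg_mem, State.setReg_rreg, State.setReg_rmem, State.setRreg_reg,
        State.setRreg_mem, State.setRreg_rreg, State.setRreg_rmem, at2, distE,
        WExp.cost, RExp.cost, Cond.Safe, Cond.Holds, Cond.cost]
      simp only [h7, Nat.add_sub_cancel, m0, m2, m6, r0, r5, w0, w1, Nat.reduceEqDiff, if_true,
        if_false, true_and, and_true, ge_iff_le]
      have hle1 : num u * (n + 1) ≤ num u * (n + 1) + num (G.tail e) := Nat.le_add_right _ _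
      refine ⟨by omega, by omega, fun hcond => ?_, fun hcond => ?_⟩
      · refine ⟨by omega, by omega, l₂.length, by simp, l₁ ++ [e], l₂, by simp, rfl, h8, .inr ⟨e, by simp,
          rfl, rfl, rfl, fun e' he' => ?_⟩, by simp; omega⟩
        rcases List.mem_append.1 he' with he' | he'
        -- The initial pair `∞`, `0` rejects edges of value `∞`: they only tie in the first
        -- component, and no number is below `0`.
        · rcases hbest with ⟨b0, b6, hb⟩ | ⟨b, hb, b0, b6, b2, hmin⟩
          · left
            rw [hb e' he']
            rw [b0, b6] at hcond
            rcases hcond with h | ⟨-, h⟩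
            · exact h
            · omega
          · rw [b0, b6] at hcond
            rcases hcond with h | ⟨h, h'⟩
            · left
              refine lt_of_lt_of_le h ?_
              rcases hmin e' he' with h' | ⟨h', -⟩
              · exact h'.le
              · exact h'.le
            · rcases hmin e' he' with h2 | ⟨h2, h3⟩
              · exact .inl (h.trans_lt h2)
              · exact .inr ⟨h.trans h2, by omega⟩
        · simp only [List.mem_singleton] at he'
          exact .inr (by rw [he']; exact ⟨rfl, le_rfl⟩)
      · refine ⟨by omega, l₂.length, by simp, l₁ ++ [e], l₂, by simp, rfl, h8, ?_, by simp; omega⟩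
        push Not at hcond
        rcases hbest with ⟨b0, b6, hb⟩ | ⟨b, hb, b0, b6, b2, hmin⟩
        · left
          refine ⟨b0, b6, fun e' he' => ?_⟩
          rcases List.mem_append.1 he' with he' | he'
          · exact hb e' he'
          · simp only [List.mem_singleton] at he'
            rw [b0] at hcond
            rw [he']
            exact top_le_iff.1 hcond.1
        · right
          refine ⟨b, by simp [hb], b0, b6, b2, fun e' he' => ?_⟩
          rcases List.mem_append.1 he' with he' | he'
          · exact hmin e' he'
          · simp only [List.mem_singleton] at he'
            rw [b0, b6] at hcond
            rw [he']
            rcases hcond.1.lt_or_eq with h | h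
            · exact .inl h
            · exact .inr ⟨h, hcond.2 h.symm⟩

end Apsp

/-! ### Adding a fragment of a path -/

namespace Apsp

open RealRam

variable {n m : ℕ} {G : RealDag n m} {num : Fin n → ℕ} {W : ℕ} {s : State}

/-- The distances and trees of all vertices before `v` are known, those of `v` are known for the
vertices `u` with `NEXT_v(u) ≠ 0`, and those of later vertices have not been touched. -/
structure Stage (G : RealDag n m) (num : Fin n → ℕ) (v : Fin n) (z : State) : Prop where
  past_dist : ∀ u w, num w < num v → z.rmem 1 (num u * (n + 1) + num w) = G.dist num u w
  past_next : ∀ u w, num w < num v → G.Ancestor u w →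
    z.mem 7 (num u * (n + 1) + num w) = num (G.nxt num u w)
  next : ∀ u, G.Ancestor u v → z.mem 7 (num u * (n + 1) + num v) ≠ 0 →
    z.mem 7 (num u * (n + 1) + num v) = num (G.nxt num u v)
  dist : ∀ u, G.Ancestor u v → z.mem 7 (num u * (n + 1) + num v) ≠ 0 →
    z.rmem 1 (num u * (n + 1) + num v) = G.dist num u v
  dist_of_not : ∀ u, ¬ G.Ancestor u v → z.rmem 1 (num u * (n + 1) + num v) = G.dist num u v
  future : ∀ u w, num v < num w →
    z.rmem 1 (num u * (n + 1) + num w) = if u = w then 0 else ⊤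

theorem Stage.congr {v : Fin n} {z z' : State} (h : Stage G num v z) (h7 : z'.mem 7 = z.mem 7)
    (h1 : z'.rmem 1 = z.rmem 1) : Stage G num v z' :=
  ⟨h1 ▸ h.past_dist, h7 ▸ h.past_next, h7 ▸ h.next, h7 ▸ h1 ▸ h.dist, h1 ▸ h.dist_of_not,
    h1 ▸ h.future⟩

/-- The correct values for `(c, v)` are stored. -/
theorem Stage.update {v c : Fin n} {z z' : State} (hnum : G.IsNumbering num) (h : Stage G num v z)
    (hc : G.Ancestor c v)
    (h7 : ∀ i, z'.mem 7 i = if i = num c * (n + 1) + num v then num (G.nxt num c v) else z.mem 7 i)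
    (h1 : ∀ i, z'.rmem 1 i = if i = num c * (n + 1) + num v then G.dist num c v else z.rmem 1 i) :
    Stage G num v z' := by
  have hne : ∀ {u w : Fin n}, num w ≠ num v →
      num u * (n + 1) + num w ≠ num c * (n + 1) + num v := fun {u w} hw h => by
    obtain ⟨-, rfl⟩ := (num_index_inj hnum).1 h
    exact hw rfl
  refine ⟨fun u w hw => ?_, fun u w hw hu => ?_, fun u hu hu0 => ?_, fun u hu hu0 => ?_,
    fun u hu => ?_, fun u w hw => ?_⟩
  · rw [h1, if_neg (hne hw.ne)]; exact h.past_dist u w hw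
  · rw [h7, if_neg (hne hw.ne)]; exact h.past_next u w hw hu
  · rw [h7] at hu0 ⊢
    split_ifs at hu0 ⊢ with heq
    · obtain ⟨rfl, -⟩ := (num_index_inj hnum).1 heq; rfl
    · exact h.next u hu hu0
  · rw [h7] at hu0
    rw [h1]
    split_ifs at hu0 ⊢ with heq
    · obtain ⟨rfl, -⟩ := (num_index_inj hnum).1 heq; rfl
    · exact h.dist u hu hu0
  · rw [h1, if_neg]
    · exact h.dist_of_not u hu
    · intro heq
      obtain ⟨rfl, -⟩ := (num_index_inj hnum).1 heq
      exact hu hc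
  · rw [h1, if_neg (hne hw.ne')]; exact h.future u w hw

open Classical in
/-- The number of ancestors `u` of `v` with `NEXT_v(u) = 0`. -/
noncomputable def unset (G : RealDag n m) (num : Fin n → ℕ) (v : Fin n) (z : State) : ℕ :=
  (Finset.univ.filter fun u => G.Ancestor u v ∧ z.mem 7 (num u * (n + 1) + num v) = 0).card

theorem unset_congr {v : Fin n} {z z' : State} (h : z'.mem 7 = z.mem 7) :
    unset G num v z' = unset G num v z := by
  rw [unset, unset, h]

theorem unset_setReg {v : Fin n} {z : State} (x y : ℕ) :
    unset G num v (z.setReg x y) = unset G num v z := rfl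

theorem unset_update {v c : Fin n} {z z' : State} (hnum : G.IsNumbering num)
    (hc : G.Ancestor c v) (hc0 : z.mem 7 (num c * (n + 1) + num v) = 0)
    (h7 : ∀ i, z'.mem 7 i = if i = num c * (n + 1) + num v then num (G.nxt num c v) else z.mem 7 i) :
    unset G num v z' + 1 = unset G num v z := by
  classical
  rw [unset, unset, ← Finset.card_insert_of_notMem (a := c)]
  · congr 1
    ext u
    simp only [Finset.mem_insert, Finset.mem_filter, Finset.mem_univ, true_and, h7,
      num_index_inj hnum, and_true]
    by_cases huc : u = c
    · subst huc; simp [hc, hc0]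
    · simp [huc]
  · have := hnum.pos (G.nxt num c v)
    simp [h7]
    omega

/-- The set of vertices with a known next vertex is closed under passing to the next vertex. -/
def NextClosed (G : RealDag n m) (num : Fin n → ℕ) (v : Fin n) (z : State) : Prop :=
  ∀ x, G.Ancestor x v → z.mem 7 (num x * (n + 1) + num v) ≠ 0 →
    G.nxt num x v = v ∨ z.mem 7 (num (G.nxt num x v) * (n + 1) + num v) ≠ 0

/-- All vertices from `u` up to the tail of `e` have the parent edge `e`, so the copied entries are
right. Each round fills an entry that was empty, so its cost is covered by the decrease of the
potential `70 * unset`. The loop may stop at a vertex already known because the known vertices are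
closed under `nxt`. -/
theorem addFragment_run {u v : Fin n} {e : Fin m} (hnum : G.IsNumbering num)
    (hn : s.reg 0 = n) (hW : (n + 1) * (n + 1) + m + 2 < W) (h3 : s.reg 3 = num v)
    (h5 : s.reg 5 = num u) (h6 : s.reg 6 = num (G.tail e))
    (h2 : s.rreg 2 = (G.weight e : WithTop ℝ)) (he : G.IsParent num u v e)
    (hst : Stage G num v s) (hcl : NextClosed G num v s) :
    Run W addFragment s fun z t => Stage G num v z ∧ NextClosed G num v z ∧
      z.mem 7 (num u * (n + 1) + num v) ≠ 0 ∧
      (∀ x, s.mem 7 (num x * (n + 1) + num v) ≠ 0 → z.mem 7 (num x * (n + 1) + num v) ≠ 0) ∧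
      t + 70 * unset G num v z ≤ 70 * unset G num v s + 70 := by
  have hadj : num (G.tail e) < num v := hnum.lt_of_adj _ _ (he.head ▸ RealDag.adj_edge e)
  have hidx : ∀ x y : Fin n, num x * (n + 1) ≤ num x * (n + 1) + num y ∧
      num x * (n + 1) + num y < (n + 1) * (n + 1) := fun x y =>
    ⟨Nat.le_add_right _ _, index_lt (hnum.le x) (hnum.le y)⟩
  have hnn : n < (n + 1) * (n + 1) := by nlinarith
  refine Run.seq (Run.of_wp ⟨trivial, ?_⟩)
  refine Run.seq ((Run.loopFrame (Q := fun z t => Frame addFragment s z ∧ ∃ c, z.reg 8 = num c ∧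
      (num c = num (G.tail e) ∨ z.mem 7 (num c * (n + 1) + num v) ≠ 0) ∧
      G.IsParent num c v e ∧ Stage G num v z ∧
      (∀ x, G.Ancestor x v → z.mem 7 (num x * (n + 1) + num v) ≠ 0 → G.nxt num x v = v ∨
        z.mem 7 (num (G.nxt num x v) * (n + 1) + num v) ≠ 0 ∨ G.nxt num x v = c) ∧
      (z.mem 7 (num u * (n + 1) + num v) ≠ 0 ∨ u = c) ∧
      (∀ x, s.mem 7 (num x * (n + 1) + num v) ≠ 0 → z.mem 7 (num x * (n + 1) + num v) ≠ 0) ∧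
      t + 70 * unset G num v z ≤ 70 * unset G num v s + 20)
    -- Inside the loop, closedness may fail only for pointers to the current vertex `c`, and `u`
    -- itself is set unless it is still the current vertex. The number of empty entries is the
    -- variant.
    (fun k z t => k = unset G num v z ∧ ∃ c, z.reg 8 = num c ∧
      G.IsParent num c v e ∧ Stage G num v z ∧
      (∀ x, G.Ancestor x v → z.mem 7 (num x * (n + 1) + num v) ≠ 0 → G.nxt num x v = v ∨
        z.mem 7 (num (G.nxt num x v) * (n + 1) + num v) ≠ 0 ∨ G.nxt num x v = c) ∧
      (z.mem 7 (num u * (n + 1) + num v) ≠ 0 ∨ u = c) ∧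
      (∀ x, s.mem 7 (num x * (n + 1) + num v) ≠ 0 → z.mem 7 (num x * (n + 1) + num v) ≠ 0) ∧
      t + 70 * unset G num v z ≤ 70 * unset G num v s) (unset G num v s) ?_ ?_).mono ?_)
  · refine ⟨(unset_congr rfl).symm, u, by simpa using h5, he, hst.congr rfl rfl, fun x hx hx0 => ?_,
      .inr rfl, fun x hx => hx, ?_⟩
    · exact (hcl x hx hx0).imp_right .inl
    · change 0 + 70 * unset G num v s ≤ _
      omega
  · rintro k z t hz hF ⟨rfl, c, h8, hp, h10, h11, h12, h13, h14⟩
    have r0 : z.reg 0 = n := by rw [hF.reg 0 (by simp)]; simpa using hn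
    have r3 : z.reg 3 = num v := by rw [hF.reg 3 (by simp)]; simpa using h3
    have r6 : z.reg 6 = num (G.tail e) := by rw [hF.reg 6 (by simp)]; simpa using h6
    have w2 : z.rreg 2 = G.weight e := by rw [hF.rreg 2 (by simp)]; simpa using h2
    have h1 := hidx c v
    have h1' := hidx c (G.tail e)
    refine ⟨by simp [r0, r3, h8]; omega, fun hc => ?_, fun hc => ?_⟩
    · simp only [Cond.Holds, nextE, at2, WExp.val, h8, r6, r0, r3, not_and_or, not_not] at hc
      refine ⟨?_, c, h8, hc, hp, h10, h11, h12, h13, by simp; omega⟩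
      have hF' := hF.mono (q := addFragment) fun l hl => by
        simp [addFragment] at hl ⊢
        tauto
      exact hF'.of_setReg (by simp [addFragment])
    · simp only [Cond.Holds, nextE, at2, WExp.val, h8, r6, r0, r3] at hc
      obtain ⟨hcj, hc0⟩ := hc
      have hcj' : c ≠ G.tail e := fun h => hcj (by rw [h])
      have hcanc : G.Ancestor c (G.tail e) :=
        (RealDag.reach_iff.1 hp.reach).resolve_left fun h => hcj' h.symm
      -- The direct ancestor has a smaller number than `v`, so its columns of both tables are final
      -- and can be copied from.
      have hD : z.rmem 1 (num c * (n + 1) + num (G.tail e)) = G.dist num c (G.tail e) :=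
        h10.past_dist c _ hadj
      have hNx : z.mem 7 (num c * (n + 1) + num (G.tail e)) = num (G.nxt num c v) := by
        rw [h10.past_next c _ hadj hcanc, hp.nxt_of_ne hnum hcj']
      have hpos := hnum.pos (G.nxt num c v)
      have hput : ∀ (y : State) (i x : ℕ), (y.setMem 7 i x).mem 7 i = x := by simp
      refine Run.of_wp ?_
      simp only [Prog.block, wp, WExp.Safe, RExp.Safe, WExp.val, RExp.val, State.setReg_reg,
        State.setReg_mem, State.setReg_rreg, State.setReg_rmem, State.setRmem_reg,
        State.setRmem_mem, State.setMem_reg, at2, distE, nextE,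
        WExp.cost, RExp.cost, Cond.cost, h8, r0, r3, r6, w2, hD, hNx, ← hp.dist_eq hnum, true_and,
        and_true, if_true, hput]
      refine ⟨by omega, by omega, by omega, by omega, by omega, ?_⟩
      set z' := (((z.setRmem 1 (num c * (n + 1) + num v) (G.dist num c v)).setMem 7
        (num c * (n + 1) + num v) (num (G.nxt num c v))).setReg 8 (num (G.nxt num c v))) with hz'
      have h7' : ∀ i, z'.mem 7 i =
          if i = num c * (n + 1) + num v then num (G.nxt num c v) else z.mem 7 i := fun i => by
        simp [hz']
      have hun := unset_update hnum hp.ancestor hc0 h7'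
      have hmono : ∀ i, z.mem 7 i ≠ 0 → z'.mem 7 i ≠ 0 := fun i hi => by
        rw [h7']; split_ifs <;> omega
      have hcset : z'.mem 7 (num c * (n + 1) + num v) ≠ 0 := by
        rw [h7', if_pos rfl]; omega
      refine ⟨unset G num v z', by omega, rfl, G.nxt num c v, by simp [hz'],
        hp.parent_nxt hnum hcj', h10.update hnum hp.ancestor h7' (fun i => by simp [hz']), ?_, ?_,
        fun x hx => hmono _ (h13 x hx), by omega⟩
      · intro x hx hx0
        change z'.mem 7 _ ≠ 0 at hx0
        by_cases hxc : x = c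
        · exact .inr (.inr (by rw [hxc]))
        · rw [h7', if_neg] at hx0
          · rcases h11 x hx hx0 with h | h | h
            · exact .inl h
            · exact .inr (.inl (hmono _ h))
            · exact .inr (.inl (by rw [h]; exact hcset))
          · rw [num_index_inj hnum]; exact fun h => hxc h.1
      · rcases h12 with h | h
        · exact .inl (hmono _ h)
        · exact .inl (by rw [h]; exact hcset)
  · rintro z t hz ⟨hF, c, h8, hcc, hp, h10, h11, h12, h13, h14⟩
    have r0 : z.reg 0 = n := by rw [hF.reg 0 (by simp [addFragment])]; exact hn
    have r3 : z.reg 3 = num v := by rw [hF.reg 3 (by simp [addFragment])]; exact h3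
    have r6 : z.reg 6 = num (G.tail e) := by rw [hF.reg 6 (by simp [addFragment])]; exact h6
    have w2 : z.rreg 2 = G.weight e := by rw [hF.rreg 2 (by simp [addFragment])]; exact h2
    have h1 := hidx (G.tail e) v
    -- However the loop ended, the entry for the direct ancestor itself is known: its next vertex is
    -- `v`, and its distance is the weight of the edge.
    have hj := hp.parent_tail hnum
    have hjn : G.nxt num (G.tail e) v = v := hj.nxt_of_eq hnum rfl
    have hjd : G.dist num (G.tail e) v = G.weight e := by
      rw [hj.dist_eq hnum, RealDag.dist_self hnum, zero_add]
    have hpos := hnum.pos v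
    have hcj : num c = num (G.tail e) → c = G.tail e := fun h => hnum.injective h
    refine Run.of_wp ?_
    simp only [Prog.block, wp, WExp.Safe, RExp.Safe, WExp.val, RExp.val, at2, nextE, WExp.cost,
      RExp.cost, Cond.Safe, Cond.Holds, Cond.cost, State.setRmem_reg, r0, r3, r6, w2, true_and]
    refine ⟨by omega, fun h0 => ⟨by omega, by omega, ?_⟩, fun h0 => ?_⟩
    · set z' := ((z.setRmem 1 (num (G.tail e) * (n + 1) + num v) (G.weight e)).setMem 7
        (num (G.tail e) * (n + 1) + num v) (num v)) with hz'
      have h7' : ∀ i, z'.mem 7 i = if i = num (G.tail e) * (n + 1) + num v then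
          num (G.nxt num (G.tail e) v) else z.mem 7 i := fun i => by
        simp [hz', hjn]
      have hun := unset_update hnum hj.ancestor h0 h7'
      have hmono : ∀ i, z.mem 7 i ≠ 0 → z'.mem 7 i ≠ 0 := fun i hi => by
        rw [h7', hjn]; split_ifs <;> omega
      have hjset : z'.mem 7 (num (G.tail e) * (n + 1) + num v) ≠ 0 := by
        rw [h7', if_pos rfl, hjn]; omega
      have hcset : z'.mem 7 (num c * (n + 1) + num v) ≠ 0 := by
        rcases hcc with h | h
        · rw [hcj h]; exact hjset
        · exact hmono _ h
      refine ⟨h10.update hnum hj.ancestor h7' (fun i => by simp [hz', hjd]), ?_, ?_,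
        fun x hx => hmono _ (h13 x hx), by omega⟩
      · intro x hx hx0
        by_cases hxj : x = G.tail e
        · exact .inl (by rw [hxj, hjn])
        · rw [h7', if_neg] at hx0
          · rcases h11 x hx hx0 with h | h | h
            · exact .inl h
            · exact .inr (hmono _ h)
            · exact .inr (by rw [h]; exact hcset)
          · rw [num_index_inj hnum]; exact fun h => hxj h.1
      · rcases h12 with h | h
        · exact hmono _ h
        · rw [h]; exact hcset
    · have hcset : z.mem 7 (num c * (n + 1) + num v) ≠ 0 := by
        rcases hcc with h | h
        · rw [hcj h]; exact h0
        · exact h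
      refine ⟨h10, fun x hx hx0 => ?_, ?_, h13, by omega⟩
      · rcases h11 x hx hx0 with h | h | h
        · exact .inl h
        · exact .inr h
        · exact .inr (by rw [h]; exact hcset)
      · rcases h12 with h | h
        · exact h
        · rw [h]; exact hcset

end Apsp

/-! ### Processing one vertex, with searches charged to leaves -/

namespace Apsp

open RealRam

variable {n m : ℕ} {G : RealDag n m} {num : Fin n → ℕ} {W : ℕ} {s : State}

/-- The data that the main loop only reads. -/
structure Ready (G : RealDag n m) (num : Fin n → ℕ) (z : State) : Prop where
  graph : HoldsGraph G z
  numbering : HoldsNumbering G num z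
  ancestors : HoldsAncestors G num z
  lists : ∀ v, ∃ l : List (Fin m), Linked (z.mem 6) (z.mem 5 (num v)) l ∧ l.Nodup ∧
    ∀ e, e ∈ l ↔ G.head e = v

theorem Ready.congr {p : Prog} {z z' : State} (h : Ready G num z) (hF : Frame p z z')
    (hp : (¬ p.Writes (.reg 0) ∧ ¬ p.Writes (.reg 1) ∧ ¬ p.Writes (.reg 2)) ∧
      (¬ p.Writes (.mem 0) ∧ ¬ p.Writes (.mem 1) ∧ ¬ p.Writes (.mem 2) ∧ ¬ p.Writes (.mem 3) ∧
      ¬ p.Writes (.mem 4) ∧ ¬ p.Writes (.mem 5) ∧ ¬ p.Writes (.mem 6)) ∧ ¬ p.Writes (.rmem 0)) :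
    Ready G num z' := by
  obtain ⟨⟨a0, a1, a2⟩, ⟨b0, b1, b2, b3, b4, b5, b6⟩, c0⟩ := hp
  have a0 := hF.reg 0 a0
  have a1 := hF.reg 1 a1
  have a2 := hF.reg 2 a2
  have b0 := hF.mem 0 b0
  have b1 := hF.mem 1 b1
  have b2 := hF.mem 2 b2
  have b3 := hF.mem 3 b3
  have b4 := hF.mem 4 b4
  have b5 := hF.mem 5 b5
  have b6 := hF.mem 6 b6
  have c0 := hF.rmem 0 c0
  exact ⟨⟨a0 ▸ h.graph.size, a1 ▸ h.graph.edges, b0 ▸ h.graph.tail, b1 ▸ h.graph.head,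
    c0 ▸ h.graph.weight⟩, ⟨h.numbering.numbering, b2 ▸ h.numbering.number,
    a2 ▸ h.numbering.sources⟩, ⟨b3 ▸ b4 ▸ h.ancestors.sorted, b3 ▸ b4 ▸ h.ancestors.mem_iff⟩,
    b5 ▸ b6 ▸ h.lists⟩

/-- The sorted list of ancestors. -/
theorem HoldsAncestors.exists_eq {v : Fin n} {p : ℕ} (h : HoldsAncestors G num s)
    (hp : p < s.mem 3 (num v)) :
    ∃ u, G.Ancestor u v ∧ s.mem 4 (num v * (n + 1) + p) = num u := by
  obtain ⟨u, h1, h2⟩ := (h.mem_iff v _).1 ⟨p, hp, rfl⟩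
  exact ⟨u, h1, h2.symm⟩

theorem HoldsAncestors.inj {v : Fin n} {p q : ℕ} (h : HoldsAncestors G num s)
    (hp : p < s.mem 3 (num v)) (hq : q < s.mem 3 (num v))
    (hpq : s.mem 4 (num v * (n + 1) + p) = s.mem 4 (num v * (n + 1) + q)) : p = q := by
  rcases lt_trichotomy p q with h1 | h1 | h1
  · exact absurd hpq (h.sorted v p q h1 hq).ne
  · exact h1
  · exact absurd hpq (h.sorted v q p h1 hp).ne'

theorem HoldsAncestors.count_le {v : Fin n} (h : HoldsAncestors G num s)
    (hnum : G.IsNumbering num) : s.mem 3 (num v) ≤ n := by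
  have : (Finset.range (s.mem 3 (num v))).card ≤ (Finset.Icc 1 n).card := by
    refine Finset.card_le_card_of_injOn (fun p => s.mem 4 (num v * (n + 1) + p)) ?_ ?_
    · intro p hp
      obtain ⟨u, -, hu⟩ := h.exists_eq (by simpa using hp)
      simp only [Finset.coe_Icc, Set.mem_Icc, hu]
      exact ⟨hnum.pos u, hnum.le u⟩
    · intro p hp q hq hpq
      exact h.inj (by simpa using hp) (by simpa using hq) hpq
  simpa using this

/-- The indices below `v` have been processed. -/
structure Before (G : RealDag n m) (num : Fin n → ℕ) (k : ℕ) (z : State) : Prop where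
  past_dist : ∀ u w, num w < k → z.rmem 1 (num u * (n + 1) + num w) = G.dist num u w
  past_next : ∀ u w, num w < k → G.Ancestor u w →
    z.mem 7 (num u * (n + 1) + num w) = num (G.nxt num u w)
  future : ∀ u w, k ≤ num w →
    z.rmem 1 (num u * (n + 1) + num w) = if u = w then 0 else ⊤

/-- Only cells in the column of `v` are cleared, so earlier columns survive. Vertices that are not
ancestors need no work at all, since their initial distances `0` and `∞` are already correct. -/
theorem initNext_run {v : Fin n} (hR : Ready G num s) (hW : (n + 1) * (n + 1) + m + 2 < W)
    (h3 : s.reg 3 = num v) (hB : Before G num (num v) s) :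
    Run W initNext s fun z t => Stage G num v z ∧
      (∀ u, G.Ancestor u v → z.mem 7 (num u * (n + 1) + num v) = 0) ∧ t ≤ 40 * n + 20 := by
  have hnum := hR.numbering.numbering
  have hA := hR.ancestors
  have hcount := hA.count_le (v := v) hnum
  have hnn : n < (n + 1) * (n + 1) := by nlinarith
  refine Run.fillUp (s.mem 3 (num v))
    (fun p => s.mem 4 (num v * (n + 1) + p) * (n + 1) + num v) (fun _ => 0) ?_ ?_ ?_ ?_
  · intro p hp q hq hpq
    exact hA.inj hp hq ((index_inj (hnum.le v) (hnum.le v)).1 hpq).1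
  · intro s' h1 h2
    simp [h1 3 (by simp), h2 3 (by simp), h3]
  · intro p hp _ s' _ hx h1 h2
    obtain ⟨u, hu, hu'⟩ := hA.exists_eq hp
    have i1 := index_lt (hnum.le v) (show p ≤ n by omega)
    have i2 := index_lt (hnum.le u) (hnum.le v)
    simp [h1 3 (by simp), h1 0 (by simp), h2 4 (by simp), h3, hR.graph.size, hu', hx]
    omega
  · intro z t hz h1 h2 _ h4 h5 h6 ht
    have hnot : ∀ u w, (u = w → ¬ G.Ancestor u w) := fun u w h h' => G.acyclic w (h ▸ h')
    have hset : ∀ u, G.Ancestor u v → z.mem 7 (num u * (n + 1) + num v) = 0 := fun u hu => by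
      obtain ⟨p, hp, hp'⟩ := (hA.mem_iff v (num u)).2 ⟨u, hu, rfl⟩
      rw [← hp']
      exact h5 p hp
    refine ⟨⟨?_, fun u w hw hu => ?_, fun u hu h0 => (h0 (hset u hu)).elim,
      fun u hu h0 => (h0 (hset u hu)).elim, fun u hu => ?_, fun u w hw => ?_⟩, hset, ?_⟩
    · rw [h4]; exact hB.past_dist
    · rw [h6]
      · exact hB.past_next u w hw hu
      · intro p hp h
        have := ((index_inj (hnum.le v) (hnum.le w)).1 h).2
        omega
    · rw [h4, hB.future u v le_rfl]
      split_ifs with h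
      · rw [h, RealDag.dist_self hnum]
      · rw [RealDag.dist_eq_top]
        intro hr
        rcases RealDag.reach_iff.1 hr with h' | h'
        · exact h h'.symm
        · exact hu h'
    · rw [h4]; exact hB.future u w hw.le
    · have : s.mem 3 (num v) * 21 ≤ n * 21 := Nat.mul_le_mul_right _ hcount
      simp at ht
      omega

open Classical in
/-- The number of edges entering `v`. -/
noncomputable def indeg (G : RealDag n m) (v : Fin n) : ℕ :=
  (Finset.univ.filter fun e => G.head e = v).card

/-- The shortest paths to `v` are found. -/
theorem vertex_run {v : Fin n} (hR : Ready G num s) (hW : (n + 1) * (n + 1) + m + 2 < W)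
    (h3 : s.reg 3 = num v) (hst : Stage G num v s)
    (hset : ∀ u, G.Ancestor u v → s.mem 7 (num u * (n + 1) + num v) = 0) :
    Run W (.forUp 4 (.const 0) (.get 3 (.reg 3)) (.block [
      .set 5 (ancE (.reg 3) (.reg 4)),
      .branch (.eq (nextE (.reg 5) (.reg 3)) (.const 0))
        (.block [findDirect, addFragment])
        .skip])) s fun z t => Before G num (num v + 1) z ∧
      t ≤ 200 * n + (60 * indeg G v + 120) * (G.leaf num v).ncard + 10 := by
  classical
  have hnum := hR.numbering.numbering
  have hA := hR.ancestors
  have hcount := hA.count_le (v := v) hnum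
  have hnn : n < (n + 1) * (n + 1) := by nlinarith
  obtain ⟨l, l1, l2, l3⟩ := hR.lists v
  have hlen : l.length = indeg G v := by
    rw [indeg, ← List.toFinset_card_of_nodup l2]
    congr 1
    ext e
    simp [l3]
  have hunset : unset G num v s ≤ n := by
    have := (Finset.univ.filter fun u => G.Ancestor u v ∧
      s.mem 7 (num u * (n + 1) + num v) = 0).card_le_univ
    rw [unset]
    simpa using this
  -- The leaves among the first `k` ancestors. Every search adds a new member, so the cardinality
  -- bounds the number of searches; filling entries is paid for by `unset`.
  let F : ℕ → Finset (Fin n) := fun k => Finset.univ.filter fun u =>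
    u ∈ G.leaf num v ∧ ∃ p < k, s.mem 4 (num v * (n + 1) + p) = num u
  refine Run.forUpFrame 0 (s.mem 3 (num v)) (fun k z t => Stage G num v z ∧
    NextClosed G num v z ∧ (∀ p < k, p < s.mem 3 (num v) →
      z.mem 7 (s.mem 4 (num v * (n + 1) + p) * (n + 1) + num v) ≠ 0) ∧
    t + 70 * unset G num v z ≤ 70 * unset G num v s + 50 * k +
      (60 * indeg G v + 120) * (F k).card) ⟨by simp; omega, rfl⟩ (Nat.zero_le _) ?_
    (by simp [findDirect, addFragment]) ?_ ?_ ?_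
  · refine ⟨hst.congr rfl rfl, fun x hx hx0 => (hx0 (hset x hx)).elim, by simp, ?_⟩
    rw [unset_setReg]
    omega
  · intro k z t _ _ hF _ _
    simp [hF.reg 3 (by simp [findDirect, addFragment]), hF.mem 3 (by simp [findDirect, addFragment]),
      h3]
  · rintro k z t hz - hk hkW hF hx ⟨hSz, hcl, hprev, ht⟩
    obtain ⟨u, hu, hu'⟩ := hA.exists_eq hk
    have hRz : Ready G num z := hR.congr hF (by simp [findDirect, addFragment])
    have r3 : z.reg 3 = num v := by rw [hF.reg 3 (by simp [findDirect, addFragment]), h3]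
    have m4 : z.mem 4 = s.mem 4 := by rw [hF.mem 4 (by simp [findDirect, addFragment])]
    have m5 : z.mem 5 = s.mem 5 := by rw [hF.mem 5 (by simp [findDirect, addFragment])]
    have m6 : z.mem 6 = s.mem 6 := by rw [hF.mem 6 (by simp [findDirect, addFragment])]
    have r0 : z.reg 0 = n := hRz.graph.size
    have i1 := index_lt (hnum.le v) (show k ≤ n by omega)
    have i2 := index_lt (hnum.le u) (hnum.le v)
    have i3 : num v * (n + 1) ≤ num v * (n + 1) + k := Nat.le_add_right _ _
    have i4 : num u * (n + 1) ≤ num u * (n + 1) + num v := Nat.le_add_right _ _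
    have hFF : F k ⊆ F (k + 1) := by
      intro x
      simp only [F, Finset.mem_filter, Finset.mem_univ, true_and]
      rintro ⟨h1, p, h2, h3⟩
      exact ⟨h1, p, by omega, h3⟩
    have hset1 : Run W (.set 5 (ancE (.reg 3) (.reg 4))) z fun z' t' =>
        z' = z.setReg 5 (num u) ∧ t' = 9 := by
      refine Run.of_wp ?_
      simp [r0, r3, m4, hu', hx]
      omega
    refine Run.seq (hset1.mono ?_)
    rintro z₁ t₁ hz₁ ⟨rfl, rfl⟩
    by_cases h0 : z.mem 7 (num u * (n + 1) + num v) = 0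
    swap
    · have hne : ¬ (Cond.eq (nextE (.reg 5) (.reg 3)) (.const 0)).Holds (z.setReg 5 (num u)) := by
        simpa [r0, r3] using h0
      intro hv
      refine ⟨_, _, .branch_false (Cond.Safe.fits hv ?_) hne (.skip _), hv, ?_, ?_, ?_, ?_⟩
      · simp [r0, r3]; omega
      · exact hSz.congr rfl rfl
      · exact fun x => hcl x
      · intro p hp hp'
        rcases Nat.lt_succ_iff_lt_or_eq.1 hp with h | rfl
        · exact hprev p h hp'
        · rw [hu']; exact h0
      · have := Finset.card_le_card hFF
        have := Nat.mul_le_mul_left (60 * indeg G v + 120) this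
        rw [unset_setReg, unset_setReg]
        simp
        omega
    -- A tree edge into `u` would come from an ancestor with a smaller number. By sortedness that
    -- ancestor precedes `u` in the list and is already set, and closedness then contradicts the
    -- empty entry of `u`.
    · have hleaf : u ∈ G.leaf num v := by
        refine RealDag.mem_leaf_of_ancestor hnum hu fun x hx hxu hnx => ?_
        obtain ⟨p, hp, hp'⟩ := (hA.mem_iff v (num x)).2 ⟨x, hx, rfl⟩
        have hpk : p < k := by
          by_contra h
          rcases (Nat.le_of_not_lt h).lt_or_eq with h | rfl
          · have := hA.sorted v k p h hp
            omega
          · omega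
        have := hprev p hpk hp
        rw [hp'] at this
        rcases hcl x hx this with h | h
        · rw [hnx] at h
          exact G.acyclic v (h ▸ hu)
        · rw [hnx] at h
          exact h h0
      have huF : u ∉ F k := by
        simp only [F, Finset.mem_filter, not_and, not_exists]
        rintro - - p hp hp'
        have := hA.inj (by omega) hk (hp'.trans hu'.symm)
        omega
      have hcard : (F k).card + 1 ≤ (F (k + 1)).card := by
        rw [← Finset.card_insert_of_notMem huF]
        refine Finset.card_le_card (Finset.insert_subset ?_ hFF)
        simp only [F, Finset.mem_filter, Finset.mem_univ, true_and]
        exact ⟨hleaf, k, by omega, hu'⟩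
      have heq : (Cond.eq (nextE (.reg 5) (.reg 3)) (.const 0)).Holds (z.setReg 5 (num u)) := by
        simpa [r0, r3] using h0
      suffices H : Run W (.seq findDirect addFragment) (z.setReg 5 (num u)) fun z' t' =>
          Stage G num v z' ∧ NextClosed G num v z' ∧ z'.mem 7 (num u * (n + 1) + num v) ≠ 0 ∧
          (∀ x, z.mem 7 (num x * (n + 1) + num v) ≠ 0 → z'.mem 7 (num x * (n + 1) + num v) ≠ 0) ∧
          t' + 70 * unset G num v z' ≤ 70 * unset G num v z + 60 * indeg G v + 100 by
        intro hv
        obtain ⟨z', t', e, v', a1, a2, a3, a4, a5⟩ := H hv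
        refine ⟨_, _, .branch_true (Cond.Safe.fits hv ?_) heq e, v', ?_, ?_, ?_, ?_⟩
        · simp [r0, r3]; omega
        · exact a1.congr rfl rfl
        · exact fun x => a2 x
        · intro p hp hp'
          simp only [State.setReg_mem]
          rcases Nat.lt_succ_iff_lt_or_eq.1 hp with h | rfl
          · obtain ⟨x, -, hx'⟩ := hA.exists_eq hp'
            rw [hx']
            exact a4 x (hx' ▸ hprev p h hp')
          · rw [hu']; exact a3
        · have := Nat.mul_le_mul_left (60 * indeg G v + 120) hcard
          rw [unset_setReg]
          simp only [Cond.cost, nextE, at2, WExp.cost]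
          rw [mul_add] at this
          omega
      refine Run.seq ((findDirect_run (G := G) (num := num) (u := u) (v := v) (l := l)
        (s := z.setReg 5 (num u)) ?_ ?_ hW (by simpa using r3) (by simp) hu ?_ l3 ?_).frame.mono ?_)
      · exact ⟨r0, by simpa using hRz.graph.edges, hRz.graph.tail, hRz.graph.head,
          hRz.graph.weight⟩
      · exact ⟨hnum, hRz.numbering.number, by simpa using hRz.numbering.sources⟩
      · simpa [m5, m6] using l1
      · intro e he
        exact hSz.past_dist _ _ (hnum.lt_of_adj _ _ (he ▸ RealDag.adj_edge e))
      rintro z₂ t₂ hz₂ ⟨⟨⟨e, he, he6, he2⟩, ht₂⟩, hF₂⟩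
      have q7 : z₂.mem 7 = z.mem 7 := hF₂.mem 7 (by simp [findDirect])
      have q1 : z₂.rmem 1 = z.rmem 1 := hF₂.rmem 1 (by simp [findDirect])
      refine (addFragment_run (G := G) (num := num) (u := u) (v := v) (e := e) hnum ?_ hW ?_ ?_ he6
        he2 he (hSz.congr q7 q1) ?_).mono ?_
      · rw [hF₂.reg 0 (by simp [findDirect])]; simpa using r0
      · rw [hF₂.reg 3 (by simp [findDirect])]; simpa using r3
      · rw [hF₂.reg 5 (by simp [findDirect])]; simp
      · unfold NextClosed; rw [q7]; exact hcl
      · rintro z' t' - ⟨a1, a2, a3, a4, a5⟩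
        rw [q7] at a4
        rw [unset_congr q7] at a5
        exact ⟨a1, a2, a3, a4, by omega⟩
  · rintro z t hz hF hx ⟨hSz, -, hprev, ht⟩
    have hall : ∀ u, G.Ancestor u v → z.mem 7 (num u * (n + 1) + num v) ≠ 0 := fun u hu => by
      obtain ⟨p, hp, hp'⟩ := (hA.mem_iff v (num u)).2 ⟨u, hu, rfl⟩
      rw [← hp']
      exact hprev p hp hp
    have hw : ∀ w, num w < num v + 1 → num w < num v ∨ w = v := fun w h => by
      rcases Nat.lt_succ_iff_lt_or_eq.1 h with h | h
      · exact .inl h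
      · exact .inr (hnum.injective h)
    refine ⟨⟨fun u w h => ?_, fun u w h hu => ?_, fun u w h => hSz.future u w h⟩, ?_⟩
    · rcases hw w h with h | rfl
      · exact hSz.past_dist u w h
      · by_cases hu : G.Ancestor u w
        · exact hSz.dist u hu (hall u hu)
        · exact hSz.dist_of_not u hu
    · rcases hw w h with h | rfl
      · exact hSz.past_next u w h hu
      · exact hSz.next u hu (hall u hu)
    · have hFl : (F (s.mem 3 (num v))).card ≤ (G.leaf num v).ncard := by
        rw [← Set.ncard_coe_finset]
        refine Set.ncard_le_ncard ?_ (Set.toFinite _)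
        intro x
        simp only [F, Finset.coe_filter]
        exact fun h => h.2.1
      have := Nat.mul_le_mul_left (60 * indeg G v + 120) hFl
      simp
      omega

end Apsp

/-! ### Initialization and the complete search -/

namespace Apsp

open RealRam

variable {n m : ℕ} {G : RealDag n m} {num : Fin n → ℕ} {W : ℕ} {s : State}

theorem initDist_run (hn : s.reg 0 = n) (hW : (n + 1) * (n + 1) + m + 2 < W) :
    Run W initDist s fun z t => (∀ x y, 1 ≤ x → x ≤ n → 1 ≤ y → y ≤ n →
      z.rmem 1 (x * (n + 1) + y) = if x = y then 0 else ⊤) ∧ t ≤ 30 * (n * n) + 60 * n + 20 := by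
  have hnn : n + 1 < (n + 1) * (n + 1) + 1 := by nlinarith
  refine Run.forUpFrame 1 (n + 1) (fun k z t => (∀ x y, 1 ≤ x → x < k → 1 ≤ y → y ≤ n →
      z.rmem 1 (x * (n + 1) + y) = if x = y then 0 else ⊤) ∧ t ≤ (30 * n + 60) * (k - 1))
    ⟨by simp; omega, rfl⟩ (by omega) ⟨fun x y _ _ => by omega, by simp⟩ (by simp) ?_ ?_ ?_
  · intro k z t _ _ hF _ _
    simp [hF.reg 0 (by simp), hn]
    omega
  · rintro k z t hz h1k hkn hkW hF hx ⟨h1, h2⟩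
    have r0 : z.reg 0 = n := by rw [hF.reg 0 (by simp)]; exact hn
    have i1 := index_lt (n := n) (x := k) (y := k) (by omega) (by omega)
    have i2 : k * (n + 1) ≤ k * (n + 1) + k := Nat.le_add_right _ _
    refine Run.seq ((Run.forUpFrame (Q := fun y t => Frame (.seq (.rput 1 (.const 0) .top)
        (.set 6 (.const 0))) z y ∧ (∀ x y', y' ≤ n → x ≠ k →
        y.rmem 1 (x * (n + 1) + y') = z.rmem 1 (x * (n + 1) + y')) ∧
        (∀ y', 1 ≤ y' → y' ≤ n → y.rmem 1 (k * (n + 1) + y') = ⊤) ∧ t ≤ 30 * n + 20)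
      1 (n + 1) (fun k' y t => (∀ x y', y' ≤ n → x ≠ k →
        y.rmem 1 (x * (n + 1) + y') = z.rmem 1 (x * (n + 1) + y')) ∧
        (∀ y', 1 ≤ y' → y' < k' → y' ≤ n → y.rmem 1 (k * (n + 1) + y') = ⊤) ∧ t ≤ 30 * (k' - 1))
      ⟨by simp; omega, rfl⟩ (by omega) ⟨fun x y' _ _ => rfl, fun y' _ _ => by omega, by simp⟩
      (by simp) ?_ ?_ ?_).mono ?_)
    · intro k' y t _ _ hF' _ _
      simp [hF'.reg 0 (by simp), r0]
      omega
    · rintro k' y t hy h1k' hkn' hkW' hF' hx' ⟨g1, g2, g3⟩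
      have i3 := index_lt (n := n) (x := k) (y := k') (by omega) (by omega)
      have i4 : k * (n + 1) ≤ k * (n + 1) + k' := Nat.le_add_right _ _
      have y3 : y.reg 3 = k := by rw [hF'.reg 3 (by simp)]; exact hx
      have y0 : y.reg 0 = n := by rw [hF'.reg 0 (by simp)]; exact r0
      refine Run.of_wp ?_
      simp only [wp, at2, WExp.Safe, RExp.Safe, WExp.val, RExp.val, WExp.cost, RExp.cost, y3, y0,
        hx', true_and, and_true]
      refine ⟨by omega, fun x y' hy' hxk => ?_, fun y' hy1 hy2 hy3 => ?_, by omega⟩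
      · simp only [State.setReg_rmem, State.setRmem_rmem, true_and]
        rw [if_neg, g1 x y' hy' hxk]
        rw [index_inj hy' (by omega)]
        exact fun h => hxk h.1
      · simp only [State.setReg_rmem, State.setRmem_rmem, true_and]
        split_ifs with h
        · rfl
        · refine g2 y' hy1 ?_ hy3
          have : y' ≠ k' := fun h' => h (by rw [h'])
          omega
    · rintro y t hy hF' hx' ⟨g1, g2, g3⟩
      refine ⟨hF'.mono (by simp), g1, fun y' h1 h2 => g2 y' h1 (by omega) h2, by simp; omega⟩
    · rintro y t hy ⟨hF', g1, g2, g3⟩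
      have y3 : y.reg 3 = k := by rw [hF'.reg 3 (by simp)]; exact hx
      have y0 : y.reg 0 = n := by rw [hF'.reg 0 (by simp)]; exact r0
      refine Run.of_wp ?_
      simp only [Prog.block, wp, at2, WExp.Safe, RExp.Safe, WExp.val, RExp.val, WExp.cost,
        RExp.cost, y3, y0, true_and, and_true]
      refine ⟨by omega, fun x y' hx1 hx2 hy1 hy2 => ?_, ?_⟩
      · simp only [State.setReg_rmem, State.setRmem_rmem, true_and]
        simp only [index_inj hy2 (by omega : k ≤ n)]
        by_cases hxk : x = k
        · subst hxk
          by_cases hxy : x = y'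
          · subst hxy; simp
          · simp [hxy, Ne.symm hxy, g2 y' hy1 hy2]
        · rw [if_neg (fun h => hxk h.1), g1 x y' hy2 hxk]
          exact h1 x y' hx1 (by omega) hy1 hy2
      · obtain ⟨k, rfl⟩ : ∃ j, k = j + 1 := ⟨k - 1, by omega⟩
        simp only [Nat.add_sub_cancel] at h2 ⊢
        rw [mul_add]
        omega
  · rintro z t hz hF hx ⟨h1, h2⟩
    refine ⟨fun x y hx1 hx2 => h1 x y hx1 (by omega), ?_⟩
    simp only [Nat.add_sub_cancel, add_mul, mul_assoc] at h2
    simp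
    omega

theorem inLists_run (hG : HoldsGraph G s) (hN : HoldsNumbering G num s)
    (hW : (n + 1) * (n + 1) + m + 2 < W) :
    Run W inLists s fun z t => (∀ v, ∃ l : List (Fin m), Linked (z.mem 6) (z.mem 5 (num v)) l ∧
      l.Nodup ∧ ∀ e, e ∈ l ↔ G.head e = v) ∧ t ≤ 20 * n + 40 * m + 30 := by
  have hnum := hN.numbering
  have hnn : n + 1 < (n + 1) * (n + 1) + 1 := by nlinarith
  refine Run.seq (Run.forUpFrame 1 (n + 1) (fun k z t => (∀ x, 1 ≤ x → x < k → z.mem 5 x = 0) ∧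
    t ≤ 20 * (k - 1)) ⟨by simp; omega, rfl⟩ (by omega) ⟨fun x _ _ => by omega, by simp⟩ (by simp)
    ?_ ?_ ?_)
  · intro k z t _ _ hF _ _
    simp [hF.reg 0 (by simp), hG.size]
    omega
  · rintro k z t hz h1k hkn hkW hF hx ⟨h1, h2⟩
    refine Run.of_wp ?_
    simp only [wp, WExp.Safe, WExp.val, WExp.cost, true_and, hx]
    refine ⟨by omega, fun x hx1 hx2 => ?_, by omega⟩
    simp only [State.setReg_mem, State.setMem_mem, true_and]
    split_ifs with h
    · rfl
    · exact h1 x hx1 (by omega)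
  · rintro z t hz hF hx ⟨h1, h2⟩
    refine Run.link (m := m) (key := fun e => num (G.head e)) ?_ ?_ ?_
    · rw [hF.reg 1 (by simp)]; exact hG.edges
    · intro e y _ h7 h
      have y1 : y.mem 1 = s.mem 1 := by rw [h 1 (by simp) (by simp), hF.mem 1 (by simp)]
      have y2 : y.mem 2 = s.mem 2 := by rw [h 2 (by simp) (by simp), hF.mem 2 (by simp)]
      simp [h7, y1, y2, hG.head, hN.number]
    · intro y t' _ hF' h t'le
      refine ⟨fun v => ?_, ?_⟩
      · obtain ⟨l, l1, l2, l3⟩ := h (num v) (h1 _ (hnum.pos v) (by have := hnum.le v; omega))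
        exact ⟨l, l1, l2, fun e => by rw [l3, hnum.injective.eq_iff]⟩
      · simp at h2 t'le ⊢
        omega

/-- The part of the algorithm that follows the numbering and the computation of the ancestors. -/
def searchPart : Prog := .seq initDist (.seq inLists
  (.forUp 3 (.add (.reg 2) (.const 1)) (.add (.reg 0) (.const 1)) <| .block [
    initNext,
    .forUp 4 (.const 0) (.get 3 (.reg 3)) <| .block [
      .set 5 (ancE (.reg 3) (.reg 4)),
      .branch (.eq (nextE (.reg 5) (.reg 3)) (.const 0))
        (.block [findDirect, addFragment])
        .skip]]))

theorem algorithm2_eq (number ancestors : Prog) :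
    algorithm2 number ancestors = .seq number (.seq ancestors searchPart) := rfl

theorem Before.holdsSolution {z : State} (hnum : G.IsNumbering num)
    (h : Before G num (n + 1) z) : HoldsSolution G num z := by
  have hlt : ∀ v, num v < n + 1 := fun v => by have := hnum.le v; omega
  refine ⟨fun u v p hp => ?_, fun u v huv hanc => ?_, fun u v hanc => ?_⟩
  · rw [h.past_dist u v (hlt v), hp.dist_eq hnum]
  · rw [h.past_dist u v (hlt v), RealDag.dist_eq_top]
    intro hr
    rcases RealDag.reach_iff.1 hr with h' | h'
    · exact huv h'.symm
    · exact hanc h'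
  · obtain ⟨e, h1, h2, h3, h4⟩ := hanc.exists_treeEdge hnum
    exact ⟨e, h1, h2, h4, by rw [h.past_next u v (hlt v) hanc, h3]⟩

/-- Each vertex costs `O(n)` for clearing and filling its column, plus its in-degree for each leaf
of its tree. Summation gives the bound. -/
theorem searchPart_run (hn : 1 ≤ n) (hG : HoldsGraph G s) (hN : HoldsNumbering G num s)
    (hA : HoldsAncestors G num s) (hW : (n + 1) * (n + 1) + m + 2 < W) :
    Run W searchPart s fun z t => HoldsNumbering G num z ∧ HoldsSolution G num z ∧
      t ≤ 2000 * (n * n) + 100 * m + 200 * ∑ v, indeg G v * (G.leaf num v).ncard := by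
  classical
  have hnum := hN.numbering
  have hnn : n + 1 < (n + 1) * (n + 1) + 1 := by nlinarith
  refine Run.seq ((initDist_run hG.size hW).frame.mono ?_)
  rintro z₁ t₁ - ⟨⟨d₁, b₁⟩, hF₁⟩
  have hG₁ : HoldsGraph G z₁ := by
    refine ⟨?_, ?_, ?_, ?_, ?_⟩
    · rw [hF₁.reg 0 (by simp [initDist])]; exact hG.size
    · rw [hF₁.reg 1 (by simp [initDist])]; exact hG.edges
    · rw [hF₁.mem 0 (by simp [initDist])]; exact hG.tail
    · rw [hF₁.mem 1 (by simp [initDist])]; exact hG.head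
    · rw [hF₁.rmem 0 (by simp [initDist])]; exact hG.weight
  have hN₁ : HoldsNumbering G num z₁ := by
    refine ⟨hnum, ?_, ?_⟩
    · rw [hF₁.mem 2 (by simp [initDist])]; exact hN.number
    · rw [hF₁.reg 2 (by simp [initDist])]; exact hN.sources
  refine Run.seq ((inLists_run hG₁ hN₁ hW).frame.mono ?_)
  rintro z₂ t₂ - ⟨⟨l₂, b₂⟩, hF₂⟩
  have hR : Ready G num z₂ := by
    refine ⟨⟨?_, ?_, ?_, ?_, ?_⟩, ⟨hnum, ?_, ?_⟩, ⟨?_, ?_⟩, l₂⟩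
    · rw [hF₂.reg 0 (by simp [inLists])]; exact hG₁.size
    · rw [hF₂.reg 1 (by simp [inLists])]; exact hG₁.edges
    · rw [hF₂.mem 0 (by simp [inLists])]; exact hG₁.tail
    · rw [hF₂.mem 1 (by simp [inLists])]; exact hG₁.head
    · rw [hF₂.rmem 0 (by simp [inLists])]; exact hG₁.weight
    · rw [hF₂.mem 2 (by simp [inLists])]; exact hN₁.number
    · rw [hF₂.reg 2 (by simp [inLists])]; exact hN₁.sources
    · rw [hF₂.mem 3 (by simp [inLists]), hF₂.mem 4 (by simp [inLists]),
        hF₁.mem 3 (by simp [initDist]), hF₁.mem 4 (by simp [initDist])]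
      exact hA.sorted
    · rw [hF₂.mem 3 (by simp [inLists]), hF₂.mem 4 (by simp [inLists]),
        hF₁.mem 3 (by simp [initDist]), hF₁.mem 4 (by simp [initDist])]
      exact hA.mem_iff
  have d₂ : ∀ u w, z₂.rmem 1 (num u * (n + 1) + num w) = if u = w then 0 else ⊤ := fun u w => by
    rw [hF₂.rmem 1 (by simp [inLists]), d₁ _ _ (hnum.pos u) (hnum.le u) (hnum.pos w) (hnum.le w)]
    simp only [hnum.injective.eq_iff]
  have hr : {v | G.IsSource v}.ncard ≤ n := by
    have := Set.ncard_le_encard {v | G.IsSource v}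
    have := Set.ncard_le_ncard (Set.subset_univ {v | G.IsSource v}) (Set.toFinite _)
    simpa [Set.ncard_univ] using this
  have hr2 := hR.numbering.sources
  have hnosrc : ∀ u w, G.IsSource w → ¬ G.Ancestor u w := fun u w hw h => by
    obtain ⟨e, he, -⟩ := h.exists_edge
    exact hw e he
  -- Sources have no ancestors, so their columns are correct after initialization, and the invariant
  -- holds at the first number beyond them.
  refine Run.forUpFrame ({v | G.IsSource v}.ncard + 1) (n + 1) (fun k z t => Before G num k z ∧
    t ≤ 500 * (n * k) + 200 * ∑ w with num w < k, indeg G w * (G.leaf num w).ncard) ?_ (by omega)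
    ⟨⟨fun u w hw => ?_, fun u w hw hu => ?_, fun u w _ => d₂ u w⟩, by simp⟩
    (by simp [initNext, findDirect, addFragment]) ?_ ?_ ?_
  · simp [hr2]
    omega
  · have hsrc := hnum.isSource_iff.2 (Nat.le_of_lt_succ hw)
    change z₂.rmem 1 _ = _
    rw [d₂ u w]
    split_ifs with h
    · rw [h, RealDag.dist_self hnum]
    · rw [RealDag.dist_eq_top]
      intro hreach
      rcases RealDag.reach_iff.1 hreach with h' | h'
      · exact h h'.symm
      · exact hnosrc u w hsrc h'
  · exact (hnosrc u w (hnum.isSource_iff.2 (Nat.le_of_lt_succ hw)) hu).elim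
  · intro k z t _ _ hF _ _
    simp [hF.reg 0 (by simp [initNext, findDirect, addFragment]), hR.graph.size]
    omega
  · rintro k z t hz h1k hkn hkW hF hx ⟨hB, ht⟩
    obtain ⟨v, rfl⟩ := hnum.exists_eq (k := k) (by omega) (by omega)
    have hRz : Ready G num z := hR.congr hF (by simp [initNext, findDirect, addFragment])
    refine Run.seq ((initNext_run hRz hW hx hB).frame.mono ?_)
    rintro y₁ u₁ - ⟨⟨hst, hset, c₁⟩, hF₁⟩
    have hRy : Ready G num y₁ := hRz.congr hF₁ (by simp [initNext])
    refine (vertex_run hRy hW ?_ hst hset).mono ?_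
    · rw [hF₁.reg 3 (by simp [initNext]), hx]
    rintro y₂ u₂ - ⟨hB₂, c₂⟩
    refine ⟨⟨hB₂.past_dist, hB₂.past_next, hB₂.future⟩, ?_⟩
    have hsum : ∑ w with num w < num v + 1, indeg G w * (G.leaf num w).ncard =
        indeg G v * (G.leaf num v).ncard +
          ∑ w with num w < num v, indeg G w * (G.leaf num w).ncard := by
      have hins : (Finset.univ.filter fun w => num w < num v + 1) =
          insert v (Finset.univ.filter fun w => num w < num v) := by
        ext w
        simp only [Finset.mem_filter, Finset.mem_univ, true_and, Finset.mem_insert]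
        rw [Nat.lt_succ_iff_lt_or_eq, hnum.injective.eq_iff, or_comm]
      rw [hins, Finset.sum_insert (by simp)]
    -- A vertex that is not a source has an incoming edge. Hence the constant cost per leaf is
    -- absorbed into in-degree times leaves: `60 + 120 = 180`.
    have hdeg : 1 ≤ indeg G v := by
      have hsrc : ¬ G.IsSource v := fun h => by
        have := hnum.isSource_iff.1 h
        omega
      simp only [RealDag.IsSource, not_forall, not_not] at hsrc
      obtain ⟨e, he⟩ := hsrc
      exact Finset.card_pos.2 ⟨e, by simp [he]⟩
    have h3 : (60 * indeg G v + 120) * (G.leaf num v).ncard ≤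
        180 * (indeg G v * (G.leaf num v).ncard) := by
      rw [← mul_assoc]
      exact Nat.mul_le_mul_right _ (by omega)
    rw [hsum, mul_add, mul_add]
    simp only [WExp.cost]
    omega
  · rintro z t hz hF hx ⟨hB, ht⟩
    have hRz : Ready G num z := hR.congr hF (by simp [initNext, findDirect, addFragment])
    refine ⟨hRz.numbering, hB.holdsSolution hnum, ?_⟩
    have hsum : ∑ w with num w < n + 1, indeg G w * (G.leaf num w).ncard =
        ∑ w, indeg G w * (G.leaf num w).ncard := by
      congr 1
      ext w
      have := hnum.le w
      simp
      omega
    rw [hsum, mul_add] at ht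
    simp only [WExp.cost]
    have : n ≤ n * n := by nlinarith
    omega

end Apsp

namespace RealRam

/-! ### Reachability by divide and conquer -/

/-- The truth value of a proposition, as a number. -/
noncomputable def ind (P : Prop) : ℕ := by
  classical exact if P then 1 else 0

theorem ind_le_one (P : Prop) : ind P ≤ 1 := by
  unfold ind; split_ifs <;> omega

theorem ind_pos {P : Prop} : 0 < ind P ↔ P := by
  unfold ind; split_ifs with h <;> simp [h]

theorem ind_eq_one {P : Prop} : ind P = 1 ↔ P := by
  unfold ind; split_ifs with h <;> simp [h]

theorem ind_of {P : Prop} (h : P) : ind P = 1 := ind_eq_one.2 h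

theorem ind_of_not {P : Prop} (h : ¬ P) : ind P = 0 := by
  unfold ind; simp [h]

theorem ind_congr {P P' : Prop} (h : P ↔ P') : ind P = ind P' := by
  rw [propext h]

/-- Truncated subtraction turns the count of intermediate vertices into a zero-one entry without
branching. -/
theorem one_sub_one_sub (v : ℕ) : 1 - (1 - v) = ind (0 < v) := by
  rcases Nat.eq_zero_or_pos v with h | h
  · rw [ind_of_not (by omega)]; omega
  · rw [ind_of h]; omega

theorem sum_ind_mul_pos {b : ℕ} {P P' : ℕ → Prop} :
    0 < ∑ k ∈ Finset.range b, ind (P k) * ind (P' k) ↔ ∃ k < b, P k ∧ P' k := by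
  rw [Nat.pos_iff_ne_zero, Ne, Finset.sum_eq_zero_iff]
  simp only [Finset.mem_range, mul_eq_zero, not_forall, not_or, ← Nat.pos_iff_ne_zero, ind_pos,
    exists_prop]

section Closure

variable {R : ℕ → ℕ → Prop}

theorem le_of_reflTransGen (hR : ∀ x y, R x y → x < y) {x y : ℕ} (h : Relation.ReflTransGen R x y) :
    x ≤ y := by
  induction h with
  | refl => rfl
  | tail _ h ih => have := hR _ _ h; omega

theorem exists_crossing {c x y : ℕ} (h : Relation.ReflTransGen R x y) (hx : x < c) (hy : c ≤ y) :
    ∃ u v, u < c ∧ c ≤ v ∧ Relation.ReflTransGen R x u ∧ R u v ∧ Relation.ReflTransGen R v y := by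
  induction h with
  | refl => omega
  | @tail u v hu huv ih =>
    by_cases huc : c ≤ u
    · obtain ⟨u', v', h1, h2, h3, h4, h5⟩ := ih huc
      exact ⟨u', v', h1, h2, h3, h4, h5.tail huv⟩
    · exact ⟨u, v, by omega, hy, hu, huv, .refl⟩

/-- The reachability across the middle of a block of size `2 b`. -/
theorem reflTransGen_block (hR : ∀ x y, R x y → x < y) {lo b i j : ℕ} (hi : i < b) (hj : j < b) :
    Relation.ReflTransGen R (lo + i) (lo + b + j) ↔ ∃ l < b, (∃ k < b,
      Relation.ReflTransGen R (lo + i) (lo + k) ∧ R (lo + k) (lo + b + l)) ∧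
      Relation.ReflTransGen R (lo + b + l) (lo + b + j) := by
  constructor
  · intro h
    -- Some edge of the path crosses the middle. As indices increase, the part before it stays in
    -- the left half of the block and the part after it in the right half.
    obtain ⟨u, v, hu, hv, h1, h2, h3⟩ := exists_crossing h (c := lo + b) (by omega) (by omega)
    have := le_of_reflTransGen hR h1
    have := le_of_reflTransGen hR h3
    obtain ⟨k, rfl⟩ := Nat.exists_eq_add_of_le (show lo ≤ u by omega)
    obtain ⟨l, rfl⟩ := Nat.exists_eq_add_of_le hv
    exact ⟨l, by omega, ⟨k, by omega, h1, h2⟩, h3⟩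
  · rintro ⟨l, -, ⟨k, -, h1, h2⟩, h3⟩
    exact (h1.tail h2).trans h3

end Closure

/-- `(x, y)` is a pair of the relation that lies in a block of size `b`, or below `lo` in a block of
size `2 b`. -/
def BlockRel (T : ℕ → ℕ → Prop) (b lo x y : ℕ) : Prop :=
  T x y ∧ (x / b = y / b ∨ x < lo ∧ x / (2 * b) = y / (2 * b))

/-! ### The product of two matrices -/

/-- The program `mm` multiplies zero-one matrices of size `b` in time `T`. -/
def Multiplies (W : ℕ) (mm : Prog) (b T : ℕ) : Prop :=
  ∀ (A B : ℕ → ℕ → ℕ) (s : State), (∀ i j, A i j ≤ 1) → (∀ i j, B i j ≤ 1) → s.reg 0 = b →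
    (∀ i < b, ∀ j < b, s.mem 0 (i * b + j) = A i j) →
    (∀ i < b, ∀ j < b, s.mem 1 (i * b + j) = B i j) →
    Run W mm s fun z t => (∀ i < b, ∀ j < b,
      z.mem 2 (i * b + j) = ∑ k ∈ Finset.range b, A i k * B k j) ∧ t ≤ T

/-- Multiply the matrices with the entries `a` and `a'`, which depend on the position in
register `N + 16`. The size is in register `N + 14`. -/
def Prog.product (mm : Prog) (N : ℕ) (a a' : WExp) : Prog := .block [
  .forUp (N + 16) (.const 0) (.mul (.reg (N + 14)) (.reg (N + 14))) (.put 0 (.reg (N + 16)) a),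
  .forUp (N + 16) (.const 0) (.mul (.reg (N + 14)) (.reg (N + 14))) (.put 1 (.reg (N + 16)) a'),
  .set 0 (.reg (N + 14)),
  mm]

variable {W N b T : ℕ} {mm : Prog} {s : State}

theorem divMod_lt {k b : ℕ} (h : k < b * b) : k / b < b ∧ k % b < b := by
  have hb : 0 < b := by
    rcases Nat.eq_zero_or_pos b with rfl | h'
    · simp at h
    · exact h'
  exact ⟨Nat.div_lt_of_lt_mul h, Nat.mod_lt _ hb⟩

theorem index_divMod {i j b : ℕ} (hi : i < b) (hj : j < b) :
    i * b + j < b * b ∧ (i * b + j) / b = i ∧ (i * b + j) % b = j := by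
  refine ⟨by nlinarith, ?_, ?_⟩
  · rw [mul_comm, Nat.mul_add_div (by omega), Nat.div_eq_of_lt hj, add_zero]
  · rw [mul_comm, Nat.mul_add_mod, Nat.mod_eq_of_lt hj]

/-- The factors are written anew into arrays `0` and `1` for each product, since `mm` may destroy
them. The first factor may read array `2`, which is still intact at that time; this allows a second
product to start from the result of the first. -/
theorem Prog.product_run {a a' : WExp} (hmm : Multiplies W mm b T) (A B : ℕ → ℕ → ℕ)
    (hA : ∀ i j, A i j ≤ 1) (hB : ∀ i j, B i j ≤ 1) (hb : s.reg (N + 14) = b) (hW : b * b < W)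
    (ha : ∀ k < b * b, ∀ z : State, z.Valid W → z.reg (N + 16) = k →
      (∀ y, y ≠ N + 16 → z.reg y = s.reg y) → (∀ c, c ≠ 0 → z.mem c = s.mem c) →
      a.Safe W z ∧ a.val z = A (k / b) (k % b))
    (ha' : ∀ k < b * b, ∀ z : State, z.Valid W → z.reg (N + 16) = k →
      (∀ y, y ≠ N + 16 → z.reg y = s.reg y) → (∀ c, c ≠ 0 → c ≠ 1 → z.mem c = s.mem c) →
      a'.Safe W z ∧ a'.val z = B (k / b) (k % b)) :
    Run W (mm.product N a a') s fun z t => (∀ i < b, ∀ j < b,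
      z.mem 2 (i * b + j) = ∑ k ∈ Finset.range b, A i k * B k j) ∧
      t ≤ T + b * b * (a.cost + a'.cost + 30) + 30 := by
  refine Run.seq (Run.fillUp (b * b) id (fun k => A (k / b) (k % b)) (fun _ _ _ _ h => h) ?_ ?_ ?_)
  · intro z h _
    simp [h, hb, hW]
  · intro k hk _ z hz hx hr hm
    exact ⟨⟨trivial, hx⟩, ha k hk z hz hx hr hm⟩
  rintro z₁ t₁ - r₁ m₁ - - f₁ - c₁
  refine Run.seq (Run.fillUp (b * b) id (fun k => B (k / b) (k % b)) (fun _ _ _ _ h => h) ?_ ?_ ?_)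
  · intro z h _
    simp [h, r₁, hb, hW]
  · intro k hk _ z hz hx hr hm
    exact ⟨⟨trivial, hx⟩, ha' k hk z hz hx (fun y hy => by rw [hr y hy, r₁ y hy])
      fun c h0 h1 => by rw [hm c h1, m₁ c h0]⟩
  rintro z₂ t₂ - r₂ m₂ - - f₂ - c₂
  refine Run.seq (Run.of_wp ⟨trivial, ?_⟩)
  refine (hmm A B _ hA hB ?_ ?_ ?_).mono ?_
  · simp [r₂, r₁, hb]
  · intro i hi j hj
    obtain ⟨h1, h2, h3⟩ := index_divMod hi hj
    have := f₁ _ h1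
    simp only [id, h2, h3] at this
    rw [State.setReg_mem, m₂ 0 (by simp), this]
  · intro i hi j hj
    obtain ⟨h1, h2, h3⟩ := index_divMod hi hj
    have := f₂ _ h1
    simp only [id, h2, h3] at this
    rw [State.setReg_mem, this]
  · rintro z t - ⟨h1, h2⟩
    refine ⟨h1, ?_⟩
    simp only [WExp.cost] at c₁ c₂ ⊢
    have e1 : b * b * (1 + a.cost + (1 + 1 + 1) + 8) = b * b * a.cost + b * b * 12 := by ring
    have e2 : b * b * (1 + a'.cost + (1 + 1 + 1) + 8) = b * b * a'.cost + b * b * 12 := by ring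
    have e3 : b * b * (a.cost + a'.cost + 30) = b * b * a.cost + b * b * a'.cost + b * b * 30 := by
      ring
    omega

/-! ### One step of the closure -/

/-- The entry of array `a` in the row `x` and the column `y`; register `N + 13` holds the size. -/
def tableE (N a : ℕ) (x y : WExp) : WExp := .get a (.add (.mul x (.reg (N + 13))) y)

def rowE (N : ℕ) : WExp := .div (.reg (N + 16)) (.reg (N + 14))

def colE (N : ℕ) : WExp := .mod (.reg (N + 16)) (.reg (N + 14))

def loE (N : ℕ) (e : WExp) : WExp := .add (.reg (N + 15)) e

def midE (N : ℕ) (e : WExp) : WExp := .add (.add (.reg (N + 15)) (.reg (N + 14))) e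

def truthE (e : WExp) : WExp := .sub (.const 1) (.sub (.const 1) e)

/-- Join the two halves of the block of size `2 b` at `lo`, where `b` and `lo` are in the registers
`N + 14` and `N + 15`. -/
def Prog.join (mm : Prog) (N : ℕ) : Prog := .block [
  mm.product N (tableE N (N + 14) (loE N (rowE N)) (loE N (colE N)))
    (tableE N (N + 13) (loE N (rowE N)) (midE N (colE N))),
  mm.product N (truthE (.get 2 (.reg (N + 16))))
    (tableE N (N + 14) (midE N (rowE N)) (midE N (colE N))),
  .forUp (N + 16) (.const 0) (.mul (.reg (N + 14)) (.reg (N + 14)))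
    (.put (N + 14) (.add (.mul (loE N (rowE N)) (.reg (N + 13))) (midE N (colE N)))
      (truthE (.get 2 (.reg (N + 16)))))]

variable {S q : ℕ} {R : ℕ → ℕ → Prop}

attribute [local simp] tableE rowE colE loE midE truthE Prog.product

theorem index_lt_sq {x y S : ℕ} (hx : x < S) (hy : y < S) :
    x * S + y < S * S ∧ x * S ≤ x * S + y := ⟨by nlinarith, Nat.le_add_right _ _⟩

theorem table_inj {x y x' y' S : ℕ} (hy : y < S) (hy' : y' < S) :
    x * S + y = x' * S + y' ↔ x = x' ∧ y = y' := by
  refine ⟨fun h => ?_, by rintro ⟨rfl, rfl⟩; rfl⟩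
  have h1 := congrArg (· / S) h
  have h2 := congrArg (· % S) h
  simp only [mul_comm _ S, Nat.mul_add_div (by omega : 0 < S), Nat.mul_add_mod,
    Nat.div_eq_of_lt hy, Nat.div_eq_of_lt hy', Nat.mod_eq_of_lt hy, Nat.mod_eq_of_lt hy'] at h1 h2
  omega

/-- Crossing the middle of a block means reaching some vertex in the left half, taking an edge, and
going on in the right half: closure times edges times closure. Since indices increase, only this
upper right part of the block is new. -/
theorem Prog.join_run (hN : ∀ l, mm.Uses l → l.idx < N) (hR : ∀ x y, R x y → x < y)
    (hmm : Multiplies W mm b T) (hb : 0 < b) (hS : s.reg (N + 13) = S) (hbr : s.reg (N + 14) = b)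
    (hlo : s.reg (N + 15) = 2 * b * q) (hle : 2 * b * q + 2 * b ≤ S) (hW : S * S + 1 < W)
    (hAD : ∀ x < S, ∀ y < S, s.mem (N + 13) (x * S + y) = ind (R x y))
    (hTR : ∀ x < S, ∀ y < S, s.mem (N + 14) (x * S + y) =
      ind (BlockRel (Relation.ReflTransGen R) b (2 * b * q) x y)) :
    Run W (mm.join N) s fun z t => (∀ x < S, ∀ y < S, z.mem (N + 14) (x * S + y) =
      ind (BlockRel (Relation.ReflTransGen R) b (2 * b * (q + 1)) x y)) ∧
      t ≤ 2 * T + 200 * (b * b) + 100 := by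
  -- Registers and arrays from `N` on are out of reach of `mm`, so the tables survive its calls.
  have hfr : ∀ j, ¬ mm.Writes (.reg (N + j)) := fun j h => by
    have := hN _ h.uses; simp [Loc.idx] at this
  have hfm : ∀ j, ¬ mm.Writes (.mem (N + j)) := fun j h => by
    have := hN _ h.uses; simp [Loc.idx] at this
  set lo := 2 * b * q with hlodef
  have hbS : b ≤ S := by omega
  have hSS : S ≤ S * S := by nlinarith
  have hbb : b * b ≤ S * S := Nat.mul_le_mul hbS hbS
  have d1 : ∀ i < b, (lo + i) / b = 2 * q := fun i hi => by
    rw [hlodef, show 2 * b * q + i = b * (2 * q) + i by ring, Nat.mul_add_div hb,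
      Nat.div_eq_of_lt hi, add_zero]
  have d2 : ∀ i < b, (lo + b + i) / b = 2 * q + 1 := fun i hi => by
    rw [hlodef, show 2 * b * q + b + i = b * (2 * q + 1) + i by ring, Nat.mul_add_div hb,
      Nat.div_eq_of_lt hi, add_zero]
  have d3 : ∀ i < 2 * b, (lo + i) / (2 * b) = q := fun i hi => by
    rw [hlodef, Nat.mul_add_div (by omega), Nat.div_eq_of_lt hi, add_zero]
  have t1 : ∀ i < b, ∀ j < b, s.mem (N + 14) ((lo + i) * S + (lo + j)) =
      ind (Relation.ReflTransGen R (lo + i) (lo + j)) := fun i hi j hj => by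
    rw [hTR _ (by omega) _ (by omega)]
    exact ind_congr ⟨fun h => h.1, fun h => ⟨h, .inl (by rw [d1 i hi, d1 j hj])⟩⟩
  have t2 : ∀ i < b, ∀ j < b, s.mem (N + 14) ((lo + b + i) * S + (lo + b + j)) =
      ind (Relation.ReflTransGen R (lo + b + i) (lo + b + j)) := fun i hi j hj => by
    rw [hTR _ (by omega) _ (by omega)]
    exact ind_congr ⟨fun h => h.1, fun h => ⟨h, .inl (by rw [d2 i hi, d2 j hj])⟩⟩
  refine Run.seq ((Prog.product_run hmm (fun i k => ind (Relation.ReflTransGen R (lo + i) (lo + k)))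
    (fun k l => ind (R (lo + k) (lo + b + l))) (fun _ _ => ind_le_one _) (fun _ _ => ind_le_one _)
    hbr (by omega) ?_ ?_).frame.mono ?_)
  · intro k hk z hz hx hr hm
    obtain ⟨hi, hj⟩ := divMod_lt hk
    obtain ⟨i1, i2⟩ := index_lt_sq (x := lo + k / b) (y := lo + k % b) (S := S)
      (by omega) (by omega)
    simp [hx, hr, hm, hS, hbr, hlo, t1 _ hi _ hj]
    omega
  · intro k hk z hz hx hr hm
    obtain ⟨hi, hj⟩ := divMod_lt hk
    obtain ⟨i1, i2⟩ := index_lt_sq (x := lo + k / b) (y := lo + b + k % b) (S := S)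
      (by omega) (by omega)
    simp [hx, hr, hm, hS, hbr, hlo, hAD (lo + k / b) (by omega) (lo + b + k % b) (by omega)]
    omega
  rintro z₁ c₁ - ⟨⟨p₁, b₁⟩, F₁⟩
  have r13 : z₁.reg (N + 13) = S := by rw [F₁.reg _ (by simp [hfr])]; exact hS
  have r14 : z₁.reg (N + 14) = b := by rw [F₁.reg _ (by simp [hfr])]; exact hbr
  have r15 : z₁.reg (N + 15) = lo := by rw [F₁.reg _ (by simp [hfr])]; exact hlo
  have m14 : z₁.mem (N + 14) = s.mem (N + 14) := F₁.mem _ (by simp [hfm])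
  refine Run.seq ((Prog.product_run hmm (fun i l => ind (∃ k < b,
    Relation.ReflTransGen R (lo + i) (lo + k) ∧ R (lo + k) (lo + b + l)))
    (fun l j => ind (Relation.ReflTransGen R (lo + b + l) (lo + b + j)))
    (fun _ _ => ind_le_one _) (fun _ _ => ind_le_one _)
    r14 (by omega) ?_ ?_).frame.mono ?_)
  · intro k hk z hz hx hr hm
    obtain ⟨hi, hj⟩ := divMod_lt hk
    have := p₁ _ hi _ hj
    rw [Nat.div_add_mod' k b] at this
    simp only [truthE, WExp.Safe, WExp.val, hx, hm 2 (by simp), this, one_sub_one_sub,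
      sum_ind_mul_pos, and_true]
    omega
  · intro k hk z hz hx hr hm
    obtain ⟨hi, hj⟩ := divMod_lt hk
    obtain ⟨i1, i2⟩ := index_lt_sq (x := lo + b + k / b) (y := lo + b + k % b) (S := S)
      (by omega) (by omega)
    simp [hx, hr, hm, r13, r14, r15, m14, t2 _ hi _ hj]
    omega
  rintro z₂ c₂ - ⟨⟨p₂, b₂⟩, F₂⟩
  have r13' : z₂.reg (N + 13) = S := by rw [F₂.reg _ (by simp [hfr])]; exact r13
  have r14' : z₂.reg (N + 14) = b := by rw [F₂.reg _ (by simp [hfr])]; exact r14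
  have r15' : z₂.reg (N + 15) = lo := by rw [F₂.reg _ (by simp [hfr])]; exact r15
  have m14' : z₂.mem (N + 14) = s.mem (N + 14) := by rw [F₂.mem _ (by simp [hfm])]; exact m14
  refine Run.fillUp (b * b) (fun k => (lo + k / b) * S + (lo + b + k % b))
    (fun k => ind (Relation.ReflTransGen R (lo + k / b) (lo + b + k % b))) ?_ ?_ ?_ ?_
  · intro k hk l hl h
    obtain ⟨hi, hj⟩ := divMod_lt hk
    obtain ⟨hi', hj'⟩ := divMod_lt hl
    obtain ⟨h1, h2⟩ := (table_inj (by omega) (by omega)).1 h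
    rw [← Nat.div_add_mod' k b, ← Nat.div_add_mod' l b, show k / b = l / b by omega,
      show k % b = l % b by omega]
  · intro z hr hm
    simp [hr, r14']
    omega
  · intro k hk _ z hz hx hr hm
    obtain ⟨hi, hj⟩ := divMod_lt hk
    obtain ⟨i1, i2⟩ := index_lt_sq (x := lo + k / b) (y := lo + b + k % b) (S := S)
      (by omega) (by omega)
    have := p₂ _ hi _ hj
    rw [Nat.div_add_mod' k b] at this
    simp only [loE, midE, rowE, colE, truthE, WExp.Safe, WExp.val, hx, hm 2 (by simp), this,
      one_sub_one_sub, sum_ind_mul_pos, reflTransGen_block hR hi hj, hr, r13', r14', r15', ne_eq,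
      Nat.add_left_cancel_iff, Nat.reduceEqDiff, not_false_eq_true, and_true, true_and]
    omega
  · rintro z t hz hr hm - - hf hnf ht
    refine ⟨fun x hx y hy => ?_, ?_⟩
    · by_cases hxy : ∃ k < b * b, (lo + k / b) * S + (lo + b + k % b) = x * S + y
      · obtain ⟨k, hk, h⟩ := hxy
        obtain ⟨hi, hj⟩ := divMod_lt hk
        obtain ⟨rfl, rfl⟩ := (table_inj (by omega) hy).1 h
        rw [hf k hk]
        refine ind_congr ⟨fun h => ⟨h, .inr ⟨?_, ?_⟩⟩, fun h => h.1⟩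
        · rw [mul_add]; omega
        · rw [d3 _ (by omega), add_assoc, d3 _ (by omega)]
      · rw [hnf _ fun k hk h => hxy ⟨k, hk, h⟩, m14', hTR x hx y hy]
        refine ind_congr ⟨?_, ?_⟩
        · rintro ⟨h1, h2 | ⟨h2, h3⟩⟩
          · exact ⟨h1, .inl h2⟩
          · exact ⟨h1, .inr ⟨by rw [mul_add]; omega, h3⟩⟩
        · rintro ⟨h1, h2 | ⟨h2, h3⟩⟩
          · exact ⟨h1, .inl h2⟩
          · by_cases hxlo : x < lo
            · exact ⟨h1, .inr ⟨hxlo, h3⟩⟩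
            -- A related pair in the block just joined, but outside the rectangle that was filled,
            -- has both ends in the same half, again because indices increase; so its entry was
            -- already present.
            · refine ⟨h1, .inl ?_⟩
              have hle := le_of_reflTransGen hR h1
              rw [mul_add, ← hlodef, mul_one] at h2
              obtain ⟨i, rfl⟩ := Nat.exists_eq_add_of_le (not_lt.1 hxlo)
              obtain ⟨j, rfl⟩ := Nat.exists_eq_add_of_le (show lo ≤ y by omega)
              have hj : j < 2 * b := by
                rw [d3 i (by omega), hlodef, Nat.mul_add_div (by omega)] at h3
                have : j / (2 * b) = 0 := by omega
                rcases Nat.div_eq_zero_iff.1 this with h | h <;> omega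
              by_cases hjb : j < b
              · rw [d1 i (by omega), d1 j hjb]
              · obtain ⟨j, rfl⟩ := Nat.exists_eq_add_of_le (not_lt.1 hjb)
                by_cases hib : i < b
                · obtain ⟨k1, k2, k3⟩ := index_divMod hib (show j < b by omega)
                  exact (hxy ⟨_, k1, by rw [k2, k3, add_assoc]⟩).elim
                · obtain ⟨i, rfl⟩ := Nat.exists_eq_add_of_le (not_lt.1 hib)
                  rw [← add_assoc, ← add_assoc, d2 i (by omega), d2 j (by omega)]
    · simp at b₁ b₂ ht ⊢
      omega

end RealRam

/-! ### The closure by matrix products in blocks of doubling size -/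

namespace RealRam

variable {W N b T S n : ℕ} {mm : Prog} {s : State} {R : ℕ → ℕ → Prop}

/-- Fill array `N + 14` with the identity matrix. -/
def Prog.identity (N : ℕ) : Prog :=
  .forUp (N + 16) (.const 0) (.mul (.reg (N + 13)) (.reg (N + 13)))
    (.put (N + 14) (.reg (N + 16)) (.sub (.sub (.const 1)
      (.sub (.div (.reg (N + 16)) (.reg (N + 13))) (.mod (.reg (N + 16)) (.reg (N + 13)))))
      (.sub (.mod (.reg (N + 16)) (.reg (N + 13))) (.div (.reg (N + 16)) (.reg (N + 13))))))

/-- With truncated subtraction, `1 - (i - j) - (j - i)` is `1` if `i = j` and `0` otherwise. -/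
theorem Prog.identity_run (hS : s.reg (N + 13) = S) (hW : S * S + 1 < W) :
    Run W (identity N) s fun z t => (∀ x < S, ∀ y < S,
      z.mem (N + 14) (x * S + y) = ind (x = y)) ∧ t ≤ S * S * 40 + 10 := by
  refine Run.fillUp (S * S) id (fun k => ind (k / S = k % S)) (fun _ _ _ _ h => h) ?_ ?_ ?_
  · intro z h _
    simp [h, hS]
    omega
  · intro k hk _ z hz hx hr hm
    refine ⟨⟨trivial, hx⟩, ?_⟩
    simp only [WExp.Safe, WExp.val, hx, hr (N + 13) (by simp), hS, and_true]
    refine ⟨by omega, ?_⟩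
    by_cases h : k / S = k % S
    · rw [ind_of h]; omega
    · rw [ind_of_not h]; omega
  · rintro z t - - - - - hf - ht
    refine ⟨fun x hx y hy => ?_, by simp at ht ⊢; omega⟩
    obtain ⟨h1, h2, h3⟩ := index_divMod hx hy
    have := hf _ h1
    rwa [id, h2, h3] at this

/-- Compute the reflexive transitive closure, in array `N + 14`, of the relation that is given in
array `N + 13` and increases the indices. Register `N + 13` holds the size, a power of two. -/
def Prog.closure (mm : Prog) (N : ℕ) : Prog := .block [
  identity N,
  .set (N + 14) (.const 1),
  .loop (.lt (.reg (N + 14)) (.reg (N + 13))) (.block [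
    .set (N + 15) (.const 0),
    .loop (.lt (.reg (N + 15)) (.reg (N + 13))) (.block [
      mm.join N,
      .set (N + 15) (.add (.reg (N + 15)) (.add (.reg (N + 14)) (.reg (N + 14))))]),
    .set (N + 14) (.add (.reg (N + 14)) (.reg (N + 14)))])]

/-- The inner loop of the closure. -/
theorem Prog.level_run (hN : ∀ l, mm.Uses l → l.idx < N) (hR : ∀ x y, R x y → x < y)
    (hmm : Multiplies W mm b T) (hb : 0 < b) (hS : s.reg (N + 13) = S) (hbr : s.reg (N + 14) = b)
    (hlo : s.reg (N + 15) = 0) (hdvd : 2 * b ∣ S) (hW : S * S + 1 < W) {K : ℕ}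
    (hK : 2 * T + 200 * (b * b) + 120 ≤ K * (2 * b * b))
    (hAD : ∀ x < S, ∀ y < S, s.mem (N + 13) (x * S + y) = ind (R x y))
    (hTR : ∀ x < S, ∀ y < S, s.mem (N + 14) (x * S + y) =
      ind (BlockRel (Relation.ReflTransGen R) b 0 x y)) :
    Run W (.loop (.lt (.reg (N + 15)) (.reg (N + 13))) (.block [
      mm.join N,
      .set (N + 15) (.add (.reg (N + 15)) (.add (.reg (N + 14)) (.reg (N + 14))))])) s
      fun z t => (∀ x < S, ∀ y < S, z.mem (N + 14) (x * S + y) =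
        ind (BlockRel (Relation.ReflTransGen R) (2 * b) 0 x y)) ∧
        z.reg (N + 14) = b ∧ t ≤ K * b * S + 10 := by
  have hfr : ∀ j, ¬ mm.Writes (.reg (N + j)) := fun j h => by
    have := hN _ h.uses; simp [Loc.idx] at this
  have hfm : ∀ j, ¬ mm.Writes (.mem (N + j)) := fun j h => by
    have := hN _ h.uses; simp [Loc.idx] at this
  obtain ⟨c, hc⟩ := hdvd
  have hSS : S ≤ S * S := by nlinarith
  -- Of the `c` blocks of size `2 * b`, the first `q` have been joined. By the choice of `K`, one
  -- join costs at most `K` times half of the area of such a block.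
  refine Run.loopFrame (fun k z t => ∃ q, k = c - q ∧ q ≤ c ∧ z.reg (N + 15) = 2 * b * q ∧
    (∀ x < S, ∀ y < S, z.mem (N + 14) (x * S + y) =
      ind (BlockRel (Relation.ReflTransGen R) b (2 * b * q) x y)) ∧ t ≤ K * b * (2 * b * q)) c
    ⟨0, by simp, by simp, by simpa using hlo, by simpa using hTR, by simp⟩ ?_
  rintro k z t hz hF ⟨q, rfl, hq, h15, hT, ht⟩
  have h13 : z.reg (N + 13) = S := by rw [hF.reg _ (by simp [Prog.join, Prog.product, hfr])]; exact hS
  have h14 : z.reg (N + 14) = b := by rw [hF.reg _ (by simp [Prog.join, Prog.product, hfr])]; exact hbr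
  have m13 : z.mem (N + 13) = s.mem (N + 13) := by
    rw [hF.mem _ (by simp [Prog.join, Prog.product, hfm])]
  refine ⟨⟨trivial, trivial⟩, fun hd => ?_, fun hd => ?_⟩
  · simp only [Cond.Holds, WExp.val, h15, h13, not_lt] at hd
    have hqc : 2 * b * q = S := le_antisymm (hc ▸ Nat.mul_le_mul_left _ hq) hd
    rw [hqc] at hT ht
    refine ⟨fun x hx y hy => ?_, h14, by simp; omega⟩
    rw [hT x hx y hy]
    refine ind_congr (and_congr_right fun _ => ⟨?_, ?_⟩)
    · rintro (h | ⟨-, h⟩)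
      · left
        rw [mul_comm, ← Nat.div_div_eq_div_mul, ← Nat.div_div_eq_div_mul, h]
      · exact .inl h
    · rintro (h | ⟨h, -⟩)
      · exact .inr ⟨hx, h⟩
      · omega
  · simp only [Cond.Holds, WExp.val, h15, h13] at hd
    have hqc : q < c := by
      by_contra h
      have := Nat.mul_le_mul_left (2 * b) (not_lt.1 h)
      omega
    have hle : 2 * b * q + 2 * b ≤ S := by
      have := Nat.mul_le_mul_left (2 * b) (show q + 1 ≤ c from hqc)
      rw [mul_add, mul_one] at this
      omega
    refine Run.seq ((Prog.join_run hN hR hmm hb h13 h14 h15 hle hW (by rw [m13]; exact hAD)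
      hT).frame.mono ?_)
    rintro z₁ t₁ - ⟨⟨hT₁, ht₁⟩, F₁⟩
    have g14 : z₁.reg (N + 14) = b := by
      rw [F₁.reg _ (by simp [Prog.join, Prog.product, hfr])]; exact h14
    have g15 : z₁.reg (N + 15) = 2 * b * q := by
      rw [F₁.reg _ (by simp [Prog.join, Prog.product, hfr])]; exact h15
    refine Run.of_wp ?_
    simp only [Prog.block, wp, WExp.Safe, WExp.val, WExp.cost, g14, g15, true_and]
    refine ⟨by omega, c - (q + 1), by omega, q + 1, rfl, hqc, ?_, hT₁, ?_⟩
    · simp; ring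
    · have e : K * b * (2 * b * (q + 1)) = K * b * (2 * b * q) + K * (2 * b * b) := by ring
      rw [e]
      simp
      omega

/-- At block size `b` there are `S / (2 * b)` joins with two products each, which costs about `ρ * b
* S`. As `b` doubles up to `S`, the levels sum to `ρ * S * S` without a logarithmic factor. -/
theorem Prog.closure_run (hN : ∀ l, mm.Uses l → l.idx < N) (hR : ∀ x y, R x y → x < y) {ρ p : ℕ}
    (hmm : ∀ b, 1 ≤ b → b ≤ S → Multiplies W mm b (ρ * (b * b))) (hp : S = 2 ^ p)
    (hS : s.reg (N + 13) = S) (hW : S * S + 1 < W)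
    (hAD : ∀ x < S, ∀ y < S, s.mem (N + 13) (x * S + y) = ind (R x y)) :
    Run W (mm.closure N) s fun z t => (∀ x < S, ∀ y < S, z.mem (N + 14) (x * S + y) =
      ind (Relation.ReflTransGen R x y)) ∧ t ≤ (ρ + 500) * (S * S) := by
  have hfr : ∀ j, ¬ mm.Writes (.reg (N + j)) := fun j h => by
    have := hN _ h.uses; simp [Loc.idx] at this
  have hfm : ∀ j, ¬ mm.Writes (.mem (N + j)) := fun j h => by
    have := hN _ h.uses; simp [Loc.idx] at this
  have hS1 : 1 ≤ S := hp ▸ Nat.one_le_two_pow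
  refine Run.seq ((Prog.identity_run hS hW).frame.mono ?_)
  rintro z₀ t₀ - ⟨⟨hT₀, b₀⟩, F₀⟩
  refine Run.seq (Run.of_wp ⟨by simp; omega, ?_⟩)
  refine Run.loopFrame (fun k z t => ∃ j, k = p - j ∧ j ≤ p ∧ z.reg (N + 14) = 2 ^ j ∧
    (∀ x < S, ∀ y < S, z.mem (N + 14) (x * S + y) =
      ind (BlockRel (Relation.ReflTransGen R) (2 ^ j) 0 x y)) ∧
    t ≤ (ρ + 190) * S * (2 ^ j - 1)) p
    ⟨0, by simp, by simp, by simp, ?_, by simp⟩ ?_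
  · intro x hx y hy
    rw [State.setReg_mem, hT₀ x hx y hy]
    refine ind_congr ⟨?_, ?_⟩
    · rintro rfl
      exact ⟨.refl, .inl rfl⟩
    · rintro ⟨-, h | h⟩
      · simpa using h
      · omega
  rintro k z t hz hF ⟨j, rfl, hj, h14, hT, ht⟩
  have h13 : z.reg (N + 13) = S := by
    rw [hF.reg _ (by simp [Prog.join, Prog.product, hfr]), ← hS, State.setReg_reg, if_neg (by simp),
      F₀.reg _ (by simp [Prog.identity])]
  have m13 : z.mem (N + 13) = s.mem (N + 13) := by
    rw [hF.mem _ (by simp [Prog.join, Prog.product, hfm]), State.setReg_mem,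
      F₀.mem _ (by simp [Prog.identity])]
  refine ⟨⟨trivial, trivial⟩, fun hd => ?_, fun hd => ?_⟩
  · simp only [Cond.Holds, WExp.val, h14, h13, not_lt] at hd
    have hSj : 2 ^ j = S := le_antisymm (hp ▸ Nat.pow_le_pow_right (by omega) hj) hd
    rw [hSj] at hT ht
    refine ⟨fun x hx y hy => ?_, ?_⟩
    · rw [hT x hx y hy]
      exact ind_congr ⟨fun h => h.1, fun h => ⟨h, .inl (by
        rw [Nat.div_eq_of_lt hx, Nat.div_eq_of_lt hy])⟩⟩
    · have h1 : (ρ + 190) * S * (S - 1) ≤ (ρ + 190) * (S * S) := by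
        rw [mul_assoc]
        exact Nat.mul_le_mul_left _ (Nat.mul_le_mul_left _ (Nat.sub_le _ _))
      have h2 : 1 ≤ S * S := Nat.mul_pos hS1 hS1
      have h3 : (ρ + 500) * (S * S) = (ρ + 190) * (S * S) + 310 * (S * S) := by ring
      simp only [Cond.cost, WExp.cost]
      omega
  · simp only [Cond.Holds, WExp.val, h14, h13] at hd
    have hjp : j < p := by
      by_contra h
      have := Nat.pow_le_pow_right (n := 2) (by omega) (not_lt.1 h)
      omega
    have hb : 0 < 2 ^ j := by positivity
    have hbb : 1 ≤ 2 ^ j * 2 ^ j := Nat.mul_pos hb hb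
    refine Run.seq (Run.of_wp ⟨by simp only [WExp.Safe]; omega, ?_⟩)
    -- The choice of `K` works since, for `b ≥ 1`, the overhead `200 * b * b + 120` of a join is at
    -- most `320 * b * b = 160 * (2 * b * b)`.
    refine Run.seq ((Prog.level_run (K := ρ + 160) hN hR (hmm (2 ^ j) hb (by omega)) hb
      (s := z.setReg (N + 15) 0) (S := S) (by simp [h13]) (by simp [h14]) (by simp) ?_ hW ?_
      (by rw [State.setReg_mem, m13]; exact hAD) (by simpa using hT)).mono ?_)
    · rw [hp, ← pow_succ']
      exact pow_dvd_pow _ hjp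
    · have : (ρ + 160) * (2 * 2 ^ j * 2 ^ j) =
        2 * (ρ * (2 ^ j * 2 ^ j)) + 320 * (2 ^ j * 2 ^ j) := by ring
      omega
    rintro z₁ t₁ - ⟨hT₁, g14, ht₁⟩
    refine Run.of_wp ?_
    have hpow : 2 ^ (j + 1) ≤ S := hp ▸ Nat.pow_le_pow_right (by omega) hjp
    rw [pow_succ] at hpow
    have hSS : S ≤ S * S := by nlinarith
    simp only [Prog.block, wp, WExp.Safe, WExp.val, WExp.cost, g14, true_and]
    refine ⟨by omega, p - (j + 1), by omega, j + 1, rfl, hjp, ?_, ?_, ?_⟩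
    · simp [pow_succ, mul_two]
    · rw [pow_succ']
      simpa using hT₁
    · have e1 : 2 ^ (j + 1) - 1 = (2 ^ j - 1) + 2 ^ j := by rw [pow_succ]; omega
      have e2 : (ρ + 190) * S * 2 ^ j = (ρ + 160) * 2 ^ j * S + 30 * (S * 2 ^ j) := by ring
      have e3 : 1 ≤ S * 2 ^ j := Nat.mul_pos hS1 hb
      rw [e1, mul_add, e2]
      simp only [Cond.cost, WExp.cost]
      omega

end RealRam

/-! ### The closure by adding columns along the edges -/

namespace RealRam

variable {W N b T S n m : ℕ} {mm : Prog} {s : State} {R : ℕ → ℕ → Prop}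

/-- The innermost loop of `Prog.columns`, which adds the column `x` to the column `y`. -/
def Prog.addColumn (N : ℕ) : Prog :=
  .forUp (N + 19) (.const 1) (.add (.reg (N + 10)) (.const 1)) (
    .branch (.eq (tableE N (N + 14) (.reg (N + 19)) (.reg (N + 18))) (.const 1))
      (.put (N + 14) (.add (.mul (.reg (N + 19)) (.reg (N + 13))) (.reg (N + 17))) (.const 1))
      .skip)

/-- Because `x < y`, the column that is read is not the one that is changed, so the loop really
computes the union of the two original columns. -/
theorem Prog.addColumn_run {x y : ℕ} (hn : s.reg (N + 10) = n) (hS : s.reg (N + 13) = S)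
    (hy : s.reg (N + 17) = y) (hx : s.reg (N + 18) = x) (hnS : n < S) (hyn : y ≤ n) (hxy : x < y)
    (hW : S * S + 1 < W) (P P' : ℕ → Prop)
    (hP : ∀ z, 1 ≤ z → z ≤ n → s.mem (N + 14) (z * S + x) = ind (P z))
    (hP' : ∀ z, 1 ≤ z → z ≤ n → s.mem (N + 14) (z * S + y) = ind (P' z)) :
    Run W (addColumn N) s fun w t =>
      (∀ z, 1 ≤ z → z ≤ n → w.mem (N + 14) (z * S + y) = ind (P' z ∨ P z)) ∧
      (∀ z v, v < S → v ≠ y → w.mem (N + 14) (z * S + v) = s.mem (N + 14) (z * S + v)) ∧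
      t ≤ 40 * n + 20 := by
  have hSS : S ≤ S * S := by nlinarith
  refine Run.forUpFrame 1 (n + 1) (fun k w t =>
    (∀ z, 1 ≤ z → z < k → w.mem (N + 14) (z * S + y) = ind (P' z ∨ P z)) ∧
    (∀ z, k ≤ z → z ≤ n → w.mem (N + 14) (z * S + y) = ind (P' z)) ∧
    (∀ z v, v < S → v ≠ y → w.mem (N + 14) (z * S + v) = s.mem (N + 14) (z * S + v)) ∧
    t ≤ 40 * (k - 1)) ⟨by simp; omega, rfl⟩ (by omega)
    ⟨fun z _ _ => by omega, fun z h1 h2 => hP' z h1 h2, fun z v _ _ => rfl, by simp⟩ (by simp)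
    ?_ ?_ ?_
  · intro k w t _ _ hF _ _
    simp [hF.reg (N + 10) (by simp), hn]
    omega
  · rintro k w t hw h1 hk hkW hF hz ⟨g1, g2, g3, g4⟩
    have r13 : w.reg (N + 13) = S := by rw [hF.reg _ (by simp)]; exact hS
    have r17 : w.reg (N + 17) = y := by rw [hF.reg _ (by simp)]; exact hy
    have r18 : w.reg (N + 18) = x := by rw [hF.reg _ (by simp)]; exact hx
    have i1 := index_lt_sq (show k < S by omega) (show x < S by omega)
    have i2 := index_lt_sq (show k < S by omega) (show y < S by omega)
    have hPk : w.mem (N + 14) (k * S + x) = ind (P k) := by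
      rw [g3 _ _ (by omega) (by omega)]; exact hP k h1 (by omega)
    refine Run.of_wp ?_
    simp only [wp, tableE, Cond.Safe, Cond.Holds, Cond.cost, WExp.Safe, WExp.val, WExp.cost, hz,
      r13, r17, r18, hPk, ind_eq_one, true_and, and_true]
    refine ⟨by omega, fun hp => ⟨by omega, ?_⟩, fun hp => ?_⟩
    · simp only [State.setReg_mem, State.setMem_mem, true_and]
      refine ⟨by omega, fun z hz1 hz2 => ?_, fun z hz1 hz2 => ?_, fun z v hv hvy => ?_, by omega⟩
      · simp only [table_inj (show y < S by omega) (show y < S by omega), and_true]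
        split_ifs with h
        · rw [h, ind_of (.inr hp)]
        · exact g1 z hz1 (by omega)
      · simp only [table_inj (show y < S by omega) (show y < S by omega), and_true]
        rw [if_neg (by omega)]
        exact g2 z (by omega) hz2
      · simp only [table_inj hv (show y < S by omega), hvy, and_false, if_false]
        exact g3 z v hv hvy
    · simp only [State.setReg_mem]
      refine ⟨fun z hz1 hz2 => ?_, fun z hz1 hz2 => g2 z (by omega) hz2, g3, by omega⟩
      by_cases h : z = k
      · rw [h, g2 k le_rfl (by omega)]
        exact ind_congr ⟨.inl, fun h => h.resolve_right hp⟩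
      · exact g1 z hz1 (by omega)
  · rintro w t hw hF - ⟨g1, g2, g3, g4⟩
    refine ⟨fun z h1 h2 => g1 z h1 (by omega), g3, ?_⟩
    simp at g4 ⊢
    omega

/-- Compute the same as `Prog.closure` by adding, for each pair `(x, y)` of the relation, the column
`x` to the column `y`. Register `N + 10` holds the largest relevant index. -/
def Prog.columns (N : ℕ) : Prog := .block [
  identity N,
  .forUp (N + 17) (.const 1) (.add (.reg (N + 10)) (.const 1)) (
    .forUp (N + 18) (.const 1) (.add (.reg (N + 10)) (.const 1)) (
      .branch (.eq (tableE N (N + 13) (.reg (N + 18)) (.reg (N + 17))) (.const 1))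
        (addColumn N)
        .skip))]

/-- The columns are completed in increasing order, and since the relation increases indices, every
column added to column `y` is already final. Testing all pairs costs `O(n²)`; an addition costs
`O(n)` and occurs at most `m` times, which the sum of indicators in the time bound records. -/
theorem Prog.columns_run (hR : ∀ x y, R x y → x < y) (hR1 : ∀ x y, R x y → 1 ≤ x ∧ y ≤ n)
    (hn : s.reg (N + 10) = n) (hS : s.reg (N + 13) = S) (hnS : n < S) (hW : S * S + 1 < W)
    (hm : ∑ y ∈ Finset.range (n + 1), ∑ x ∈ Finset.range (n + 1), ind (R x y) ≤ m)
    (hAD : ∀ x < S, ∀ y < S, s.mem (N + 13) (x * S + y) = ind (R x y)) :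
    Run W (columns N) s fun z t => (∀ x y, 1 ≤ x → x ≤ n → 1 ≤ y → y ≤ n →
      z.mem (N + 14) (x * S + y) = ind (Relation.ReflTransGen R x y)) ∧
      t ≤ 40 * (S * S) + 100 * (n * n) + 100 * n + 100 * (m * n) + 100 * m + 50 := by
  have hSS : S ≤ S * S := by nlinarith
  refine Run.seq ((identity_run hS hW).frame.mono ?_)
  rintro z₀ t₀ - ⟨⟨hT₀, b₀⟩, F₀⟩
  refine Run.forUpFrame 1 (n + 1) (fun k z t =>
    (∀ x y, 1 ≤ x → x ≤ n → 1 ≤ y → y < k →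
      z.mem (N + 14) (x * S + y) = ind (Relation.ReflTransGen R x y)) ∧
    (∀ x y, 1 ≤ x → x ≤ n → k ≤ y → y ≤ n → z.mem (N + 14) (x * S + y) = ind (x = y)) ∧
    t ≤ (60 * n + 60) * (k - 1) + (60 * n + 60) *
      ∑ y ∈ Finset.range k, ∑ x ∈ Finset.range (n + 1), ind (R x y))
    ⟨by simp; omega, rfl⟩ (by omega) ⟨fun x y _ _ _ _ => by omega, ?_, Nat.zero_le _⟩
    (by simp [addColumn]) ?_ ?_ ?_
  · intro x y _ _ _ _
    rw [State.setReg_mem, hT₀ x (by omega) y (by omega)]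
  · intro k z t _ _ hF _ _
    simp [hF.reg (N + 10) (by simp [addColumn]), F₀.reg (N + 10) (by simp [identity]), hn]
    omega
  · rintro k z t hz h1k hkn hkW hF hx ⟨g1, g2, g3⟩
    have r10 : z.reg (N + 10) = n := by
      rw [hF.reg _ (by simp [addColumn]), F₀.reg (N + 10) (by simp [identity])]; exact hn
    have r13 : z.reg (N + 13) = S := by
      rw [hF.reg _ (by simp [addColumn]), F₀.reg (N + 13) (by simp [identity])]; exact hS
    have m13 : z.mem (N + 13) = s.mem (N + 13) := by
      rw [hF.mem _ (by simp [addColumn]), F₀.mem _ (by simp [identity])]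
    refine Run.forUpFrame 1 (n + 1) (fun x w t =>
      (∀ u, 1 ≤ u → u ≤ n → w.mem (N + 14) (u * S + k) =
        ind (u = k ∨ ∃ v < x, Relation.ReflTransGen R u v ∧ R v k)) ∧
      (∀ u v, v < S → v ≠ k → w.mem (N + 14) (u * S + v) = z.mem (N + 14) (u * S + v)) ∧
      t ≤ 40 * (x - 1) + (60 * n + 60) * ∑ x ∈ Finset.range x, ind (R x k))
      ⟨by simp; omega, rfl⟩ (by omega) ⟨?_, fun u v _ _ => rfl, Nat.zero_le _⟩
      (by simp [addColumn]) ?_ ?_ ?_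
    · intro u h1 h2
      rw [State.setReg_mem, g2 u k h1 h2 le_rfl (by omega)]
      refine ind_congr ⟨.inl, ?_⟩
      rintro (h | ⟨v, hv, -, h⟩)
      · exact h
      · have := (hR1 _ _ h).1
        omega
    · intro x w t _ _ hF' _ _
      simp [hF'.reg (N + 10) (by simp [addColumn]), r10]
      omega
    · rintro x w t hw h1x hxn hxW hF' hwx ⟨f1, f2, f3⟩
      have w10 : w.reg (N + 10) = n := by rw [hF'.reg _ (by simp [addColumn])]; exact r10
      have w13 : w.reg (N + 13) = S := by rw [hF'.reg _ (by simp [addColumn])]; exact r13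
      have w17 : w.reg (N + 17) = k := by rw [hF'.reg _ (by simp [addColumn])]; exact hx
      have wm : w.mem (N + 13) (x * S + k) = ind (R x k) := by
        rw [hF'.mem _ (by simp [addColumn]), m13, hAD x (by omega) k (by omega)]
      have i1 := index_lt_sq (show x < S by omega) (show k < S by omega)
      rw [Finset.sum_range_succ, mul_add (60 * n + 60)]
      by_cases hxk : R x k
      · have hlt := hR _ _ hxk
        have hc : (Cond.eq (tableE N (N + 13) (.reg (N + 18)) (.reg (N + 17))) (.const 1)).Safe W w := by
          simp [tableE, w13, w17, hwx]
          omega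
        intro hv
        obtain ⟨w', t', e, v', q⟩ := addColumn_run w10 w13 w17 hwx hnS (by omega) hlt hW _ _
          (fun u h1 h2 => (f2 u x (by omega) (by omega)).trans (g1 u x h1 h2 h1x hlt)) f1 hv
        refine ⟨w', _, .branch_true (hc.fits hv) ?_ e, v', ?_, ?_, ?_⟩
        · simp [tableE, w13, w17, hwx, wm, ind_of hxk]
        · intro u h1 h2
          rw [State.setReg_mem, q.1 u h1 h2]
          refine ind_congr ⟨?_, ?_⟩
          · rintro ((h | ⟨v, h1, h2⟩) | h)
            · exact .inl h
            · exact .inr ⟨v, by omega, h2⟩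
            · exact .inr ⟨x, by omega, h, hxk⟩
          · rintro (h | ⟨v, h1, h2, h3⟩)
            · exact .inl (.inl h)
            · rcases Nat.lt_succ_iff_lt_or_eq.1 h1 with h | rfl
              · exact .inl (.inr ⟨v, h, h2, h3⟩)
              · exact .inr h2
        · intro u v h1 h2
          rw [State.setReg_mem, q.2.1 u v h1 h2, f2 u v h1 h2]
        · have := q.2.2
          rw [ind_of hxk]
          simp [tableE]
          omega
      · refine Run.of_wp ?_
        simp only [wp, tableE, Cond.Safe, Cond.Holds, Cond.cost, WExp.Safe, WExp.val, WExp.cost,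
          w13, w17, hwx, wm, ind_eq_one, true_and, and_true, hxk, false_implies, not_false_eq_true,
          true_implies]
        refine ⟨by omega, fun u h1 h2 => ?_, fun u v h1 h2 => ?_, by omega⟩
        · rw [State.setReg_mem, f1 u h1 h2]
          refine ind_congr (or_congr_right ⟨?_, ?_⟩)
          · rintro ⟨v, h1, h2⟩
            exact ⟨v, by omega, h2⟩
          · rintro ⟨v, h1, h2, h3⟩
            rcases Nat.lt_succ_iff_lt_or_eq.1 h1 with h | rfl
            · exact ⟨v, h, h2, h3⟩
            · exact (hxk h3).elim
        · rw [State.setReg_mem, f2 u v h1 h2]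
    · rintro w t' hw hF' hwx ⟨f1, f2, f3⟩
      simp only [State.setReg_mem]
      refine ⟨fun u v h1 h2 h3 h4 => ?_, fun u v h1 h2 h3 h4 => ?_, ?_⟩
      · by_cases hvk : v = k
        · rw [hvk, f1 u h1 h2]
          refine ind_congr ?_
          -- Splitting off the last edge of a path to column `k` gives exactly the union that the
          -- inner loop has formed.
          rw [Relation.ReflTransGen.cases_tail_iff]
          refine or_congr eq_comm ⟨?_, ?_⟩
          · rintro ⟨v, -, h⟩
            exact ⟨v, h⟩
          · rintro ⟨v, h, h'⟩
            have := hR _ _ h'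
            exact ⟨v, by omega, h, h'⟩
        · rw [f2 u v (by omega) hvk]
          exact g1 u v h1 h2 h3 (by omega)
      · rw [f2 u v (by omega) (by omega)]
        exact g2 u v h1 h2 (by omega) h4
      · rw [Finset.sum_range_succ, mul_add (60 * n + 60)]
        obtain ⟨k, rfl⟩ : ∃ j, k = j + 1 := ⟨k - 1, by omega⟩
        have e : (60 * n + 60) * (k + 1 + 1 - 1) = (60 * n + 60) * k + (60 * n + 60) := by
          rw [Nat.add_sub_cancel]; ring
        rw [e]
        simp only [Nat.add_sub_cancel, WExp.cost] at g3 f3 ⊢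
        omega
  · rintro z t hz hF - ⟨g1, g2, g3⟩
    refine ⟨fun x y h1 h2 h3 h4 => g1 x y h1 h2 h3 (by omega), ?_⟩
    have h := Nat.mul_le_mul_left (60 * n + 60) hm
    have e1 : (60 * n + 60) * m = 60 * (m * n) + 60 * m := by ring
    have e2 : (60 * n + 60) * (n + 1 - 1) = 60 * (n * n) + 60 * n := by
      rw [Nat.add_sub_cancel]; ring
    rw [e2] at g3
    simp only [WExp.cost]
    omega

end RealRam

namespace RealRam

variable {W : ℕ} {s : State}

/-! ### Copying arrays -/

/-- Copy the first cells of the word array `a'` to `a`; register `h` holds their number. -/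
def Prog.copy (x a a' h : ℕ) : Prog := .forUp x (.const 0) (.reg h) (.put a (.reg x) (.get a' (.reg x)))

/-- Copy the first cells of the real array `a'` to `a`; register `h` holds their number. -/
def Prog.rcopy (x a a' h : ℕ) : Prog :=
  .forUp x (.const 0) (.reg h) (.rput a (.reg x) (.get a' (.reg x)))

theorem Prog.copy_run {x a a' h H : ℕ} (hh : s.reg h = H) (hxh : h ≠ x) (ha : a' ≠ a) :
    Run W (copy x a a' h) s fun z t => (∀ k < H, z.mem a k = s.mem a' k) ∧
      t ≤ 15 * H + 10 := by
  refine Run.fillUp H id (s.mem a') (fun _ _ _ _ h => h) ?_ ?_ ?_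
  · intro z hr _
    simp [hr h hxh, hh]
  · intro k hk _ z hz hx hr hm
    simp [hx, hm a' ha]
  · rintro z t - - - - - hf - ht
    refine ⟨hf, ?_⟩
    simp at ht
    omega

theorem Prog.rcopy_run {x a a' h H : ℕ} (hh : s.reg h = H) (hxh : h ≠ x) (ha : a' ≠ a) :
    Run W (rcopy x a a' h) s fun z t => (∀ k < H, z.rmem a k = s.rmem a' k) ∧
      t ≤ 15 * H + 10 := by
  intro hs
  have hW : 0 < W := (Nat.zero_le _).trans_lt (hs.1 0)
  revert hs
  refine Run.forUpFrame 0 H (fun k z t => (∀ l < k, z.rmem a l = s.rmem a' l) ∧ t ≤ 15 * k)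
    ⟨hW, rfl⟩ (Nat.zero_le _) (by simp) (by simp) ?_ ?_ ?_
  · intro k z t _ _ hF _ _
    have : z.reg h = H := by rw [hF.reg _ (by simp [hxh])]; exact hh
    simp [this]
  · rintro k z t hz - hk hkW hF hx ⟨h1, h2⟩
    refine Run.of_wp ?_
    have hm : z.rmem a' = s.rmem a' := hF.rmem _ (by simp [ha])
    simp only [wp, WExp.Safe, RExp.Safe, WExp.val, RExp.val, WExp.cost, RExp.cost, hx, hm, true_and]
    refine ⟨fun l hl => ?_, by omega⟩
    simp only [State.setReg_rmem, State.setRmem_rmem, true_and]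
    split_ifs with h
    · rw [h]
    · exact h1 l (by omega)
  · rintro z t hz hF - ⟨h1, h2⟩
    refine ⟨h1, ?_⟩
    simp
    omega

theorem Prog.clock_writes {N : ℕ} {p : Prog} {l : Loc} (h : (p.clock N).Writes l) :
    p.Writes l ∨ l = .reg N ∨ l = .reg (N + 1) := by
  induction p with
  | skip => exact h.elim
  | set x e | put a i e | rset x e | rput a i e => simp [clock, tick] at h ⊢; tauto
  | seq p q ihp ihq => simp only [clock, Writes] at h ⊢; tauto
  | branch c p q ihp ihq => simp only [clock, Writes] at h ⊢; tauto
  | loop c p ih => simp [clock, tick, flag] at h ⊢; tauto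

end RealRam

/-! ### From the graph to the adjacency matrix and back to lists of ancestors -/

namespace Apsp

open RealRam

variable {n m : ℕ} {G : RealDag n m} {num : Fin n → ℕ} {W N S : ℕ} {s z : State}

/-- The edges between the numbers of the vertices. -/
def NumAdj (G : RealDag n m) (num : Fin n → ℕ) (x y : ℕ) : Prop :=
  ∃ e, num (G.tail e) = x ∧ num (G.head e) = y

theorem NumAdj.lt (hnum : G.IsNumbering num) {x y : ℕ} (h : NumAdj G num x y) : x < y := by
  obtain ⟨e, rfl, rfl⟩ := h
  exact hnum.lt_of_adj _ _ ⟨e, rfl, rfl⟩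

theorem NumAdj.bounds (hnum : G.IsNumbering num) {x y : ℕ} (h : NumAdj G num x y) :
    1 ≤ x ∧ y ≤ n := by
  obtain ⟨e, rfl, rfl⟩ := h
  exact ⟨hnum.pos _, hnum.le _⟩

theorem reflTransGen_numAdj_iff (hnum : G.IsNumbering num) {u v : Fin n} :
    Relation.ReflTransGen (NumAdj G num) (num u) (num v) ↔ G.Reach u v := by
  constructor
  · intro h
    generalize hy : num v = y at h
    induction h generalizing v with
    | refl =>
      rw [hnum.injective hy]
      exact RealDag.reach_refl u
    | tail _ h ih =>
      obtain ⟨e, h1, h2⟩ := h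
      have := hnum.injective (hy.trans h2.symm)
      exact (ih h1).tail ⟨e, rfl, this.symm⟩
  · intro h
    exact h.lift num fun a b ⟨e, h1, h2⟩ => ⟨e, by rw [h1], by rw [h2]⟩

theorem ancestor_iff (hnum : G.IsNumbering num) {v : Fin n} {x : ℕ} :
    (∃ u, G.Ancestor u v ∧ num u = x) ↔
      (1 ≤ x ∧ x ≤ n) ∧ x ≠ num v ∧ Relation.ReflTransGen (NumAdj G num) x (num v) := by
  constructor
  · rintro ⟨u, h, rfl⟩
    exact ⟨⟨hnum.pos u, hnum.le u⟩, (hnum.lt_of_ancestor h).ne,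
      (reflTransGen_numAdj_iff hnum).2 h.reach⟩
  · rintro ⟨⟨h1, h2⟩, h3, h4⟩
    obtain ⟨u, rfl⟩ := hnum.exists_eq h1 h2
    rcases RealDag.reach_iff.1 ((reflTransGen_numAdj_iff hnum).1 h4) with h | h
    · exact (h3 (by rw [h])).elim
    · exact ⟨u, h, rfl⟩

theorem sum_ind_numAdj_le (G : RealDag n m) (num : Fin n → ℕ) :
    ∑ y ∈ Finset.range (n + 1), ∑ x ∈ Finset.range (n + 1), ind (NumAdj G num x y) ≤ m := by
  classical
  rw [← Finset.sum_product']
  calc ∑ p ∈ Finset.range (n + 1) ×ˢ Finset.range (n + 1), ind (NumAdj G num p.2 p.1)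
      = ((Finset.range (n + 1) ×ˢ Finset.range (n + 1)).filter
          fun p => NumAdj G num p.2 p.1).card := by
        rw [Finset.card_filter]
        exact Finset.sum_congr rfl fun p _ => by unfold ind; congr
    _ ≤ (Finset.univ.image fun e : Fin m => (num (G.head e), num (G.tail e))).card := by
        refine Finset.card_le_card fun p hp => ?_
        obtain ⟨e, h1, h2⟩ := (Finset.mem_filter.1 hp).2
        exact Finset.mem_image.2 ⟨e, Finset.mem_univ _, by rw [h1, h2]⟩
    _ ≤ m := Finset.card_image_le.trans (by simp)

/-! ### Saving the input -/

/-- Copy the graph and the numbering to registers and arrays that no subroutine uses. -/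
def save (N : ℕ) : Prog := .block [
  .set (N + 10) (.reg 0),
  .set (N + 11) (.reg 1),
  .set (N + 12) (.reg 2),
  .copy (N + 16) (N + 10) 0 (N + 11),
  .copy (N + 16) (N + 11) 1 (N + 11),
  .copy (N + 16) (N + 12) 2 (N + 10),
  .rcopy (N + 16) (N + 10) 0 (N + 11)]

def restore (N : ℕ) : Prog := .block [
  .set 0 (.reg (N + 10)),
  .set 1 (.reg (N + 11)),
  .set 2 (.reg (N + 12)),
  .copy (N + 16) 0 (N + 10) (N + 11),
  .copy (N + 16) 1 (N + 11) (N + 11),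
  .copy (N + 16) 2 (N + 12) (N + 10),
  .rcopy (N + 16) 0 (N + 10) (N + 11)]

/-- The memory holds a copy of the graph and the numbering. -/
structure Saved (G : RealDag n m) (num : Fin n → ℕ) (N : ℕ) (s : State) : Prop where
  numbering : G.IsNumbering num
  size : s.reg (N + 10) = n
  edges : s.reg (N + 11) = m
  sources : s.reg (N + 12) = {v | G.IsSource v}.ncard
  tail : ∀ e : Fin m, s.mem (N + 10) e = G.tail e
  head : ∀ e : Fin m, s.mem (N + 11) e = G.head e
  number : ∀ v : Fin n, s.mem (N + 12) v = num v
  weight : ∀ e : Fin m, s.rmem (N + 10) e = (G.weight e : WithTop ℝ)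

theorem Saved.congr {p : Prog} (h : Saved G num N s) (hF : Frame p s z)
    (h1 : ¬ p.Writes (.reg (N + 10))) (h2 : ¬ p.Writes (.reg (N + 11)))
    (h3 : ¬ p.Writes (.reg (N + 12))) (h4 : ¬ p.Writes (.mem (N + 10)))
    (h5 : ¬ p.Writes (.mem (N + 11))) (h6 : ¬ p.Writes (.mem (N + 12)))
    (h7 : ¬ p.Writes (.rmem (N + 10))) : Saved G num N z :=
  ⟨h.numbering, by rw [hF.reg _ h1]; exact h.size, by rw [hF.reg _ h2]; exact h.edges,
    by rw [hF.reg _ h3]; exact h.sources, by rw [hF.mem _ h4]; exact h.tail,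
    by rw [hF.mem _ h5]; exact h.head, by rw [hF.mem _ h6]; exact h.number,
    by rw [hF.rmem _ h7]; exact h.weight⟩

attribute [local simp] Prog.copy Prog.rcopy

theorem save_run (hG : HoldsGraph G s) (hN : HoldsNumbering G num s) :
    Run W (save N) s fun z t => Saved G num N z ∧ t ≤ 15 * n + 45 * m + 50 := by
  refine Run.seq (Run.of_wp ⟨trivial, ?_⟩)
  refine Run.seq (Run.of_wp ⟨trivial, ?_⟩)
  refine Run.seq (Run.of_wp ⟨trivial, ?_⟩)
  refine Run.seq ((Prog.copy_run (H := m) (by simp [hG.edges]) (by simp) (by simp)).frame.mono ?_)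
  rintro z₁ t₁ - ⟨⟨c₁, b₁⟩, F₁⟩
  refine Run.seq ((Prog.copy_run (H := m) (by
    rw [F₁.reg _ (by simp)]; simp [hG.edges]) (by simp) (by simp)).frame.mono ?_)
  rintro z₂ t₂ - ⟨⟨c₂, b₂⟩, F₂⟩
  refine Run.seq ((Prog.copy_run (H := n) (by
    rw [F₂.reg _ (by simp), F₁.reg _ (by simp)]; simp [hG.size]) (by simp) (by simp)).frame.mono ?_)
  rintro z₃ t₃ - ⟨⟨c₃, b₃⟩, F₃⟩
  refine (Prog.rcopy_run (H := m) (by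
    rw [F₃.reg _ (by simp), F₂.reg _ (by simp), F₁.reg _ (by simp)]; simp [hG.edges]) (by simp)
    (by simp)).frame.mono ?_
  rintro z₄ t₄ - ⟨⟨c₄, b₄⟩, F₄⟩
  refine ⟨⟨hN.numbering, ?_, ?_, ?_, fun e => ?_, fun e => ?_, fun v => ?_, fun e => ?_⟩, ?_⟩
  · rw [F₄.reg _ (by simp), F₃.reg _ (by simp), F₂.reg _ (by simp), F₁.reg _ (by simp)]
    simp [hG.size]
  · rw [F₄.reg _ (by simp), F₃.reg _ (by simp), F₂.reg _ (by simp), F₁.reg _ (by simp)]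
    simp [hG.edges]
  · rw [F₄.reg _ (by simp), F₃.reg _ (by simp), F₂.reg _ (by simp), F₁.reg _ (by simp)]
    simp [hN.sources]
  · rw [F₄.mem _ (by simp), F₃.mem _ (by simp), F₂.mem _ (by simp), c₁ _ e.2]
    exact hG.tail e
  · rw [F₄.mem _ (by simp), F₃.mem _ (by simp), c₂ _ e.2, F₁.mem _ (by simp)]
    exact hG.head e
  · rw [F₄.mem _ (by simp), c₃ _ v.2, F₂.mem _ (by simp), F₁.mem _ (by simp)]
    exact hN.number v
  · rw [c₄ _ e.2, F₃.rmem _ (by simp), F₂.rmem _ (by simp), F₁.rmem _ (by simp)]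
    exact hG.weight e
  · simp only [WExp.cost]
    omega

theorem restore_run (h : Saved G num N s) :
    Run W (restore N) s fun z t => HoldsGraph G z ∧ HoldsNumbering G num z ∧
      t ≤ 15 * n + 45 * m + 50 := by
  refine Run.seq (Run.of_wp ⟨trivial, ?_⟩)
  refine Run.seq (Run.of_wp ⟨trivial, ?_⟩)
  refine Run.seq (Run.of_wp ⟨trivial, ?_⟩)
  refine Run.seq ((Prog.copy_run (H := m) (by simp [h.edges]) (by simp) (by simp)).frame.mono ?_)
  rintro z₁ t₁ - ⟨⟨c₁, b₁⟩, F₁⟩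
  refine Run.seq ((Prog.copy_run (H := m) (by
    rw [F₁.reg _ (by simp)]; simp [h.edges]) (by simp) (by simp)).frame.mono ?_)
  rintro z₂ t₂ - ⟨⟨c₂, b₂⟩, F₂⟩
  refine Run.seq ((Prog.copy_run (H := n) (by
    rw [F₂.reg _ (by simp), F₁.reg _ (by simp)]; simp [h.size]) (by simp) (by simp)).frame.mono ?_)
  rintro z₃ t₃ - ⟨⟨c₃, b₃⟩, F₃⟩
  refine (Prog.rcopy_run (H := m) (by
    rw [F₃.reg _ (by simp), F₂.reg _ (by simp), F₁.reg _ (by simp)]; simp [h.edges]) (by simp)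
    (by simp)).frame.mono ?_
  rintro z₄ t₄ - ⟨⟨c₄, b₄⟩, F₄⟩
  refine ⟨⟨?_, ?_, fun e => ?_, fun e => ?_, fun e => ?_⟩, ⟨h.numbering, fun v => ?_, ?_⟩, ?_⟩
  · rw [F₄.reg _ (by simp), F₃.reg _ (by simp), F₂.reg _ (by simp), F₁.reg _ (by simp)]
    simp [h.size]
  · rw [F₄.reg _ (by simp), F₃.reg _ (by simp), F₂.reg _ (by simp), F₁.reg _ (by simp)]
    simp [h.edges]
  · rw [F₄.mem _ (by simp), F₃.mem _ (by simp), F₂.mem _ (by simp), c₁ _ e.2]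
    exact h.tail e
  · rw [F₄.mem _ (by simp), F₃.mem _ (by simp), c₂ _ e.2, F₁.mem _ (by simp)]
    exact h.head e
  · rw [c₄ _ e.2, F₃.rmem _ (by simp), F₂.rmem _ (by simp), F₁.rmem _ (by simp)]
    exact h.weight e
  · rw [F₄.mem _ (by simp), c₃ _ v.2, F₂.mem _ (by simp), F₁.mem _ (by simp)]
    exact h.number v
  · rw [F₄.reg _ (by simp), F₃.reg _ (by simp), F₂.reg _ (by simp), F₁.reg _ (by simp)]
    simp [h.sources]
  · simp only [WExp.cost]
    omega

/-! ### The adjacency matrix -/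

/-- Find the least power of two that exceeds the number of vertices. -/
def findSize (N : ℕ) : Prog := .block [
  .set (N + 13) (.const 1),
  .loop (.not (.lt (.reg (N + 10)) (.reg (N + 13))))
    (.set (N + 13) (.add (.reg (N + 13)) (.reg (N + 13))))]

theorem findSize_run (hn : 1 ≤ n) (h : s.reg (N + 10) = n) (hW : 2 * n < W) :
    Run W (findSize N) s fun z t => (∃ p, z.reg (N + 13) = 2 ^ p) ∧ n < z.reg (N + 13) ∧
      z.reg (N + 13) ≤ 2 * n ∧ t ≤ 30 * n + 20 := by
  refine Run.seq (Run.of_wp ⟨by simp; omega, ?_⟩)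
  -- A doubling costs `9` and raises ten times the size by at least `10`, so the time is linear in
  -- the final size; the number of doublings need not be counted.
  refine Run.loopFrame (fun k z t => k = 2 * n - z.reg (N + 13) ∧ (∃ p, z.reg (N + 13) = 2 ^ p) ∧
    z.reg (N + 13) ≤ 2 * n ∧ t + 10 ≤ 10 * z.reg (N + 13)) (2 * n - 1) ?_ ?_
  · simp
    exact ⟨⟨0, rfl⟩, by omega⟩
  rintro k z t hz hF ⟨rfl, ⟨p, hp⟩, h1, h2⟩
  have h10 : z.reg (N + 10) = n := by rw [hF.reg _ (by simp)]; simp [h]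
  have hpos : 0 < z.reg (N + 13) := hp ▸ Nat.two_pow_pos p
  refine ⟨⟨trivial, trivial⟩, fun hc => ?_, fun hc => ?_⟩
  · simp only [Cond.Holds, WExp.val, h10, not_not] at hc
    refine ⟨⟨p, hp⟩, hc, h1, ?_⟩
    simp
    omega
  · simp only [Cond.Holds, WExp.val, h10] at hc
    refine Run.of_wp ?_
    simp only [wp, WExp.Safe, WExp.val, true_and]
    refine ⟨by omega, _, ?_, rfl, ⟨p + 1, ?_⟩, ?_, ?_⟩
    · simp
      omega
    · simp [hp, pow_succ, mul_two]
    · simp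
      omega
    · simp
      omega

/-- Store the adjacency matrix in array `N + 13`. -/
def adjacency (N : ℕ) : Prog := .block [
  .forUp (N + 16) (.const 0) (.mul (.reg (N + 13)) (.reg (N + 13)))
    (.put (N + 13) (.reg (N + 16)) (.const 0)),
  .forUp (N + 16) (.const 0) (.reg (N + 11))
    (.put (N + 13) (.add (.mul (.get (N + 12) (.get (N + 10) (.reg (N + 16)))) (.reg (N + 13)))
      (.get (N + 12) (.get (N + 11) (.reg (N + 16))))) (.const 1))]

theorem adjacency_run (h : Saved G num N s) (hS : s.reg (N + 13) = S) (hn : n < S)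
    (hW : S * S + 1 < W) :
    Run W (adjacency N) s fun z t => (∀ x < S, ∀ y < S,
      z.mem (N + 13) (x * S + y) = ind (NumAdj G num x y)) ∧ t ≤ 20 * (S * S) + 30 * m + 30 := by
  have hnum := h.numbering
  have hlt : ∀ v, num v < S := fun v => (hnum.le v).trans_lt hn
  refine Run.seq ((Run.fillUp (Q := fun z t => (∀ k < S * S, z.mem (N + 13) k = 0) ∧
    t ≤ 20 * (S * S) + 10) (S * S) id (fun _ => 0) (fun _ _ _ _ h => h) ?_ ?_ ?_).frame.mono ?_)
  · intro z hr _
    simp [hr, hS]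
    omega
  · intro k hk _ z hz hx hr hm
    simp [hx]
    omega
  · rintro z t - - - - - hf - ht
    refine ⟨hf, ?_⟩
    simp at ht
    omega
  rintro z₁ t₁ - ⟨⟨c₁, b₁⟩, F₁⟩
  have h₁ := h.congr F₁ (by simp) (by simp) (by simp) (by simp) (by simp) (by simp) (by simp)
  have hS₁ : z₁.reg (N + 13) = S := by rw [F₁.reg _ (by simp)]; exact hS
  refine Run.forUpFrame 0 m (fun k z t => (∀ x < S, ∀ y < S, z.mem (N + 13) (x * S + y) =
    ind (∃ e : Fin m, (e : ℕ) < k ∧ num (G.tail e) = x ∧ num (G.head e) = y)) ∧ t ≤ 30 * k)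
    ⟨by simp; omega, rfl⟩ (Nat.zero_le _) ⟨?_, by simp⟩ (by simp) ?_ ?_ ?_
  · intro x hx y hy
    rw [State.setReg_mem, c₁ _ (index_lt_sq hx hy).1, ind_of_not]
    rintro ⟨e, he, -⟩
    omega
  · intro k z t _ _ hF _ _
    simp [hF.reg (N + 11) (by simp), h₁.edges]
  · rintro k z t hz - hk hkW hF hx ⟨g1, g2⟩
    have hz' := h₁.congr hF (by simp) (by simp) (by simp) (by simp) (by simp) (by simp) (by simp)
    have hSz : z.reg (N + 13) = S := by rw [hF.reg _ (by simp)]; exact hS₁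
    have i := index_lt_sq (hlt (G.tail ⟨k, hk⟩)) (hlt (G.head ⟨k, hk⟩))
    have ht := hz'.tail ⟨k, hk⟩
    have hh := hz'.head ⟨k, hk⟩
    refine Run.of_wp ?_
    simp only [wp, WExp.Safe, WExp.val, WExp.cost, hx, ht, hh, hz'.number, hSz, true_and]
    refine ⟨by omega, by omega, fun x hx y hy => ?_, by omega⟩
    simp only [State.setReg_mem, State.setMem_mem, true_and, table_inj hy (hlt (G.head ⟨k, hk⟩))]
    split_ifs with hxy
    · exact (ind_of ⟨⟨k, hk⟩, by simp, hxy.1.symm, hxy.2.symm⟩).symm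
    · rw [g1 x hx y hy]
      refine ind_congr ⟨?_, ?_⟩
      · rintro ⟨e, he, h⟩
        exact ⟨e, by omega, h⟩
      · rintro ⟨e, he, h, h'⟩
        refine ⟨e, ?_, h, h'⟩
        have : (e : ℕ) ≠ k := fun hek => hxy (by
          rw [← h, ← h', show e = ⟨k, hk⟩ from Fin.ext hek]; exact ⟨rfl, rfl⟩)
        omega
  · rintro z t hz hF - ⟨g1, g2⟩
    refine ⟨fun x hx y hy => ?_, ?_⟩
    · rw [g1 x hx y hy]
      exact ind_congr ⟨fun ⟨e, _, h⟩ => ⟨e, h⟩, fun ⟨e, h⟩ => ⟨e, e.2, h⟩⟩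
    · simp
      omega

/-! ### The lists of ancestors -/

/-- List the indices `x ≠ y` with the entry `1` at `(x, y)` in array `N + 14`; register `3` holds
`y`. -/
def extractRow (N : ℕ) : Prog :=
  .forUp 4 (.const 1) (.add (.reg 0) (.const 1)) (
    .branch (.and (.not (.eq (.reg 4) (.reg 3)))
        (.eq (tableE N (N + 14) (.reg 4) (.reg 3)) (.const 1)))
      (.block [
        .put 4 (at2 (.reg 3) (.reg 5)) (.reg 4),
        .set 5 (.add (.reg 5) (.const 1))])
      .skip)

theorem extractRow_run {y : ℕ} {P : ℕ → Prop} (h0 : s.reg 0 = n) (h3 : s.reg 3 = y)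
    (h5 : s.reg 5 = 0) (hS : s.reg (N + 13) = S) (hn : n < S) (hy : y ≤ n) (hW : S * S + 1 < W)
    (hP : ∀ x, 1 ≤ x → x ≤ n → s.mem (N + 14) (x * S + y) = ind (P x)) :
    Run W (extractRow N) s fun z t =>
      (∀ p q, p < q → q < z.reg 5 → z.mem 4 (y * (n + 1) + p) < z.mem 4 (y * (n + 1) + q)) ∧
      (∀ x, (∃ p < z.reg 5, z.mem 4 (y * (n + 1) + p) = x) ↔ (1 ≤ x ∧ x ≤ n) ∧ x ≠ y ∧ P x) ∧
      (∀ x p, x ≠ y → p ≤ n → z.mem 4 (x * (n + 1) + p) = s.mem 4 (x * (n + 1) + p)) ∧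
      z.reg 5 ≤ n ∧ t ≤ 60 * n + 20 := by
  have hSS : S ≤ S * S := by nlinarith
  have hnS : (n + 1) * (n + 1) ≤ S * S := Nat.mul_le_mul hn hn
  refine Run.forUpFrame 1 (n + 1) (fun k z t =>
    (∀ p q, p < q → q < z.reg 5 → z.mem 4 (y * (n + 1) + p) < z.mem 4 (y * (n + 1) + q)) ∧
    (∀ x, (∃ p < z.reg 5, z.mem 4 (y * (n + 1) + p) = x) ↔ (1 ≤ x ∧ x < k) ∧ x ≠ y ∧ P x) ∧
    (∀ x p, x ≠ y → p ≤ n → z.mem 4 (x * (n + 1) + p) = s.mem 4 (x * (n + 1) + p)) ∧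
    z.reg 5 ≤ k - 1 ∧ t ≤ 60 * (k - 1)) ⟨by simp; omega, rfl⟩ (by omega) ?_ (by simp) ?_ ?_ ?_
  · simp only [State.setReg_reg, State.setReg_mem]
    simp only [show (5 : ℕ) ≠ 4 by simp, if_false, h5]
    refine ⟨fun p q _ h => by omega, fun x => ⟨?_, ?_⟩, fun _ _ _ _ => trivial, by omega, by omega⟩
    · rintro ⟨p, hp, -⟩
      omega
    · rintro ⟨h, -⟩
      omega
  · intro k z t _ _ hF _ _
    simp [hF.reg 0 (by simp), h0]
    omega
  · rintro k z t hz h1k hkn hkW hF hx ⟨g1, g2, g3, g4, g5⟩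
    have r0 : z.reg 0 = n := by rw [hF.reg _ (by simp)]; exact h0
    have r3 : z.reg 3 = y := by rw [hF.reg _ (by simp)]; exact h3
    have r13 : z.reg (N + 13) = S := by rw [hF.reg _ (by simp)]; exact hS
    have m14 : z.mem (N + 14) (k * S + y) = ind (P k) := by
      rw [hF.mem _ (by simp)]; exact hP k h1k (by omega)
    have i1 := index_lt_sq (show k < S by omega) (show y < S by omega)
    have i2 := index_lt (n := n) (x := y) (y := z.reg 5) hy (by omega)
    have i3 : y * (n + 1) ≤ y * (n + 1) + z.reg 5 := Nat.le_add_right _ _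
    refine Run.of_wp ?_
    simp only [Prog.block, wp, tableE, at2, Cond.Safe, Cond.Holds, Cond.cost, WExp.Safe, WExp.val,
      WExp.cost, hx, r0, r3, r13, m14, ind_eq_one, true_and, and_true]
    refine ⟨by omega, fun hp => ?_, fun hp => ?_⟩
    · simp only [State.setMem_reg, State.setReg_reg, State.setReg_mem, State.setMem_mem, true_and,
        if_true, show (5 : ℕ) ≠ 4 by simp, if_false, Nat.add_left_cancel_iff]
      have hlt : ∀ p < z.reg 5, z.mem 4 (y * (n + 1) + p) < k := fun p hp' =>
        ((g2 _).1 ⟨p, hp', rfl⟩).1.2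
      refine ⟨by omega, by omega, fun p q hpq hq => ?_, fun x => ⟨?_, ?_⟩, fun x p hxy hpn => ?_,
        by omega, by omega⟩
      · rw [if_neg (by omega)]
        split_ifs with h
        · exact hlt p (by omega)
        · exact g1 p q hpq (by omega)
      · rintro ⟨p, hp1, hp2⟩
        split_ifs at hp2 with h
        · exact hp2 ▸ ⟨⟨h1k, by omega⟩, hp⟩
        · obtain ⟨h2, h3⟩ := (g2 x).1 ⟨p, by omega, hp2⟩
          exact ⟨⟨h2.1, by omega⟩, h3⟩
      · rintro ⟨⟨h2, h3⟩, h4⟩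
        rcases Nat.lt_succ_iff_lt_or_eq.1 h3 with h | rfl
        · obtain ⟨p, hp1, hp2⟩ := (g2 x).2 ⟨⟨h2, h⟩, h4⟩
          exact ⟨p, by omega, by rw [if_neg (by omega)]; exact hp2⟩
        · exact ⟨z.reg 5, by omega, by simp⟩
      · simp only [index_inj hpn (show z.reg 5 ≤ n by omega), hxy, false_and, if_false]
        exact g3 x p hxy hpn
    · simp only [State.setReg_reg, State.setReg_mem, show (5 : ℕ) ≠ 4 by simp, if_false]
      refine ⟨g1, fun x => (g2 x).trans ⟨?_, ?_⟩, g3, by omega, by omega⟩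
      · rintro ⟨⟨h2, h3⟩, h4⟩
        exact ⟨⟨h2, by omega⟩, h4⟩
      · rintro ⟨⟨h2, h3⟩, h4⟩
        have : x ≠ k := by
          rintro rfl
          exact hp h4
        exact ⟨⟨h2, by omega⟩, h4⟩
  · rintro z t hz hF - ⟨g1, g2, g3, g4, g5⟩
    refine ⟨g1, fun x => (g2 x).trans ?_, g3, by omega, ?_⟩
    · rw [Nat.lt_succ_iff]
    · simp
      omega

/-- Store the lists of ancestors. -/
def extract (N : ℕ) : Prog :=
  .forUp 3 (.const 1) (.add (.reg 0) (.const 1)) (.block [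
    .set 5 (.const 0),
    extractRow N,
    .put 3 (.reg 3) (.reg 5)])

theorem extract_run (hN : HoldsNumbering G num s) (h0 : s.reg 0 = n) (hS : s.reg (N + 13) = S)
    (hn : n < S) (hW : S * S + 1 < W)
    (hT : ∀ x y, 1 ≤ x → x ≤ n → 1 ≤ y → y ≤ n →
      s.mem (N + 14) (x * S + y) = ind (Relation.ReflTransGen (NumAdj G num) x y)) :
    Run W (extract N) s fun z t => HoldsAncestors G num z ∧ t ≤ 60 * (n * n) + 60 * n + 20 := by
  have hnum := hN.numbering
  have hSS : S ≤ S * S := by nlinarith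
  refine Run.forUpFrame 1 (n + 1) (fun k z t => (∀ y, 1 ≤ y → y < k →
    (∀ p q, p < q → q < z.mem 3 y → z.mem 4 (y * (n + 1) + p) < z.mem 4 (y * (n + 1) + q)) ∧
    (∀ x, (∃ p < z.mem 3 y, z.mem 4 (y * (n + 1) + p) = x) ↔ (1 ≤ x ∧ x ≤ n) ∧ x ≠ y ∧
      Relation.ReflTransGen (NumAdj G num) x y) ∧ z.mem 3 y ≤ n) ∧
    t ≤ (60 * n + 50) * (k - 1)) ⟨by simp; omega, rfl⟩ (by omega)
    ⟨fun y _ _ => by omega, by simp⟩ (by simp [extractRow]) ?_ ?_ ?_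
  · intro k z t _ _ hF _ _
    simp [hF.reg 0 (by simp [extractRow]), h0]
    omega
  · rintro k z t hz h1k hkn hkW hF hx ⟨g1, g2⟩
    have r0 : z.reg 0 = n := by rw [hF.reg _ (by simp [extractRow])]; exact h0
    have r13 : z.reg (N + 13) = S := by rw [hF.reg _ (by simp [extractRow])]; exact hS
    have m14 : z.mem (N + 14) = s.mem (N + 14) := hF.mem _ (by simp [extractRow])
    refine Run.seq (Run.of_wp ⟨by simp; omega, ?_⟩)
    refine Run.seq ((extractRow_run (y := k) (S := S)
      (P := fun x => Relation.ReflTransGen (NumAdj G num) x k) (by simp [r0])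
      (by simp [hx]) (by simp) (by simp [r13]) hn (by omega) hW fun x h1 h2 => ?_).frame.mono ?_)
    · rw [State.setReg_mem, m14]
      exact hT x k h1 h2 h1k (by omega)
    rintro z₁ t₁ - ⟨⟨f1, f2, f3, f4, f5⟩, F₁⟩
    have r3 : z₁.reg 3 = k := by rw [F₁.reg _ (by simp [extractRow])]; simp [hx]
    have m3 : z₁.mem 3 = z.mem 3 := by rw [F₁.mem _ (by simp [extractRow])]; rfl
    refine Run.of_wp ?_
    simp only [Prog.block, wp, WExp.Safe, WExp.val, WExp.cost, r3, true_and]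
    refine ⟨fun y h1 h2 => ?_, ?_⟩
    · have e4 : ((z₁.setMem 3 k (z₁.reg 5)).setReg 3 (k + 1)).mem 4 = z₁.mem 4 := by
        simp
      have e3 : ((z₁.setMem 3 k (z₁.reg 5)).setReg 3 (k + 1)).mem 3 y =
          if y = k then z₁.reg 5 else z.mem 3 y := by
        simp [m3]
      rw [e4, e3]
      by_cases hyk : y = k
      · rw [if_pos hyk, hyk]
        exact ⟨f1, f2, f4⟩
      · rw [if_neg hyk]
        obtain ⟨g3, g4, g5⟩ := g1 y h1 (by omega)
        -- Rows of the list table have length `n + 1`. The bound `n` on the size of each list, kept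
        -- in the invariant, ensures that writing one row leaves the others intact.
        have e : ∀ p < z.mem 3 y, z₁.mem 4 (y * (n + 1) + p) = z.mem 4 (y * (n + 1) + p) :=
          fun p hp => f3 y p hyk (by omega)
        refine ⟨fun p q hpq hq => ?_, fun x => ?_, g5⟩
        · rw [e p (by omega), e q hq]
          exact g3 p q hpq hq
        · rw [← g4]
          exact exists_congr fun p => and_congr_right fun hp => by rw [e p hp]
    · obtain ⟨k, rfl⟩ : ∃ j, k = j + 1 := ⟨k - 1, by omega⟩
      rw [Nat.add_sub_cancel] at g2 ⊢
      rw [mul_add]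
      omega
  · rintro z t hz hF - ⟨g1, g2⟩
    have hlt : ∀ v, num v < n + 1 := fun v => by have := hnum.le v; omega
    refine ⟨⟨fun v => (g1 _ (hnum.pos v) (hlt v)).1, fun v x => ?_⟩, ?_⟩
    · rw [(g1 _ (hnum.pos v) (hlt v)).2.1, ancestor_iff hnum]
    · have : (60 * n + 50) * (n + 1 - 1) = 60 * (n * n) + 50 * n := by
        rw [Nat.add_sub_cancel]; ring
      rw [this] at g2
      simp
      omega

end Apsp

namespace Apsp

open RealRam

variable {n m : ℕ} {G : RealDag n m} {num : Fin n → ℕ} {W N S ρ : ℕ} {mm : Prog} {s : State}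

/-! ### Reachability in bounded time -/

/-- Compute the closure by matrix multiplication, or by columns if that takes too long. -/
def reachability (mm : Prog) (N : ℕ) : Prog := .block [
  .set (N + 20) (.add (.mul (.reg (N + 10)) (.reg (N + 11)))
    (.add (.mul (.reg (N + 10)) (.reg (N + 10))) (.const 1))),
  (mm.closure N).clock (N + 20),
  .branch (.eq (.reg (N + 20)) (.const 0)) (.columns N) .skip]

/-- Registers `N + 20` and `N + 21`, the fuel and the flag of the clock, must be invisible to the
program that is clocked. -/
theorem closure_not_uses (hN : ∀ l, mm.Uses l → l.idx < N) {j : ℕ} (hj : 20 ≤ j) :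
    ¬ (mm.closure N).Uses (.reg (N + j)) := by
  have h : ¬ mm.Uses (.reg (N + j)) := fun h => by
    have := hN _ h; simp [Loc.idx] at this
  simp [Prog.closure, Prog.identity, Prog.join, Prog.product, Prog.Uses, Cond.Uses, WExp.Uses,
    tableE, rowE, colE, loE, midE, truthE, h]
  omega

/-- The fuel is proportional to the cost of the column method. If some is left, the closure was
computed completely; if none is left, then the time of the closure is at least the fuel, and the
column method costs only a constant times the minimum, apart from the `S * S` for the identity
matrix. -/
theorem reachability_run (hN : ∀ l, mm.Uses l → l.idx < N) (hn : 1 ≤ n) (h : Saved G num N s)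
    (hS : s.reg (N + 13) = S) (hp : ∃ p, S = 2 ^ p) (hnS : n < S) (hW : S * S + 1 < W)
    (hW' : n * m + n * n + 2 < W)
    (hmm : ∀ b, 1 ≤ b → b ≤ S → Multiplies W mm b (ρ * (b * b)))
    (hAD : ∀ x < S, ∀ y < S, s.mem (N + 13) (x * S + y) = ind (NumAdj G num x y)) :
    Run W (reachability mm N) s fun z t => Saved G num N z ∧ z.reg (N + 13) = S ∧
      (∀ x y, 1 ≤ x → x ≤ n → 1 ≤ y → y ≤ n →
        z.mem (N + 14) (x * S + y) = ind (Relation.ReflTransGen (NumAdj G num) x y)) ∧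
      t ≤ (2 * (mm.closure N).clockCost + 600) *
        min ((ρ + 500) * (S * S)) (n * m + n * n + 1) + 40 * (S * S) := by
  obtain ⟨p, hp⟩ := hp
  have hnum := h.numbering
  have hfr : ∀ j, ¬ mm.Writes (.reg (N + j)) := fun j h => by
    have := hN _ h.uses; simp [Loc.idx] at this
  have hfm : ∀ j, ¬ mm.Writes (.mem (N + j)) := fun j h => by
    have := hN _ h.uses; simp [Loc.idx] at this
  have hfq : ∀ j, ¬ mm.Writes (.rmem (N + j)) := fun j h => by
    have := hN _ h.uses; simp [Loc.idx] at this
  have hclosure : ∀ l, ¬ (mm.closure N).Writes l → l ≠ .reg (N + 20) → l ≠ .reg (N + 20 + 1) →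
      ¬ ((mm.closure N).clock (N + 20)).Writes l := fun l h1 h2 h3 h4 => by
    rcases Prog.clock_writes h4 with h | h | h <;> contradiction
  set F := n * m + n * n + 1 with hF
  refine Run.seq (Run.of_wp ⟨?_, ?_⟩)
  · simp [h.size, h.edges]
    omega
  have hval : WExp.val s (.add (.mul (.reg (N + 10)) (.reg (N + 11)))
      (.add (.mul (.reg (N + 10)) (.reg (N + 10))) (.const 1))) = F := by
    simp [h.size, h.edges, hF, add_assoc]
  rw [hval]
  refine Run.seq ?_
  intro hv
  have h₀ : Saved G num N (s.setReg (N + 20) F) :=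
    ⟨hnum, by simp [h.size], by simp [h.edges], by simp [h.sources], h.tail, h.head, h.number,
      h.weight⟩
  obtain ⟨s', T, e, v', hT, bT⟩ := Prog.closure_run (s := s.setReg (N + 20) F) hN
    (fun x y h => h.lt hnum) hmm hp (by simp [hS]) hW hAD hv
  obtain ⟨z, u, e', u1, u2, u3, u4⟩ := e.clock (by omega) (closure_not_uses hN (j := 20) (by omega))
    (closure_not_uses hN (j := 21) (by omega)) _ ⟨fun _ _ _ => rfl, rfl, rfl, rfl⟩ hv
  have hFr : Frame ((mm.closure N).clock (N + 20)) (s.setReg (N + 20) F) z := fun l hl => e'.agree hl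
  refine ⟨z, u, e', e'.valid hv, ?_⟩
  have hz : Saved G num N z := by
    refine h₀.congr hFr ?_ ?_ ?_ ?_ ?_ ?_ ?_ <;>
    exact hclosure _ (by simp [Prog.closure, Prog.identity, Prog.join, Prog.product, hfr, hfm, hfq])
      (by simp) (by simp)
  have z13 : z.reg (N + 13) = S := by
    rw [hFr.reg _ (hclosure _ (by simp [Prog.closure, Prog.identity, Prog.join, Prog.product, hfr])
      (by simp) (by simp))]
    simp [hS]
  have zm13 : z.mem (N + 13) = s.mem (N + 13) := by
    rw [hFr.mem _ (hclosure _ (by simp [Prog.closure, Prog.identity, Prog.join, Prog.product, hfm])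
      (by simp) (by simp))]
    rfl
  simp only [State.setReg_reg, if_true] at u1 u2 u3
  set κ := (mm.closure N).clockCost
  set M := min ((ρ + 500) * (S * S)) F with hM
  have hused : F - z.reg (N + 20) ≤ M := by
    rw [hM, le_min_iff]
    omega
  have hSS : 1 ≤ S * S := Nat.mul_pos (by omega) (by omega)
  have hM1 : 1 ≤ M := by
    rw [hM, le_min_iff]
    exact ⟨Nat.mul_pos (by omega) hSS, by omega⟩
  have hu : u ≤ 2 * κ * M := by
    refine u3.trans ?_
    have := Nat.mul_le_mul_left κ (show 1 + (F - z.reg (N + 20)) ≤ 2 * M by omega)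
    calc κ * (1 + (F - z.reg (N + 20))) ≤ κ * (2 * M) := this
      _ = 2 * κ * M := by ring
  rw [add_mul (2 * κ)]
  rcases Nat.eq_zero_or_pos (z.reg (N + 20)) with h0 | hpos
  -- Exhausted fuel means that all `F` units were used, while at most `M` can be used. So the
  -- minimum is attained by the column method.
  · have hMF : M = F := le_antisymm (min_le_right _ _) (by omega)
    have hlt : ∀ x < S, ∀ y < S, z.mem (N + 13) (x * S + y) = ind (NumAdj G num x y) := by
      rw [zm13]; exact hAD
    intro hvz
    obtain ⟨w, t, ew, vw, ⟨c, bt⟩, Fw⟩ := (Prog.columns_run (fun x y h => h.lt hnum)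
      (fun x y h => h.bounds hnum) hz.size z13 hnS hW (sum_ind_numAdj_le G num) hlt).frame hvz
    refine ⟨w, _, .branch_true (c := .eq (.reg (N + 20)) (.const 0)) ⟨hvz.1 _, show 0 < W by omega⟩ h0 ew, vw, ?_, ?_, c, ?_⟩
    · exact hz.congr Fw (by simp [Prog.columns, Prog.identity, Prog.addColumn])
        (by simp [Prog.columns, Prog.identity, Prog.addColumn])
        (by simp [Prog.columns, Prog.identity, Prog.addColumn])
        (by simp [Prog.columns, Prog.identity, Prog.addColumn])
        (by simp [Prog.columns, Prog.identity, Prog.addColumn])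
        (by simp [Prog.columns, Prog.identity, Prog.addColumn])
        (by simp [Prog.columns, Prog.identity, Prog.addColumn])
    · rw [Fw.reg _ (by simp [Prog.columns, Prog.identity, Prog.addColumn])]
      exact z13
    · have e1 : n ≤ n * n := Nat.le_mul_of_pos_left n hn
      have e2 : m ≤ n * m := Nat.le_mul_of_pos_left m hn
      have e3 : m * n = n * m := mul_comm m n
      simp only [Cond.cost, WExp.cost]
      omega
  · refine Run.of_wp ⟨⟨trivial, show 0 < W by omega⟩, fun hc => ?_, fun hc => ?_⟩
    · simp at hc
      omega
    · have hsim := u4 hpos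
      refine ⟨hz, z13, fun x y _ hx _ hy => ?_, ?_⟩
      · rw [hsim.2.1]
        exact hT x (by omega) y (by omega)
      · simp only [Cond.cost, WExp.cost]
        omega

/-- The subroutine that finds the ancestors. -/
def findAncestors (mm : Prog) (N : ℕ) : Prog := .block [
  save N, findSize N, adjacency N, reachability mm N, restore N, extract N]

theorem findAncestors_run (hN : ∀ l, mm.Uses l → l.idx < N) (hn : 1 ≤ n) (hG : HoldsGraph G s)
    (hnum : HoldsNumbering G num s) (hW : 4 * (n * n) + n * m + 2 < W)
    (hmm : ∀ b, 1 ≤ b → b ≤ 2 * n → Multiplies W mm b (ρ * (b * b))) :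
    Run W (findAncestors mm N) s fun z t => HoldsGraph G z ∧ HoldsNumbering G num z ∧
      HoldsAncestors G num z ∧ t ≤ (2 * (mm.closure N).clockCost + 600) *
        min (4 * (ρ + 500) * (n * n)) (n * m + n * n + 1) + 1000 * (n * n) := by
  have hnn : n ≤ n * n := Nat.le_mul_of_pos_left n hn
  have hm := G.edges_le
  refine Run.seq ((save_run hG hnum).mono ?_)
  rintro z₁ t₁ - ⟨h₁, b₁⟩
  refine Run.seq ((findSize_run hn h₁.size (by omega)).frame.mono ?_)
  rintro z₂ t₂ - ⟨⟨hp, l₂, g₂, b₂⟩, F₂⟩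
  have h₂ := h₁.congr F₂ (by simp [findSize]) (by simp [findSize]) (by simp [findSize])
    (by simp [findSize]) (by simp [findSize]) (by simp [findSize]) (by simp [findSize])
  generalize hS : z₂.reg (N + 13) = S at *
  have hSS : S * S ≤ 4 * (n * n) := by
    calc S * S ≤ (2 * n) * (2 * n) := Nat.mul_le_mul g₂ g₂
      _ = 4 * (n * n) := by ring
  refine Run.seq ((adjacency_run h₂ hS l₂ (by omega)).frame.mono ?_)
  rintro z₃ t₃ - ⟨⟨a₃, b₃⟩, F₃⟩
  have h₃ := h₂.congr F₃ (by simp [adjacency]) (by simp [adjacency]) (by simp [adjacency])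
    (by simp [adjacency]) (by simp [adjacency]) (by simp [adjacency]) (by simp [adjacency])
  refine Run.seq ((reachability_run (S := S) hN hn h₃
    (by rw [F₃.reg _ (by simp [adjacency])]; exact hS) hp l₂ (by omega) (by omega)
    (fun b h h' => hmm b h (h'.trans g₂)) a₃).mono ?_)
  rintro z₄ t₄ - ⟨h₄, r₄, T₄, b₄⟩
  refine Run.seq ((restore_run h₄).frame.mono ?_)
  rintro z₅ t₅ - ⟨⟨G₅, N₅, b₅⟩, F₅⟩
  have r₅ : z₅.reg (N + 13) = S := by
    rw [F₅.reg _ (by simp [restore, Prog.copy, Prog.rcopy])]; exact r₄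
  have T₅ : z₅.mem (N + 14) = z₄.mem (N + 14) := F₅.mem _ (by simp [restore, Prog.copy, Prog.rcopy])
  refine (extract_run N₅ G₅.size r₅ l₂ (by omega) (by rw [T₅]; exact T₄)).frame.mono ?_
  rintro z₆ t₆ - ⟨⟨A₆, b₆⟩, F₆⟩
  refine ⟨⟨?_, ?_, ?_, ?_, ?_⟩, ⟨N₅.numbering, ?_, ?_⟩, A₆, ?_⟩
  · rw [F₆.reg 0 (by simp [extract, extractRow])]; exact G₅.size
  · rw [F₆.reg 1 (by simp [extract, extractRow])]; exact G₅.edges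
  · rw [F₆.mem 0 (by simp [extract, extractRow])]; exact G₅.tail
  · rw [F₆.mem 1 (by simp [extract, extractRow])]; exact G₅.head
  · rw [F₆.rmem 0 (by simp [extract, extractRow])]; exact G₅.weight
  · rw [F₆.mem 2 (by simp [extract, extractRow])]; exact N₅.number
  · rw [F₆.reg 2 (by simp [extract, extractRow])]; exact N₅.sources
  · have hmin : min ((ρ + 500) * (S * S)) (n * m + n * n + 1) ≤
        min (4 * (ρ + 500) * (n * n)) (n * m + n * n + 1) := by
      refine min_le_min_right _ ?_
      calc (ρ + 500) * (S * S) ≤ (ρ + 500) * (4 * (n * n)) := Nat.mul_le_mul_left _ hSS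
        _ = 4 * (ρ + 500) * (n * n) := by ring
    have := Nat.mul_le_mul_left (2 * (mm.closure N).clockCost + 600) hmin
    omega

end Apsp

/-! ### The exponent of matrix multiplication is at least two -/

namespace RealRam

variable {W : ℕ}

/-- A program that multiplies matrices has to write the product, so that `ω` is at least `2`. -/
theorem sq_le_of_multiplies {ω C : ℝ} {mm : Prog} {κ : ℕ}
    (h : ∀ n : ℕ, 1 ≤ n → ∀ W : ℕ, (n + 2) ^ κ ≤ W →
      ∀ (A B : Matrix (Fin n) (Fin n) ℕ) (s : State), s.Valid W →
        (∀ i j, A i j ≤ 1) → (∀ i j, B i j ≤ 1) → s.reg 0 = n →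
        (∀ i j : Fin n, s.mem 0 (i * n + j) = A i j) →
        (∀ i j : Fin n, s.mem 1 (i * n + j) = B i j) →
        ∃ s' t, Exec W mm s s' t ∧ (∀ i j : Fin n, s'.mem 2 (i * n + j) = (A * B) i j) ∧
          (t : ℝ) ≤ C * (n : ℝ) ^ ω) {n : ℕ} (hn : 1 ≤ n) : (n : ℝ) ^ 2 ≤ C * (n : ℝ) ^ ω := by
  classical
  -- Two zero matrices are multiplied while the array for the product is filled with ones, so every
  -- one of its `n * n` relevant cells must be overwritten.
  let s : State := ⟨fun x => if x = 0 then n else 0, fun a _ => if a = 2 then 1 else 0,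
    fun _ => 0, fun _ _ => 0⟩
  have hs : s.Valid ((n + 2) ^ κ + (n + 2)) := by
    refine ⟨fun x => ?_, fun a i => ?_⟩
    · simp only [s]; split_ifs <;> omega
    · simp only [s]; split_ifs <;> omega
  obtain ⟨s', t, e, h1, h2⟩ := h n hn _ (Nat.le_add_right _ _) 0 0 s hs (by simp) (by simp)
    (by simp [s]) (by simp [s]) (by simp [s])
  obtain ⟨F, hF, hchanged⟩ := e.exists_changed
  have hsub : (Finset.range (n * n)).image (fun k => (2, k)) ⊆ F := by
    intro p hp
    obtain ⟨k, hk, rfl⟩ := Finset.mem_image.1 hp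
    by_contra hnot
    obtain ⟨hi, hj⟩ := divMod_lt (Finset.mem_range.1 hk)
    have h3 := h1 ⟨_, hi⟩ ⟨_, hj⟩
    simp only [Nat.div_add_mod' k n] at h3
    rw [hchanged _ _ hnot] at h3
    simp [s] at h3
  have hcard := Finset.card_le_card hsub
  rw [Finset.card_image_of_injective _ (fun a b h => by simpa using h), Finset.card_range] at hcard
  have : ((n * n : ℕ) : ℝ) ≤ t := by exact_mod_cast hcard.trans hF
  push_cast at this
  nlinarith

/-- For a smaller exponent, `n ^ (2 - ω)` would be bounded by `C`, although it tends to infinity. -/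
theorem two_le_of_sq_le {ω C : ℝ} (h : ∀ n : ℕ, 1 ≤ n → (n : ℝ) ^ 2 ≤ C * (n : ℝ) ^ ω) :
    2 ≤ ω := by
  by_contra hω
  have ht := (tendsto_rpow_atTop (show 0 < 2 - ω by linarith)).comp tendsto_natCast_atTop_atTop
  obtain ⟨n, hn, hC⟩ := ((Filter.eventually_ge_atTop 1).and
    (ht.eventually (Filter.eventually_gt_atTop C))).exists
  have hpos : (0 : ℝ) < n := by exact_mod_cast hn
  have h1 := h n hn
  have h2 : (n : ℝ) ^ 2 = (n : ℝ) ^ (2 - ω) * (n : ℝ) ^ ω := by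
    rw [← Real.rpow_add hpos, sub_add_cancel, Real.rpow_two]
  rw [h2] at h1
  exact absurd (le_of_mul_le_mul_right h1 (Real.rpow_pos_of_pos hpos ω)) (not_le.2 hC)

end RealRam

/-! ### Time bounds in terms of real exponents -/

namespace Apsp

open RealRam

variable {n m : ℕ} {G : RealDag n m} {num : Fin n → ℕ} {W : ℕ} {s : State} {ω : ℝ}

/-- Since `ω ≥ 2`, products of size `b ≤ 2 * n` take time at most `C * (2 * n) ^ (ω - 2) * b ^ 2`,
which is the quadratic form required by the block method. Both time bounds hold for the same run, so
their minimum is available. -/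
theorem exists_findsAncestors (hω : MatMulTime ω) : 2 ≤ ω ∧ ∃ (ancestors : Prog) (κ : ℕ) (K : ℝ),
    0 ≤ K ∧ ∀ (n m : ℕ) (G : RealDag n m) (num : Fin n → ℕ), 1 ≤ n → ∀ W : ℕ, (n + 2) ^ κ ≤ W →
    ∀ s : State, HoldsGraph G s → HoldsNumbering G num s →
      Run W ancestors s fun z t => HoldsGraph G z ∧ HoldsNumbering G num z ∧
        HoldsAncestors G num z ∧ (t : ℝ) ≤ K * (n : ℝ) ^ ω ∧ (t : ℝ) ≤ K * (n * m + (n : ℝ) ^ 2) := by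
  obtain ⟨mm, C, κ, hmm⟩ := hω
  have hsq : ∀ n : ℕ, 1 ≤ n → (n : ℝ) ^ 2 ≤ C * (n : ℝ) ^ ω := fun n => sq_le_of_multiplies hmm
  have h2 := two_le_of_sq_le hsq
  have hC : 0 ≤ C := by
    have := hsq 1 le_rfl
    simp at this
    linarith
  obtain ⟨N, hN⟩ := mm.exists_bound
  obtain ⟨c, hc⟩ : ∃ c, 2 * (mm.closure N).clockCost + 600 = c := ⟨_, rfl⟩
  -- Blocks reach the size `2 * n`, and `b + 2 ≤ (n + 2) ^ 2` for them, hence the factor `2` in the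
  -- exponent. The summand `3` provides room for table indices and for the fuel.
  refine ⟨h2, findAncestors mm N, 2 * κ + 3, c * (4 * (C * 2 ^ (ω - 2) + 501)) + 1000 + c * 2,
    by positivity, ?_⟩
  intro n m G num hn W hW s hG hnum
  have hpos : (0 : ℝ) < n := by exact_mod_cast hn
  have hn1 : (1 : ℝ) ≤ n := by exact_mod_cast hn
  have hm := G.edges_le
  have hW3 : (n + 2) ^ 3 ≤ W := (Nat.pow_le_pow_right (by omega) (by omega)).trans hW
  have hWκ : ∀ b ≤ 2 * n, (b + 2) ^ κ ≤ W := fun b hb => by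
    refine le_trans ?_ ((Nat.pow_le_pow_right (n := n + 2) (by omega)
      (show 2 * κ ≤ 2 * κ + 3 by omega)).trans hW)
    rw [pow_mul]
    exact Nat.pow_le_pow_left (by nlinarith) _
  have hW4 : 4 * (n * n) + n * m + 2 < W := by
    have := Nat.mul_le_mul_left n hm
    have e : (n + 2) ^ 3 = n * (n * n) + 6 * (n * n) + 12 * n + 8 := by ring
    omega
  -- Rounding up makes the factor an integer for the program logic; the resulting summand `1` turns
  -- `500` into `501` below.
  set ρ := ⌈C * (2 * n : ℝ) ^ (ω - 2)⌉₊ with hρ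
  have hmul : ∀ b, 1 ≤ b → b ≤ 2 * n → Multiplies W mm b (ρ * (b * b)) := by
    intro b hb hbn A B z hA hB h0 hA' hB' hz
    obtain ⟨z', t, e, hp, ht⟩ := hmm b hb W (hWκ b hbn) (.of fun i j => A i j) (.of fun i j => B i j) z hz
      (fun i j => hA _ _) (fun i j => hB _ _) h0 (fun i j => hA' _ i.2 _ j.2)
      fun i j => hB' _ i.2 _ j.2
    refine ⟨z', t, e, e.valid hz, fun i hi j hj => ?_, ?_⟩
    · rw [hp ⟨i, hi⟩ ⟨j, hj⟩, Matrix.mul_apply, Finset.sum_range]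
      rfl
    · have hb0 : (0 : ℝ) < b := by exact_mod_cast hb
      have h3 : (b : ℝ) ^ ω = (b : ℝ) ^ (ω - 2) * (b * b) := by
        rw [← sq, ← Real.rpow_two, ← Real.rpow_add hb0, sub_add_cancel]
      have h4 : (b : ℝ) ^ (ω - 2) ≤ (2 * n : ℝ) ^ (ω - 2) :=
        Real.rpow_le_rpow hb0.le (by exact_mod_cast hbn) (by linarith)
      have h5 : C * (2 * n : ℝ) ^ (ω - 2) ≤ ρ := Nat.le_ceil _
      have h6 : (t : ℝ) ≤ ρ * (b * b) := by
        refine ht.trans ?_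
        rw [h3, ← mul_assoc]
        exact mul_le_mul_of_nonneg_right ((mul_le_mul_of_nonneg_left h4 hC).trans h5)
          (by positivity)
      exact_mod_cast h6
  refine (findAncestors_run hN hn hG hnum hW4 hmul).mono ?_
  rintro z t - ⟨h3, h4, h5, ht⟩
  rw [hc] at ht
  have hsq' : (n : ℝ) ^ 2 ≤ (n : ℝ) ^ ω := by
    rw [← Real.rpow_two]
    exact Real.rpow_le_rpow_of_exponent_le hn1 h2
  have hnn : (n : ℝ) * n = (n : ℝ) ^ 2 := (sq _).symm
  have hD : 0 ≤ C * (2 : ℝ) ^ (ω - 2) := by positivity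
  refine ⟨h3, h4, h5, ?_, ?_⟩
  · have h6 : t ≤ c * (4 * (ρ + 500) * (n * n)) + 1000 * (n * n) :=
      ht.trans (Nat.add_le_add_right (Nat.mul_le_mul_left _ (min_le_left _ _)) _)
    have h7 : (t : ℝ) ≤ c * (4 * (ρ + 500) * (n * n)) + 1000 * (n * n) := by exact_mod_cast h6
    have h8 : (ρ : ℝ) ≤ C * (2 * n : ℝ) ^ (ω - 2) + 1 :=
      (Nat.ceil_lt_add_one (by positivity)).le
    have h9 : (n : ℝ) ^ (ω - 2) * (n : ℝ) ^ 2 = (n : ℝ) ^ ω := by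
      rw [← Real.rpow_two, ← Real.rpow_add hpos, sub_add_cancel]
    have h10 : ((ρ : ℝ) + 500) * (n : ℝ) ^ 2 ≤ (C * 2 ^ (ω - 2) + 501) * (n : ℝ) ^ ω := by
      rw [Real.mul_rpow (by norm_num) hpos.le, ← mul_assoc] at h8
      calc ((ρ : ℝ) + 500) * (n : ℝ) ^ 2
          ≤ (C * 2 ^ (ω - 2) * (n : ℝ) ^ (ω - 2) + 501) * (n : ℝ) ^ 2 :=
            mul_le_mul_of_nonneg_right (by linarith) (by positivity)
        _ = C * 2 ^ (ω - 2) * ((n : ℝ) ^ (ω - 2) * (n : ℝ) ^ 2) + 501 * (n : ℝ) ^ 2 := by ring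
        _ ≤ (C * 2 ^ (ω - 2) + 501) * (n : ℝ) ^ ω := by rw [h9]; linarith
    have hc0 : (0 : ℝ) ≤ c := Nat.cast_nonneg _
    have h11 := mul_le_mul_of_nonneg_left h10 hc0
    have h12 : 0 ≤ (c : ℝ) * 2 * (n : ℝ) ^ ω := by positivity
    rw [hnn] at h7
    linarith
  · have h6 : t ≤ c * (n * m + n * n + 1) + 1000 * (n * n) :=
      ht.trans (Nat.add_le_add_right (Nat.mul_le_mul_left _ (min_le_right _ _)) _)
    have h7 : (t : ℝ) ≤ c * (n * m + n * n + 1) + 1000 * (n * n) := by exact_mod_cast h6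
    rw [hnn] at h7
    have hc0 : (0 : ℝ) ≤ c := Nat.cast_nonneg _
    have h8 : (1 : ℝ) ≤ (n : ℝ) ^ 2 := one_le_pow₀ hn1
    have h9 : (c : ℝ) * (n * m + (n : ℝ) ^ 2 + 1) ≤ c * 2 * (n * m + (n : ℝ) ^ 2) := by
      have : (0 : ℝ) ≤ n * m := by positivity
      rw [mul_assoc]
      exact mul_le_mul_of_nonneg_left (by linarith) hc0
    have h10 : 0 ≤ (c : ℝ) * (4 * (C * 2 ^ (ω - 2) + 501)) * (n * m + (n : ℝ) ^ 2) := by positivity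
    have h11 : (0 : ℝ) ≤ n * m := by positivity
    linarith

theorem sum_indeg (G : RealDag n m) : ∑ v, indeg G v = m := by
  have := Finset.card_eq_sum_card_fiberwise (f := G.head) (s := Finset.univ) (t := Finset.univ)
    (by simp)
  simpa [indeg] using this.symm

theorem indeg_le (G : RealDag n m) (v : Fin n) : indeg G v ≤ n := by
  have : indeg G v ≤ (Finset.univ : Finset (Fin n)).card :=
    Finset.card_le_card_of_injOn G.tail (by simp) fun e he e' he' h => by
      simp only [Finset.coe_filter, Finset.mem_univ, true_and, Set.mem_ofPred_eq] at he he'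
      exact RealDag.edge_ext h (he.trans he'.symm)
  simpa using this

/-- Bound every leaf count by the maximum and use that the in-degrees sum to `m`. The absolute value
is there because the sign of `a` is not prescribed. -/
theorem sum_indeg_mul_leaf_le_max {a α : ℝ} (hn : 1 ≤ n)
    (h : ∀ v, ((G.leaf num v).ncard : ℝ) ≤ a * (n : ℝ) ^ α) :
    ((∑ v, indeg G v * (G.leaf num v).ncard : ℕ) : ℝ) ≤ |a| * (m * (n : ℝ) ^ α) := by
  have h1 : ∀ v, (indeg G v : ℝ) * (G.leaf num v).ncard ≤ indeg G v * (|a| * (n : ℝ) ^ α) :=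
    fun v => mul_le_mul_of_nonneg_left ((h v).trans (mul_le_mul_of_nonneg_right (le_abs_self a)
      (by positivity))) (Nat.cast_nonneg _)
  push_cast
  refine (Finset.sum_le_sum fun v _ => h1 v).trans ?_
  rw [← Finset.sum_mul, ← Nat.cast_sum, sum_indeg]
  exact le_of_eq (by ring)

/-- Bound every in-degree by `n`; the sum of the leaf counts is `n` times their mean, which gives
the exponent `2 + β`. -/
theorem sum_indeg_mul_leaf_le_mean {b β : ℝ} (hn : 1 ≤ n)
    (h : (∑ v, ((G.leaf num v).ncard : ℝ)) / n ≤ b * (n : ℝ) ^ β) :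
    ((∑ v, indeg G v * (G.leaf num v).ncard : ℕ) : ℝ) ≤ |b| * (n : ℝ) ^ (2 + β) := by
  have hpos : (0 : ℝ) < n := by exact_mod_cast hn
  have h1 : ∀ v, (indeg G v : ℝ) * (G.leaf num v).ncard ≤ n * (G.leaf num v).ncard :=
    fun v => mul_le_mul_of_nonneg_right (by exact_mod_cast indeg_le G v) (Nat.cast_nonneg _)
  push_cast
  refine (Finset.sum_le_sum fun v _ => h1 v).trans ?_
  rw [← Finset.mul_sum]
  rw [div_le_iff₀ hpos] at h
  calc (n : ℝ) * ∑ v, ((G.leaf num v).ncard : ℝ) ≤ n * (b * (n : ℝ) ^ β * n) :=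
        mul_le_mul_of_nonneg_left h hpos.le
    _ = b * (n : ℝ) ^ (2 + β) := by rw [Real.rpow_add hpos, Real.rpow_two]; ring
    _ ≤ |b| * (n : ℝ) ^ (2 + β) := mul_le_mul_of_nonneg_right (le_abs_self b) (by positivity)

end Apsp

/-! ### The corollary -/

open RealRam Apsp in
theorem mainTheorem4 (ω : ℝ) (hω : MatMulTime ω) :
    (∃ number : Prog, NumbersVertices number) ∧
    ∃ ancestors : Prog, FindsAncestors ancestors ∧
      ∀ number : Prog, NumbersVertices number →
        ∃ κ : ℕ, ∀ a b : ℝ, ∃ C : ℝ, ∀ (n m : ℕ) (G : RealDag n m), 1 ≤ n →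
          ∀ W : ℕ, (n + 2) ^ κ ≤ W → ∀ s : State, s.Valid W → HoldsGraph G s →
            ∃ (num : Fin n → ℕ) (s' : State) (t : ℕ),
              Exec W (algorithm2 number ancestors) s s' t ∧
              HoldsNumbering G num s' ∧ HoldsSolution G num s' ∧
              ∀ α β : ℝ, 2 ≤ n →
                (∀ v, ((G.leaf num v).ncard : ℝ) ≤ a * (n : ℝ) ^ α) →
                (∑ v, ((G.leaf num v).ncard : ℝ)) / n ≤ b * (n : ℝ) ^ β →
                (t : ℝ) ≤ C * (min ((n : ℝ) ^ ω) (n * m + (n : ℝ) ^ 2 * Real.log n) +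
                  min (m * (n : ℝ) ^ α) ((n : ℝ) ^ (2 + β))) := by
  obtain ⟨h2, ancestors, κ, K, hK, hanc⟩ := exists_findsAncestors hω
  refine ⟨⟨kahn, numbersVertices_kahn⟩, ancestors, ⟨κ, fun n m G num hn W hW s hs hG hN => ?_⟩, ?_⟩
  · obtain ⟨z, t, e, -, h1, h2, h3, -⟩ := hanc n m G num hn W hW s hG hN hs
    exact ⟨z, t, e, h1, h2, h3⟩
  rintro number ⟨C₁, κ₁, hnumber⟩
  -- The summands of the constant pay for the numbering, the ancestors, the terms in `n²` and `m` of
  -- the search, and the searches charged to leaves. The exponents `α` and `β` do not enter.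
  refine ⟨κ + κ₁ + 3, fun a b => ⟨4 * |C₁| + 2 * K + 4200 + 200 * (|a| + |b|), ?_⟩⟩
  intro n m G hn W hW s hs hG
  have hle : ∀ k ≤ κ + κ₁ + 3, (n + 2) ^ k ≤ W := fun k hk =>
    (Nat.pow_le_pow_right (by omega) hk).trans hW
  obtain ⟨num, s₁, t₁, e₁, G₁, N₁, b₁⟩ := hnumber n m G hn W (hle _ (by omega)) s hs hG
  obtain ⟨s₂, t₂, e₂, v₂, G₂, N₂, A₂, b₂, b₂'⟩ := hanc n m G num hn W (hle _ (by omega)) s₁ G₁ N₁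
    (e₁.valid hs)
  have hm := G.edges_le
  have hW3 : (n + 1) * (n + 1) + m + 2 < W := by
    refine lt_of_lt_of_le ?_ (hle 3 (by omega))
    have e : (n + 2) ^ 3 = n * (n * n) + 6 * (n * n) + 12 * n + 8 := by ring
    have e' : (n + 1) * (n + 1) = n * n + 2 * n + 1 := by ring
    omega
  obtain ⟨s₃, t₃, e₃, v₃, N₃, S₃, b₃⟩ := searchPart_run hn G₂ N₂ A₂ hW3 v₂
  refine ⟨num, s₃, t₁ + (t₂ + t₃), algorithm2_eq number ancestors ▸ e₁.seq (e₂.seq e₃), N₃, S₃, ?_⟩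
  intro α β hn2 hα hβ
  have hpos : (0 : ℝ) < n := by exact_mod_cast hn
  have hn1 : (1 : ℝ) ≤ n := by exact_mod_cast hn
  -- The subroutines achieve `n²` where the claim allows `n² log n`. The condition `n ≥ 2` serves
  -- only to compare the two.
  have hlog : (1 : ℝ) / 2 ≤ Real.log n := by
    have h3 : Real.log 2 ≤ Real.log n := Real.log_le_log (by norm_num) (by exact_mod_cast hn2)
    have := Real.log_two_gt_d9
    linarith
  set M := min ((n : ℝ) ^ ω) (n * m + (n : ℝ) ^ 2 * Real.log n) with hM
  set L := min (m * (n : ℝ) ^ α) ((n : ℝ) ^ (2 + β)) with hL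
  have hnm : (0 : ℝ) ≤ n * m := by positivity
  have hsq : (n : ℝ) ^ 2 ≤ 2 * ((n : ℝ) ^ 2 * Real.log n) := by nlinarith [sq_nonneg (n : ℝ)]
  have hsqω : (n : ℝ) ^ 2 ≤ (n : ℝ) ^ ω := by
    rw [← Real.rpow_two]
    exact Real.rpow_le_rpow_of_exponent_le hn1 h2
  have hM2 : (n : ℝ) ^ 2 ≤ 2 * M := by
    rw [hM, mul_min_of_nonneg _ _ (by norm_num : (0 : ℝ) ≤ 2), le_min_iff]
    constructor
    · have : (0 : ℝ) ≤ (n : ℝ) ^ ω := by positivity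
      linarith
    · linarith
  have hmR : (m : ℝ) ≤ (n : ℝ) ^ 2 := by rw [sq]; exact_mod_cast hm
  have hnR : (n : ℝ) ≤ (n : ℝ) ^ 2 := by nlinarith
  have hM0 : 0 ≤ M := by nlinarith [sq_nonneg (n : ℝ)]
  -- Linear time is dominated by `M`, as `n + m ≤ 2 * n ^ 2 ≤ 4 * M`.
  have c₁ : (t₁ : ℝ) ≤ 4 * |C₁| * M := by
    calc (t₁ : ℝ) ≤ C₁ * (n + m) := b₁
      _ ≤ |C₁| * (4 * M) := mul_le_mul (le_abs_self _) (by linarith) (by positivity) (abs_nonneg _)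
      _ = 4 * |C₁| * M := by ring
  have c₂ : (t₂ : ℝ) ≤ 2 * K * M := by
    have h3 : (n : ℝ) ^ ω ≤ 2 * (n : ℝ) ^ ω := by
      have : (0 : ℝ) ≤ (n : ℝ) ^ ω := by positivity
      linarith
    have h4 : (n : ℝ) * m + (n : ℝ) ^ 2 ≤ 2 * (n * m + (n : ℝ) ^ 2 * Real.log n) := by linarith
    have h5 : min ((n : ℝ) ^ ω) (n * m + (n : ℝ) ^ 2) ≤ 2 * M := by
      rw [hM, mul_min_of_nonneg _ _ (by norm_num : (0 : ℝ) ≤ 2)]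
      exact min_le_min h3 h4
    calc (t₂ : ℝ) ≤ K * min ((n : ℝ) ^ ω) (n * m + (n : ℝ) ^ 2) := by
          rw [mul_min_of_nonneg _ _ hK]
          exact le_min b₂ b₂'
      _ ≤ K * (2 * M) := mul_le_mul_of_nonneg_left h5 hK
      _ = 2 * K * M := by ring
  -- The two leaf bounds apply to the same sum, so it is below their minimum once they share the
  -- factor `|a| + |b|`.
  have c₃ : ((∑ v, indeg G v * (G.leaf num v).ncard : ℕ) : ℝ) ≤ (|a| + |b|) * L := by
    have h3 := sum_indeg_mul_leaf_le_max hn hα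
    have h4 := sum_indeg_mul_leaf_le_mean hn hβ
    have h5 : (0 : ℝ) ≤ m * (n : ℝ) ^ α := by positivity
    have h6 : (0 : ℝ) ≤ (n : ℝ) ^ (2 + β) := by positivity
    rw [hL, mul_min_of_nonneg _ _ (by positivity), le_min_iff]
    constructor
    · nlinarith [abs_nonneg b]
    · nlinarith [abs_nonneg a]
  have hL0 : 0 ≤ L := le_min (by positivity) (by positivity)
  have c₄ : (t₃ : ℝ) ≤ 2000 * (n : ℝ) ^ 2 + 100 * m +
      200 * ((∑ v, indeg G v * (G.leaf num v).ncard : ℕ) : ℝ) := by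
    rw [sq]
    exact_mod_cast b₃
  have h3 : 0 ≤ (4 * |C₁| + 2 * K + 4200) * L := by positivity
  have h4 : 0 ≤ 200 * (|a| + |b|) * M := by positivity
  push_cast at c₃ c₄ ⊢
  linarith
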